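/- Write $\mathbb N=\{0,1,2,\dots\}$ and let $K\subseteq\{0,1\}^q\times\mathbb{N}^n$ be finite. Let $\langle K\rangle$ be the set of sums of finitely many elements of $K$ (taken in $\mathbb N^q\times\mathbb N^n$) that lie in $\{0,1\}^q\times\mathbb N^n$. Assume: (1) if $(I,m)\in K$ and $I_i=1$, then $(I-e_i,m)\in K$; (2) the elements $(x^m v)^{\pm1}$ with $(0,m)\in K$ generate the $\mathbb C$-algebra $\mathbb C[x_1^{\pm},\dots,x_n^{\pm},v^{\pm}]$; (3) for every $1\le i\le q$ there is an $m^i\in\mathbb N^n$ with $(e_i,m^i)\in\langle K\rangle$. Let $A=\mathbb C[\xi^I x^m v\mid (I,m)\in K]$ be the subalgebra generated by these monomials in the commutative superalgebra $\mathbb C[x_1^\pm,\dots,x_n^\pm,v^\pm,\xi_1,\dots,\xi_q]$, where the $\xi_i$ are odd. Then the superscheme $\operatorname{Spec}A$ is a (not necessarily normal) toric supervariety. That is, it is irreducible, separated, of finite type over $\mathbb C$, reduced and generically fermionically regular; and it carries a left action of a supertorus $T$ and a $T$-equivariant map $T\to\operatorname{Spec}A$ that factors as the quotient $T\to T/H$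 followed by an open immersion $T/H\to\operatorname{Spec}A$, for a closed subgroup $H$ with trivial even part. Moreover, let $c_{ij}=c_{ji}\in\mathbb C^n$ for $1\le i,j\le q$, and let $T_c$ be the supertorus with $\mathbb C[T_c]=\mathbb C[x^\pm,v^\pm,\xi]$ whose odd Lie algebra basis $\theta_1,\dots,\theta_q$ satisfies $[\theta_i,\theta_j]=\sum_l (c_{ij})_l X_l$, where $X_l$ is the basis vector of $\operatorname{Lie}(T_{c,\bar 0})$ belonging to the coordinate $x_l$; on $\mathbb C[T_c]$ the vector $\theta_i$ acts, through left translation, as $\tfrac12\sum_{j}\xi_j\sum_l (c_{ij})_l x_l\frac{\partial}{\partial x_l}-\frac{\partial}{\partial \xi_i}$. Let $\langle\,,\rangle$ be the standard bilinear product. Then there is an action of $T_c$ on $\operatorname{Spec}A$ that, with the map $T_c\to\operatorname{Spec}A$ given by the inclusion $A\subseteq\mathbb C[T_c]$, makes $\operatorname{Spec}A$ a toric supervariety, if and only if $$\langle m,c_{ij}\rangle=0\quad\text{for all } i,j \text{ and all }(I,m)\in K\text{ with } I_j=0\text{ and }(I+e_j,m)\notin K.$$ In particular, $\langle m,c_{ij}\rangle=0$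 must hold for all $i,j$ and all $(I,m)\in K$ with $I_j=0$ and $(I+e_j,m)\notin\langle K\rangle$. -/

import Mathlib

open TopologicalSpace

noncomputable section

universe u v

section SuperRings

/-- A (commutative) superring: a ring `A` with a `ℤ/2`-grading `𝒜` whose homogeneous elements
commute up to the usual sign. -/
class SuperRing {A : Type u} [Ring A] (𝒜 : ZMod 2 → AddSubgroup A) : Prop where
  one_mem : (1 : A) ∈ 𝒜 0
  mul_mem : ∀ {i j : ZMod 2} {a b : A}, a ∈ 𝒜 i → b ∈ 𝒜 j → a * b ∈ 𝒜 (i + j)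
  isCompl : IsCompl (𝒜 0) (𝒜 1)
  even_comm : ∀ {a : A}, a ∈ 𝒜 0 → ∀ b : A, a * b = b * a
  odd_anticomm : ∀ {a b : A}, a ∈ 𝒜 1 → b ∈ 𝒜 1 → a * b = -(b * a)
  odd_sq : ∀ {a : A}, a ∈ 𝒜 1 → a * a = 0

variable {A : Type u} [Ring A] (𝒜 : ZMod 2 → AddSubgroup A) [SuperRing 𝒜]

/-- The even part `A₀`, a subring of `A`. -/
def evenPart : Subring A where
  carrier := 𝒜 0
  one_mem' := SuperRing.one_mem
  mul_mem' ha hb := by simpa using SuperRing.mul_mem (𝒜 := 𝒜) ha hb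
  zero_mem' := (𝒜 0).zero_mem
  add_mem' := (𝒜 0).add_mem
  neg_mem' := (𝒜 0).neg_mem

instance evenPart.instCommRing : CommRing (evenPart 𝒜) :=
  { (inferInstance : Ring (evenPart 𝒜)) with
    mul_comm := fun a b => Subtype.ext (SuperRing.even_comm (𝒜 := 𝒜) a.2 b) }

instance evenPart.instAlgebra : Algebra (evenPart 𝒜) A where
  smul s a := (s : A) * a
  algebraMap := (evenPart 𝒜).subtype
  commutes' s a := SuperRing.even_comm (𝒜 := 𝒜) s.2 a
  smul_def' _ _ := rfl

theorem evenPart_smul_def (s : evenPart 𝒜) (a : A) : s • a = (s : A) * a := rfl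

theorem evenPart_smul_mem (s : evenPart 𝒜) {i : ZMod 2} {a : A} (ha : a ∈ 𝒜 i) :
    s • a ∈ 𝒜 i := by
  have := SuperRing.mul_mem (𝒜 := 𝒜) s.2 ha
  rwa [zero_add] at this

theorem exists_even_add_odd (a : A) : ∃ b ∈ 𝒜 0, ∃ c ∈ 𝒜 1, b + c = a :=
  AddSubgroup.mem_sup.1 ((SuperRing.isCompl (𝒜 := 𝒜)).sup_eq_top ▸ AddSubgroup.mem_top a)

theorem eq_zero_of_even_of_odd {a : A} (h0 : a ∈ 𝒜 0) (h1 : a ∈ 𝒜 1) : a = 0 := by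
  have h : a ∈ 𝒜 0 ⊓ 𝒜 1 := ⟨h0, h1⟩
  rwa [(SuperRing.isCompl (𝒜 := 𝒜)).inf_eq_bot, AddSubgroup.mem_bot] at h

variable (S : Submonoid (evenPart 𝒜))

theorem loc_mk_add (a b : A) (s : S) :
    (LocalizedModule.mk (a + b) s : LocalizedModule S A)
      = LocalizedModule.mk a s + LocalizedModule.mk b s := by
  rw [LocalizedModule.mk_add_mk, ← smul_add, LocalizedModule.mk_cancel_common_left]

theorem loc_one_def : (1 : LocalizedModule S A) = LocalizedModule.mk 1 1 :=
  OreLocalization.one_def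

/-- The grading of the localization `S⁻¹A`: the degree `i` part consists of the fractions
`a / s` with `a` of degree `i`. -/
def locGrading (i : ZMod 2) : AddSubgroup (LocalizedModule S A) where
  carrier := {x | ∃ a ∈ 𝒜 i, ∃ s : S, x = LocalizedModule.mk a s}
  zero_mem' := ⟨0, (𝒜 i).zero_mem, 1, (LocalizedModule.zero_mk 1).symm⟩
  add_mem' := by
    rintro _ _ ⟨a, ha, s, rfl⟩ ⟨b, hb, t, rfl⟩
    exact ⟨_, (𝒜 i).add_mem (evenPart_smul_mem 𝒜 t.1 ha) (evenPart_smul_mem 𝒜 s.1 hb), _,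
      LocalizedModule.mk_add_mk⟩
  neg_mem' := by
    rintro _ ⟨a, ha, s, rfl⟩
    exact ⟨-a, (𝒜 i).neg_mem ha, s, LocalizedModule.mk_neg.symm⟩

instance locGrading.instSuperRing : SuperRing (locGrading 𝒜 S) where
  one_mem := ⟨1, SuperRing.one_mem, 1, loc_one_def 𝒜 S⟩
  mul_mem := by
    rintro i j _ _ ⟨a, ha, s, rfl⟩ ⟨b, hb, t, rfl⟩
    exact ⟨a * b, SuperRing.mul_mem ha hb, s * t, LocalizedModule.mk_mul_mk⟩
  isCompl := by
    constructor
    · rw [disjoint_iff, eq_bot_iff]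
      rintro x ⟨⟨a, ha, s, rfl⟩, b, hb, t, h⟩
      obtain ⟨r, hr⟩ := LocalizedModule.mk_eq.1 h
      have h0 : r • t • a = 0 := by
        apply eq_zero_of_even_of_odd 𝒜
        · exact evenPart_smul_mem 𝒜 r.1 (evenPart_smul_mem 𝒜 t.1 ha)
        · rw [hr]
          exact evenPart_smul_mem 𝒜 r.1 (evenPart_smul_mem 𝒜 s.1 hb)
      rw [AddSubgroup.mem_bot, ← LocalizedModule.zero_mk t, LocalizedModule.mk_eq]
      exact ⟨r, by simpa using h0⟩
    · rw [codisjoint_iff, eq_top_iff]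
      intro x _
      induction x using LocalizedModule.induction_on with
      | h a s =>
        obtain ⟨b, hb, c, hc, rfl⟩ := exists_even_add_odd 𝒜 a
        rw [loc_mk_add]
        exact AddSubgroup.add_mem_sup ⟨b, hb, s, rfl⟩ ⟨c, hc, s, rfl⟩
  even_comm := by
    rintro _ ⟨a, ha, s, rfl⟩ y
    induction y using LocalizedModule.induction_on with
    | h b t =>
      rw [LocalizedModule.mk_mul_mk, LocalizedModule.mk_mul_mk,
        SuperRing.even_comm (𝒜 := 𝒜) ha, mul_comm s t]
  odd_anticomm := by
    rintro _ _ ⟨a, ha, s, rfl⟩ ⟨b, hb, t, rfl⟩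
    rw [LocalizedModule.mk_mul_mk, LocalizedModule.mk_mul_mk,
      SuperRing.odd_anticomm (𝒜 := 𝒜) ha hb, mul_comm s t, LocalizedModule.mk_neg]
  odd_sq := by
    rintro _ ⟨a, ha, s, rfl⟩
    rw [LocalizedModule.mk_mul_mk, SuperRing.odd_sq (𝒜 := 𝒜) ha, LocalizedModule.zero_mk]

/-- The natural ring homomorphism `A → S⁻¹A`. -/
def locMap : A →+* LocalizedModule S A where
  toFun a := LocalizedModule.mk a 1
  map_one' := (loc_one_def 𝒜 S).symm
  map_mul' a b := by rw [LocalizedModule.mk_mul_mk, one_mul]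
  map_zero' := LocalizedModule.zero_mk 1
  map_add' a b := loc_mk_add 𝒜 S a b 1


/-- The set of zero divisors of a ring. For superrings over `ℂ` the left and right zero divisors
are the same elements. -/
def zeroDivisorSet (R : Type u) [Ring R] : Set R := {a | ∃ b : R, b ≠ 0 ∧ a * b = 0}

/-- The multiplicative set of even non-zero-divisors of `A`. -/
def evenNonZeroDivisors : Submonoid (evenPart 𝒜) where
  carrier := {s | ∀ b : A, (s : A) * b = 0 → b = 0}
  one_mem' b hb := by simpa using hb
  mul_mem' {s t} hs ht b hb := ht b (hs _ (by simpa [mul_assoc] using hb))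

/-- The total superring of fractions `K(A)`. -/
abbrev TotalFractions : Type u := LocalizedModule (evenNonZeroDivisors 𝒜) A

/-- The ideal `J_A`: the preimage in `A` of the ideal of `K(A)` generated by the odd part. -/
def superJ : TwoSidedIdeal A :=
  TwoSidedIdeal.comap (locMap 𝒜 (evenNonZeroDivisors 𝒜))
    (TwoSidedIdeal.span (locGrading 𝒜 (evenNonZeroDivisors 𝒜) 1 : Set (TotalFractions 𝒜)))

/-- The underlying ring `A / J_A`. -/
abbrev UnderlyingRing : Type u := (superJ 𝒜).ringCon.Quotient

/-- A superring is reduced if `J_A` is the set of nilpotent elements and the zero divisors of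
`A / J_A` are exactly the images of the zero divisors of `A`. -/
structure IsReducedSuperRing : Prop where
  superJ_eq : (superJ 𝒜 : Set A) = {a | IsNilpotent a}
  image_zeroDivisorSet :
    (superJ 𝒜).ringCon.mk' '' zeroDivisorSet A = zeroDivisorSet (UnderlyingRing 𝒜)

/-- A superring is fermionically regular if it is isomorphic, as a superring, to the exterior
algebra of a module over a commutative ring. -/
def IsFermionicallyRegular {A : Type u} [Ring A] (𝒜 : ZMod 2 → AddSubgroup A) : Prop :=
  ∃ (R : Type u) (_ : CommRing R) (M : Type u) (_ : AddCommGroup M) (_ : Module R M)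
    (e : ExteriorAlgebra R M ≃+* A),
    ∀ (i : ZMod 2) (x : ExteriorAlgebra R M),
      e x ∈ 𝒜 i ↔ x ∈ CliffordAlgebra.evenOdd (0 : QuadraticForm R M) i

end SuperRings

section AffineSuperschemes

variable {A : Type u} [Ring A] (𝒜 : ZMod 2 → AddSubgroup A) [SuperRing 𝒜]

/-- The underlying space `|Spec A| = |Spec A₀|` of the affine superscheme `Spec A`. -/
abbrev SuperSpec : Type u := PrimeSpectrum (evenPart 𝒜)

/-- The stalk of the structure sheaf of `Spec A` at `p`: the localization `A_p`. -/
abbrev SuperStalk (p : SuperSpec 𝒜) : Type u := LocalizedModule p.asIdeal.primeCompl A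

/-- The grading of the stalk `A_p`. -/
abbrev stalkGrading (p : SuperSpec 𝒜) : ZMod 2 → AddSubgroup (SuperStalk 𝒜 p) :=
  locGrading 𝒜 p.asIdeal.primeCompl

/-- A family of germs on `U` is locally a fraction with even denominator. -/
def IsLocalFraction (U : Opens (SuperSpec 𝒜)) (s : ∀ p : U, SuperStalk 𝒜 p.1) : Prop :=
  ∀ p : U, ∃ (V : Opens (SuperSpec 𝒜)) (hVU : V ≤ U), p.1 ∈ V ∧ ∃ (a : A) (f : evenPart 𝒜),
    ∀ r : V, ∃ hf : f ∈ r.1.asIdeal.primeCompl,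
      s ⟨r.1, hVU r.2⟩ = LocalizedModule.mk a ⟨f, hf⟩

/-- The superring `𝒪_A(U)` of sections over `U` of the structure sheaf of `Spec A`, the sheaf
associated with the `A₀`-module `A`. -/
def superSections (U : Opens (SuperSpec 𝒜)) : Subring (∀ p : U, SuperStalk 𝒜 p.1) where
  carrier := {s | IsLocalFraction 𝒜 U s}
  one_mem' p := ⟨U, le_rfl, p.2, 1, 1, fun r => ⟨Submonoid.one_mem _, loc_one_def 𝒜 _⟩⟩
  zero_mem' p := ⟨U, le_rfl, p.2, 0, 1, fun r =>
    ⟨Submonoid.one_mem _, (LocalizedModule.zero_mk _).symm⟩⟩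
  mul_mem' {s t} hs ht p := by
    obtain ⟨V, hV, hpV, a, f, h⟩ := hs p
    obtain ⟨W, hW, hpW, b, g, h'⟩ := ht p
    refine ⟨V ⊓ W, inf_le_left.trans hV, ⟨hpV, hpW⟩, a * b, f * g, fun r => ?_⟩
    obtain ⟨hf, e⟩ := h ⟨r.1, r.2.1⟩
    obtain ⟨hg, e'⟩ := h' ⟨r.1, r.2.2⟩
    refine ⟨Submonoid.mul_mem _ hf hg, ?_⟩
    rw [Pi.mul_apply, e, e', LocalizedModule.mk_mul_mk]
    rfl
  add_mem' {s t} hs ht p := by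
    obtain ⟨V, hV, hpV, a, f, h⟩ := hs p
    obtain ⟨W, hW, hpW, b, g, h'⟩ := ht p
    refine ⟨V ⊓ W, inf_le_left.trans hV, ⟨hpV, hpW⟩, g • a + f • b, f * g, fun r => ?_⟩
    obtain ⟨hf, e⟩ := h ⟨r.1, r.2.1⟩
    obtain ⟨hg, e'⟩ := h' ⟨r.1, r.2.2⟩
    refine ⟨Submonoid.mul_mem _ hf hg, ?_⟩
    rw [Pi.add_apply, e, e', LocalizedModule.mk_add_mk]
    rfl
  neg_mem' {s} hs p := by
    obtain ⟨V, hV, hpV, a, f, h⟩ := hs p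
    refine ⟨V, hV, hpV, -a, f, fun r => ?_⟩
    obtain ⟨hf, e⟩ := h r
    exact ⟨hf, by rw [Pi.neg_apply, e, LocalizedModule.mk_neg]⟩

/-- The grading of `𝒪_A(U)`: a section is of degree `i` if all its germs are. -/
def sectionsGrading (U : Opens (SuperSpec 𝒜)) (i : ZMod 2) :
    AddSubgroup (superSections 𝒜 U) where
  carrier := {s | ∀ p : U, s.1 p ∈ stalkGrading 𝒜 p.1 i}
  zero_mem' p := (stalkGrading 𝒜 p.1 i).zero_mem
  add_mem' hs ht p := (stalkGrading 𝒜 p.1 i).add_mem (hs p) (ht p)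
  neg_mem' hs p := (stalkGrading 𝒜 p.1 i).neg_mem (hs p)

theorem sections_decompose (U : Opens (SuperSpec 𝒜)) (s : superSections 𝒜 U) :
    ∃ s₀ ∈ sectionsGrading 𝒜 U 0, ∃ s₁ ∈ sectionsGrading 𝒜 U 1, s₀ + s₁ = s := by
  have key : ∀ p : U, ∃ b ∈ stalkGrading 𝒜 p.1 0, ∃ c ∈ stalkGrading 𝒜 p.1 1, b + c = s.1 p :=
    fun p => exists_even_add_odd _ _
  choose b hb c hc hbc using key
  have huniq : ∀ (p : U) (b' c' : SuperStalk 𝒜 p.1), b' ∈ stalkGrading 𝒜 p.1 0 →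
      c' ∈ stalkGrading 𝒜 p.1 1 → b' + c' = s.1 p → b p = b' ∧ c p = c' := by
    intro p b' c' hb' hc' h
    have e : b p - b' = c' - c p := by
      rw [sub_eq_sub_iff_add_eq_add, hbc p, ← h, add_comm]
    have h0 : b p - b' = 0 := eq_zero_of_even_of_odd (stalkGrading 𝒜 p.1)
      (sub_mem (hb p) hb') (e ▸ sub_mem hc' (hc p))
    exact ⟨sub_eq_zero.1 h0, (sub_eq_zero.1 (e ▸ h0)).symm⟩
  have hloc : IsLocalFraction 𝒜 U b ∧ IsLocalFraction 𝒜 U c := by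
    constructor <;> intro p <;> obtain ⟨V, hV, hpV, a, f, h⟩ := s.2 p <;>
      obtain ⟨a₀, h₀, a₁, h₁, rfl⟩ := exists_even_add_odd 𝒜 a
    · refine ⟨V, hV, hpV, a₀, f, fun r => ?_⟩
      obtain ⟨hf, e⟩ := h r
      exact ⟨hf, (huniq ⟨r.1, hV r.2⟩ _ _ ⟨a₀, h₀, ⟨f, hf⟩, rfl⟩ ⟨a₁, h₁, ⟨f, hf⟩, rfl⟩
        (by rw [e, loc_mk_add])).1⟩
    · refine ⟨V, hV, hpV, a₁, f, fun r => ?_⟩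
      obtain ⟨hf, e⟩ := h r
      exact ⟨hf, (huniq ⟨r.1, hV r.2⟩ _ _ ⟨a₀, h₀, ⟨f, hf⟩, rfl⟩ ⟨a₁, h₁, ⟨f, hf⟩, rfl⟩
        (by rw [e, loc_mk_add])).2⟩
  exact ⟨⟨b, hloc.1⟩, hb, ⟨c, hloc.2⟩, hc, Subtype.ext (funext hbc)⟩

instance sectionsGrading.instSuperRing (U : Opens (SuperSpec 𝒜)) :
    SuperRing (sectionsGrading 𝒜 U) where
  one_mem p := SuperRing.one_mem (𝒜 := stalkGrading 𝒜 p.1)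
  mul_mem hs ht p := SuperRing.mul_mem (𝒜 := stalkGrading 𝒜 p.1) (hs p) (ht p)
  isCompl := by
    constructor
    · rw [disjoint_iff, eq_bot_iff]
      rintro s ⟨h0, h1⟩
      exact Subtype.ext (funext fun p =>
        eq_zero_of_even_of_odd (stalkGrading 𝒜 p.1) (h0 p) (h1 p))
    · rw [codisjoint_iff, eq_top_iff]
      intro s _
      obtain ⟨b, hb, c, hc, rfl⟩ := sections_decompose 𝒜 U s
      exact AddSubgroup.add_mem_sup hb hc
  even_comm hs t := Subtype.ext (funext fun p =>
    SuperRing.even_comm (𝒜 := stalkGrading 𝒜 p.1) (hs p) (t.1 p))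
  odd_anticomm hs ht := Subtype.ext (funext fun p =>
    SuperRing.odd_anticomm (𝒜 := stalkGrading 𝒜 p.1) (hs p) (ht p))
  odd_sq hs := Subtype.ext (funext fun p =>
    SuperRing.odd_sq (𝒜 := stalkGrading 𝒜 p.1) (hs p))

/-- `Spec A` is reduced: the superring of sections over every affine open is reduced. The affine
opens of `Spec A` are those of the even scheme `Spec A₀`, as the structure sheaf is
quasi-coherent. -/
def IsReducedSuperSpec : Prop :=
  ∀ U : Opens (SuperSpec 𝒜),
    AlgebraicGeometry.IsAffineOpen (X := AlgebraicGeometry.Spec (CommRingCat.of (evenPart 𝒜))) U →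
      IsReducedSuperRing (sectionsGrading 𝒜 U)

/-- `Spec A` is generically fermionically regular: there is a dense set of points at which the
stalks are fermionically regular. -/
def IsGFRSuperSpec : Prop :=
  ∃ Z : Set (SuperSpec 𝒜), closure Z = Set.univ ∧
    ∀ p ∈ Z, IsFermionicallyRegular (stalkGrading 𝒜 p)

/-- `Spec A` is an algebraic supervariety over `ℂ`: a separated superscheme of finite type over
`ℂ` that is generically fermionically regular and reduced. -/
structure IsAffineSupervariety [Algebra ℂ A] : Prop where
  /-- the complex scalars are even, that is, `A` is a superalgebra over `ℂ` -/
  algebraMap_mem : ∀ z : ℂ, algebraMap ℂ A z ∈ 𝒜 0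
  finiteType : Algebra.FiniteType ℂ A
  /-- the diagonal, given by the multiplication map of `A`, is a closed immersion -/
  separated : Function.Surjective (LinearMap.mul' ℂ A)
  gfr : IsGFRSuperSpec 𝒜
  reduced : IsReducedSuperSpec 𝒜

variable {C : Type v} [Ring C] (𝒞 : ZMod 2 → AddSubgroup C) [SuperRing 𝒞]

/-- A homomorphism of superrings; it is the same thing as a morphism
`Spec C → Spec A` of affine superschemes. -/
structure SuperHom {A : Type u} [Ring A] (𝒜 : ZMod 2 → AddSubgroup A)
    {C : Type v} [Ring C] (𝒞 : ZMod 2 → AddSubgroup C) where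
  toRingHom : A →+* C
  map_mem : ∀ (i : ZMod 2) (a : A), a ∈ 𝒜 i → toRingHom a ∈ 𝒞 i

variable {𝒜 𝒞}

/-- The homomorphism `A₀ → C₀` of even parts. -/
def SuperHom.evenHom (φ : SuperHom 𝒜 𝒞) : evenPart 𝒜 →+* evenPart 𝒞 where
  toFun a := ⟨φ.toRingHom a, φ.map_mem 0 a a.2⟩
  map_one' := Subtype.ext (map_one φ.toRingHom)
  map_mul' a b := Subtype.ext (map_mul φ.toRingHom (a : A) (b : A))
  map_zero' := Subtype.ext (map_zero φ.toRingHom)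
  map_add' a b := Subtype.ext (map_add φ.toRingHom (a : A) (b : A))

/-- The map `|Spec C| → |Spec A|` of underlying spaces. -/
def SuperHom.specMap (φ : SuperHom 𝒜 𝒞) : SuperSpec 𝒞 → SuperSpec 𝒜 :=
  PrimeSpectrum.comap φ.evenHom

/-- The map `A_{φ⁻¹(p)} → C_p` of stalks, `a / s ↦ φ a / φ s`. -/
def SuperHom.stalkMap (φ : SuperHom 𝒜 𝒞) (p : SuperSpec 𝒞)
    (x : SuperStalk 𝒜 (φ.specMap p)) : SuperStalk 𝒞 p :=
  LocalizedModule.liftOn x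
    (fun as => LocalizedModule.mk (φ.toRingHom as.1)
      (⟨φ.evenHom as.2, as.2.2⟩ : p.asIdeal.primeCompl)) <| by
    rintro ⟨a, s⟩ ⟨b, t⟩ ⟨r, hr⟩
    rw [LocalizedModule.mk_eq]
    refine ⟨⟨φ.evenHom r, r.2⟩, ?_⟩
    have h : φ.toRingHom ((r : evenPart 𝒜) * ((t : evenPart 𝒜) * a))
        = φ.toRingHom ((r : evenPart 𝒜) * ((s : evenPart 𝒜) * b)) := congrArg φ.toRingHom hr
    rw [map_mul, map_mul, map_mul, map_mul] at h
    exact h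

/-- The morphism `Spec C → Spec A` is an open immersion: it is an open embedding of the underlying
spaces and induces isomorphisms on all stalks. -/
structure SuperHom.IsOpenImmersion (φ : SuperHom 𝒜 𝒞) : Prop where
  isOpenEmbedding : Topology.IsOpenEmbedding φ.specMap
  stalkMap_bijective : ∀ p : SuperSpec 𝒞, Function.Bijective (φ.stalkMap p)

end AffineSuperschemes

section Supertori

/-- A supertorus, given by its Harish-Chandra pair `(T₀, 𝔱)`: `T₀ = (ℂˣ)^p`, `𝔱₀ = ℂ^p` with basis
`x_k`, and `𝔱₁ = ℂ^q` with basis `θ_i`. As `[𝔱₀, 𝔱] = 0` (so that the connected group `T₀` acts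
trivially on `𝔱`, and the Jacobi identity is automatic), the only datum is the symmetric bracket
`[θ_i, θ_j] = ∑ k, bracket i j k • x_k`. -/
@[ext]
structure Supertorus (p q : ℕ) where
  bracket : Fin q → Fin q → Fin p → ℂ
  symm : ∀ i j, bracket i j = bracket j i

/-- The superalgebra `ℂ[T] = ℂ[t₁^±, …, t_p^±, ξ₁, …, ξ_q]`: Laurent polynomials with coefficients
in the exterior algebra on `ξ₁, …, ξ_q`. -/
abbrev TorusRing (p q : ℕ) : Type :=
  AddMonoidAlgebra (ExteriorAlgebra ℂ (Fin q → ℂ)) (Fin p → ℤ)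

variable {p q : ℕ}

/-- The grading of `ℂ[T]`: the `t_k` are even and the `ξ_i` are odd. -/
def torusGrading (p q : ℕ) (i : ZMod 2) : AddSubgroup (TorusRing p q) where
  carrier := {f | ∀ χ, f.coeff χ ∈ CliffordAlgebra.evenOdd (0 : QuadraticForm ℂ (Fin q → ℂ)) i}
  zero_mem' _ := Submodule.zero_mem _
  add_mem' hf hg χ := Submodule.add_mem _ (hf χ) (hg χ)
  neg_mem' hf χ := Submodule.neg_mem _ (hf χ)

/-- The odd coordinate `ξ_i`. -/
def oddCoord (i : Fin q) : TorusRing p q :=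
  AddMonoidAlgebra.single 0 (ExteriorAlgebra.ι ℂ (Pi.single i 1))

/-- The operator that multiplies the `t^χ`-component by `w χ`. -/
def weightScale (w : (Fin p → ℤ) → ℂ) : TorusRing p q →ₗ[ℂ] TorusRing p q where
  toFun f := .ofCoeff (Finsupp.onFinset f.coeff.support (fun χ => w χ • f.coeff χ)
    fun χ h => Finsupp.mem_support_iff.2 fun h' => h (by rw [h', smul_zero]))
  map_add' f g := by
    ext χ : 2
    exact smul_add _ _ _
  map_smul' z f := by
    ext χ : 2
    exact smul_comm _ _ _

/-- The derivation `⟨t∂/∂t, x⟩ = ∑ k, x_k t_k ∂/∂t_k`. -/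
def evenDeriv (x : Fin p → ℂ) : TorusRing p q →ₗ[ℂ] TorusRing p q :=
  weightScale fun χ => ∑ k, (χ k : ℂ) * x k

/-- The odd derivation `∂/∂ξ_i`, the contraction of the coefficients with the `i`-th coordinate
functional. -/
def oddDeriv (i : Fin q) : TorusRing p q →ₗ[ℂ] TorusRing p q where
  toFun f := .ofCoeff (f.coeff.mapRange
    (CliffordAlgebra.contractLeft (Q := (0 : QuadraticForm ℂ (Fin q → ℂ))) (LinearMap.proj i))
    (map_zero _))
  map_add' f g := by
    ext χ : 2
    exact map_add (CliffordAlgebra.contractLeft (Q := (0 : QuadraticForm ℂ (Fin q → ℂ)))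
      (LinearMap.proj i)) (f.coeff χ) (g.coeff χ)
  map_smul' z f := by
    ext χ : 2
    exact map_smul (CliffordAlgebra.contractLeft (Q := (0 : QuadraticForm ℂ (Fin q → ℂ)))
      (LinearMap.proj i)) z (f.coeff χ)

/-- The element `z ∈ T₀` acts on `ℂ[T]` through left translation, `(z · f)(t) = f(z⁻¹t)`. -/
def leftTranslate (z : Fin p → ℂˣ) : TorusRing p q →ₗ[ℂ] TorusRing p q :=
  weightScale fun χ => ∏ k, ((z k ^ (-χ k) : ℂˣ) : ℂ)

/-- The action of `θ_i ∈ 𝔱₁` on `ℂ[T]` through left translation,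
`½ ∑ j, ξ_j ⟨t∂/∂t, [θ_i, θ_j]⟩ - ∂/∂ξ_i`. -/
def Supertorus.leftOdd (T : Supertorus p q) (i : Fin q) : TorusRing p q →ₗ[ℂ] TorusRing p q :=
  (1 / 2 : ℂ) • ∑ j, LinearMap.mulLeft ℂ (oddCoord j) ∘ₗ evenDeriv (T.bracket i j) - oddDeriv i

/-- The action of `θ_i ∈ 𝔱₁` on `ℂ[T]` through right translation,
`½ ∑ j, ξ_j ⟨t∂/∂t, [θ_i, θ_j]⟩ + ∂/∂ξ_i`. -/
def Supertorus.rightOdd (T : Supertorus p q) (i : Fin q) : TorusRing p q →ₗ[ℂ] TorusRing p q :=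
  (1 / 2 : ℂ) • ∑ j, LinearMap.mulLeft ℂ (oddCoord j) ∘ₗ evenDeriv (T.bracket i j) + oddDeriv i

/-- The parity involution of `ℂ[T]`. -/
def parityInvolution (p q : ℕ) : TorusRing p q →ₐ[ℂ] TorusRing p q :=
  AddMonoidAlgebra.mapAlgHom _ CliffordAlgebra.involute

theorem coeff_parityInvolution (f : TorusRing p q) (χ : Fin p → ℤ) :
    (parityInvolution p q f).coeff χ = CliffordAlgebra.involute (f.coeff χ) := rfl

theorem eq_zero_of_eq_neg_self {M : Type*} [AddCommGroup M] [Module ℂ M] {x : M}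
    (h : x = -x) : x = 0 := by
  have h2 : (2 : ℂ) • x = 0 := by rw [two_smul]; nth_rewrite 2 [h]; exact add_neg_cancel x
  exact (smul_eq_zero.1 h2).resolve_left two_ne_zero

theorem mem_evenOdd_iff (x : ExteriorAlgebra ℂ (Fin q → ℂ)) :
    (x ∈ CliffordAlgebra.evenOdd (0 : QuadraticForm ℂ (Fin q → ℂ)) 0 ↔
      CliffordAlgebra.involute x = x) ∧
    (x ∈ CliffordAlgebra.evenOdd (0 : QuadraticForm ℂ (Fin q → ℂ)) 1 ↔
      CliffordAlgebra.involute x = -x) := by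
  have hx : x ∈ CliffordAlgebra.evenOdd (0 : QuadraticForm ℂ (Fin q → ℂ)) 0 ⊔
      CliffordAlgebra.evenOdd (0 : QuadraticForm ℂ (Fin q → ℂ)) 1 :=
    (CliffordAlgebra.evenOdd_isCompl (0 : QuadraticForm ℂ (Fin q → ℂ))).sup_eq_top ▸
      Submodule.mem_top
  obtain ⟨b, hb, c, hc, rfl⟩ := Submodule.mem_sup.1 hx
  refine ⟨⟨CliffordAlgebra.involute_eq_of_mem_even, fun h => ?_⟩,
    ⟨CliffordAlgebra.involute_eq_of_mem_odd, fun h => ?_⟩⟩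
  · rw [map_add, CliffordAlgebra.involute_eq_of_mem_even hb,
      CliffordAlgebra.involute_eq_of_mem_odd hc] at h
    have h' : c = 0 := eq_zero_of_eq_neg_self (add_left_cancel h).symm
    simpa [h'] using hb
  · rw [map_add, CliffordAlgebra.involute_eq_of_mem_even hb,
      CliffordAlgebra.involute_eq_of_mem_odd hc, neg_add] at h
    have h' : b = 0 := eq_zero_of_eq_neg_self (add_right_cancel h)
    simpa [h'] using hc

theorem mem_torusGrading_zero (f : TorusRing p q) :
    f ∈ torusGrading p q 0 ↔ parityInvolution p q f = f := by
  refine ⟨fun h => ?_, fun h χ => ?_⟩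
  · ext χ : 2
    exact (mem_evenOdd_iff _).1.1 (h χ)
  · rw [(mem_evenOdd_iff _).1, ← coeff_parityInvolution, h]

theorem mem_torusGrading_one (f : TorusRing p q) :
    f ∈ torusGrading p q 1 ↔ parityInvolution p q f = -f := by
  refine ⟨fun h => ?_, fun h χ => ?_⟩
  · ext χ : 2
    exact (mem_evenOdd_iff _).2.1 (h χ)
  · rw [(mem_evenOdd_iff _).2, ← coeff_parityInvolution, h]
    rfl

theorem parityInvolution_parityInvolution (f : TorusRing p q) :
    parityInvolution p q (parityInvolution p q f) = f := by
  ext χ : 2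
  exact CliffordAlgebra.involute_involute _

theorem ext_ι_mul (v : Fin q → ℂ) (b : ExteriorAlgebra ℂ (Fin q → ℂ)) :
    CliffordAlgebra.ι (0 : QuadraticForm ℂ (Fin q → ℂ)) v * b =
      CliffordAlgebra.involute b * CliffordAlgebra.ι (0 : QuadraticForm ℂ (Fin q → ℂ)) v := by
  induction b using CliffordAlgebra.induction with
  | algebraMap r => rw [AlgHom.commutes, Algebra.commutes]
  | ι w =>
    rw [CliffordAlgebra.involute_ι, neg_mul, eq_neg_iff_add_eq_zero]
    exact ExteriorAlgebra.ι_add_mul_swap v w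
  | mul a b ha hb => rw [← mul_assoc, ha, mul_assoc, hb, map_mul, mul_assoc]
  | add a b ha hb => rw [mul_add, ha, hb, map_add, add_mul]

theorem ext_comm (a b : ExteriorAlgebra ℂ (Fin q → ℂ)) :
    (a ∈ CliffordAlgebra.evenOdd (0 : QuadraticForm ℂ (Fin q → ℂ)) 0 → a * b = b * a) ∧
    (a ∈ CliffordAlgebra.evenOdd (0 : QuadraticForm ℂ (Fin q → ℂ)) 1 →
      a * b = CliffordAlgebra.involute b * a) := by
  constructor <;> intro h
  · induction a, h using CliffordAlgebra.even_induction with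
    | algebraMap r => exact Algebra.commutes _ _
    | add x y hx hy ihx ihy => rw [add_mul, mul_add, ihx, ihy]
    | ι_mul_ι_mul v w x hx ih =>
      rw [mul_assoc, ih, ← mul_assoc, mul_assoc _ _ b, ext_ι_mul w b, ← mul_assoc, ext_ι_mul v,
        CliffordAlgebra.involute_involute, mul_assoc, mul_assoc, mul_assoc]
  · induction a, h using CliffordAlgebra.odd_induction with
    | ι v => exact ext_ι_mul v b
    | add x y hx hy ihx ihy => rw [add_mul, mul_add, ihx, ihy]
    | ι_mul_ι_mul v w x hx ih =>
      rw [mul_assoc, ih, ← mul_assoc, mul_assoc _ _ (CliffordAlgebra.involute b), ext_ι_mul w,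
        ← mul_assoc, ext_ι_mul v, CliffordAlgebra.involute_involute, mul_assoc, mul_assoc,
        mul_assoc]

theorem torus_sum_single (f : TorusRing p q) :
    f = ∑ χ ∈ f.coeff.support, AddMonoidAlgebra.single χ (f.coeff χ) := by
  classical
  ext χ : 2
  rw [AddMonoidAlgebra.coeff_sum, Finsupp.finsetSum_apply]
  simp only [AddMonoidAlgebra.coeff_single, Finsupp.single_apply]
  rw [Finset.sum_ite_eq']
  split_ifs with h
  · rfl
  · simpa using h

theorem parityInvolution_single (χ : Fin p → ℤ) (a : ExteriorAlgebra ℂ (Fin q → ℂ)) :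
    parityInvolution p q (AddMonoidAlgebra.single χ a)
      = AddMonoidAlgebra.single χ (CliffordAlgebra.involute a) :=
  AddMonoidAlgebra.mapAlgHom_single _ _ _

theorem torus_comm (f g : TorusRing p q) :
    (f ∈ torusGrading p q 0 → f * g = g * f) ∧
    (f ∈ torusGrading p q 1 → f * g = parityInvolution p q g * f) := by
  constructor <;> intro h <;>
    induction g using AddMonoidAlgebra.induction_linear with
    | zero => simp
    | add x y hx hy => simp only [mul_add, add_mul, map_add, hx, hy]
    | single ψ b =>
      rw [torus_sum_single f, Finset.sum_mul, Finset.mul_sum]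
      refine Finset.sum_congr rfl fun χ _ => ?_
      simp only [parityInvolution_single, AddMonoidAlgebra.single_mul_single]
      first
      | rw [(ext_comm _ _).1 (h χ), add_comm]
      | rw [(ext_comm _ _).2 (h χ), add_comm]

/-- The grading induced on a subalgebra of `ℂ[T]`. -/
def restrictGrading (S : Subalgebra ℂ (TorusRing p q)) (i : ZMod 2) : AddSubgroup S where
  carrier := {f | (f : TorusRing p q) ∈ torusGrading p q i}
  zero_mem' := (torusGrading p q i).zero_mem
  add_mem' hf hg := (torusGrading p q i).add_mem hf hg
  neg_mem' hf := (torusGrading p q i).neg_mem hf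

theorem superRing_restrictGrading (S : Subalgebra ℂ (TorusRing p q))
    (hS : ∀ f ∈ S, parityInvolution p q f ∈ S) : SuperRing (restrictGrading S) where
  one_mem := (mem_torusGrading_zero _).2 (map_one (parityInvolution p q))
  mul_mem := by
    rintro i j ⟨f, hfS⟩ ⟨g, hgS⟩ (hf : f ∈ torusGrading p q i) (hg : g ∈ torusGrading p q j)
    change f * g ∈ torusGrading p q (i + j)
    fin_cases i <;> fin_cases j
    · exact (mem_torusGrading_zero _).2 (by
        rw [map_mul, (mem_torusGrading_zero _).1 hf, (mem_torusGrading_zero _).1 hg])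
    · exact (mem_torusGrading_one _).2 (by
        rw [map_mul, (mem_torusGrading_zero _).1 hf, (mem_torusGrading_one _).1 hg, mul_neg])
    · exact (mem_torusGrading_one _).2 (by
        rw [map_mul, (mem_torusGrading_one _).1 hf, (mem_torusGrading_zero _).1 hg, neg_mul])
    · exact (mem_torusGrading_zero _).2 (by
        rw [map_mul, (mem_torusGrading_one _).1 hf, (mem_torusGrading_one _).1 hg, neg_mul_neg])
  isCompl := by
    constructor
    · rw [disjoint_iff, eq_bot_iff]
      rintro ⟨f, hfS⟩ ⟨(h0 : f ∈ torusGrading p q 0), (h1 : f ∈ torusGrading p q 1)⟩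
      exact Subtype.ext (eq_zero_of_eq_neg_self
        (((mem_torusGrading_zero f).1 h0).symm.trans ((mem_torusGrading_one f).1 h1)))
    · rw [codisjoint_iff, eq_top_iff]
      rintro ⟨f, hfS⟩ -
      have h0 : (1 / 2 : ℂ) • (f + parityInvolution p q f) ∈ S :=
        S.smul_mem (S.add_mem hfS (hS f hfS)) _
      have h1 : (1 / 2 : ℂ) • (f - parityInvolution p q f) ∈ S :=
        S.smul_mem (S.sub_mem hfS (hS f hfS)) _
      have e : (⟨f, hfS⟩ : S) = ⟨_, h0⟩ + ⟨_, h1⟩ := Subtype.ext (by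
        change f = (1 / 2 : ℂ) • (f + parityInvolution p q f)
          + (1 / 2 : ℂ) • (f - parityInvolution p q f)
        module)
      rw [e]
      refine AddSubgroup.add_mem_sup ((mem_torusGrading_zero _).2 ?_)
        ((mem_torusGrading_one _).2 ?_)
      · rw [map_smul, map_add, parityInvolution_parityInvolution, add_comm]
      · rw [map_smul, map_sub, parityInvolution_parityInvolution, ← smul_neg, neg_sub]
  even_comm := by
    rintro ⟨f, hfS⟩ hf ⟨g, hgS⟩
    exact Subtype.ext ((torus_comm f g).1 hf)
  odd_anticomm := by
    rintro ⟨f, hfS⟩ ⟨g, hgS⟩ hf hg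
    refine Subtype.ext (((torus_comm f g).2 hf).trans ?_)
    rw [(mem_torusGrading_one g).1 hg, neg_mul]
    rfl
  odd_sq := by
    rintro ⟨f, hfS⟩ hf
    refine Subtype.ext (eq_zero_of_eq_neg_self (((torus_comm f f).2 hf).trans ?_))
    rw [(mem_torusGrading_one f).1 hf, neg_mul]
    rfl

theorem oddDeriv_mul (i : Fin q) (f g : TorusRing p q) :
    oddDeriv i (f * g) = oddDeriv i f * g + parityInvolution p q f * oddDeriv i g := by
  have hext : ∀ a b : ExteriorAlgebra ℂ (Fin q → ℂ),
      CliffordAlgebra.contractLeft (Q := (0 : QuadraticForm ℂ (Fin q → ℂ)))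
        (LinearMap.proj i) (a * b)
      = CliffordAlgebra.contractLeft (Q := (0 : QuadraticForm ℂ (Fin q → ℂ)))
        (LinearMap.proj i) a * b + CliffordAlgebra.involute a *
        CliffordAlgebra.contractLeft (Q := (0 : QuadraticForm ℂ (Fin q → ℂ)))
        (LinearMap.proj i) b := by
    intro a b
    induction a using CliffordAlgebra.left_induction with
    | algebraMap r =>
      rw [CliffordAlgebra.contractLeft_algebraMap_mul, CliffordAlgebra.contractLeft_algebraMap,
        zero_mul, zero_add, AlgHom.commutes]
    | add x y hx hy => simp only [add_mul, map_add, hx, hy]; abel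
    | ι_mul x v hx =>
      rw [mul_assoc, CliffordAlgebra.contractLeft_ι_mul, CliffordAlgebra.contractLeft_ι_mul, hx,
        map_mul, CliffordAlgebra.involute_ι, sub_mul, mul_add, smul_mul_assoc]
      simp only [mul_assoc, neg_mul]
      abel
  have hsingle : ∀ (χ : Fin p → ℤ) (a : ExteriorAlgebra ℂ (Fin q → ℂ)),
      oddDeriv i (AddMonoidAlgebra.single χ a) = AddMonoidAlgebra.single χ
        (CliffordAlgebra.contractLeft (Q := (0 : QuadraticForm ℂ (Fin q → ℂ)))
        (LinearMap.proj i) a) := by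
    intro χ a
    refine AddMonoidAlgebra.coeff_injective ?_
    exact Finsupp.mapRange_single (hf := map_zero _)
  induction f using AddMonoidAlgebra.induction_linear with
  | zero => simp
  | add x y hx hy => simp only [add_mul, map_add, hx, hy]; abel
  | single χ a =>
    induction g using AddMonoidAlgebra.induction_linear with
    | zero => simp
    | add x y hx hy => simp only [mul_add, map_add, hx, hy]; abel
    | single ψ b =>
      simp only [hsingle, parityInvolution_single, AddMonoidAlgebra.single_mul_single, hext,
        AddMonoidAlgebra.single_add]

theorem weightScale_single (w : (Fin p → ℤ) → ℂ) (χ : Fin p → ℤ)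
    (a : ExteriorAlgebra ℂ (Fin q → ℂ)) :
    weightScale w (AddMonoidAlgebra.single χ a) = AddMonoidAlgebra.single χ (w χ • a) := by
  classical
  ext ψ : 2
  change w ψ • (AddMonoidAlgebra.single χ a).coeff ψ = _
  simp only [AddMonoidAlgebra.coeff_single, Finsupp.single_apply]
  split_ifs with h
  · rw [h]
  · rw [smul_zero]

theorem evenDeriv_mul (x : Fin p → ℂ) (f g : TorusRing p q) :
    evenDeriv x (f * g) = evenDeriv x f * g + f * evenDeriv x g := by
  induction f using AddMonoidAlgebra.induction_linear with
  | zero => simp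
  | add x y hx hy => simp only [add_mul, map_add, hx, hy]; abel
  | single χ a =>
    induction g using AddMonoidAlgebra.induction_linear with
    | zero => simp
    | add x y hx hy => simp only [mul_add, map_add, hx, hy]; abel
    | single ψ b =>
      simp only [evenDeriv, weightScale_single, AddMonoidAlgebra.single_mul_single,
        smul_mul_assoc, mul_smul_comm, ← AddMonoidAlgebra.single_add, ← add_smul,
        ← Finset.sum_add_distrib, Pi.add_apply, Int.cast_add, add_mul]

theorem oddCoord_mul (j : Fin q) (f : TorusRing p q) :
    oddCoord j * f = parityInvolution p q f * oddCoord j := by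
  refine (torus_comm _ f).2 ?_
  rw [mem_torusGrading_one, oddCoord, parityInvolution_single,
    ← AddMonoidAlgebra.single_neg]
  exact congrArg _ (CliffordAlgebra.involute_ι _)

theorem rightOdd_mul (T : Supertorus p q) (i : Fin q) (f g : TorusRing p q) :
    T.rightOdd i (f * g) = T.rightOdd i f * g + parityInvolution p q f * T.rightOdd i g := by
  have h : ∀ j, oddCoord j * evenDeriv (T.bracket i j) (f * g)
      = oddCoord j * evenDeriv (T.bracket i j) f * g
        + parityInvolution p q f * (oddCoord j * evenDeriv (T.bracket i j) g) := by
    intro j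
    rw [evenDeriv_mul, mul_add, ← mul_assoc, ← mul_assoc, oddCoord_mul j f, mul_assoc _ _ (evenDeriv _ g)]
  simp only [Supertorus.rightOdd, LinearMap.add_apply, LinearMap.smul_apply, LinearMap.sum_apply,
    LinearMap.comp_apply, LinearMap.mulLeft_apply, h, oddDeriv_mul, Finset.sum_add_distrib,
    smul_add, add_mul, mul_add, Finset.sum_mul, Finset.mul_sum, smul_mul_assoc, mul_smul_comm]
  abel

theorem rightOdd_parityInvolution (T : Supertorus p q) (i : Fin q) (f : TorusRing p q) :
    T.rightOdd i (parityInvolution p q f) = -parityInvolution p q (T.rightOdd i f) := by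
  have hext : ∀ a : ExteriorAlgebra ℂ (Fin q → ℂ),
      CliffordAlgebra.contractLeft (Q := (0 : QuadraticForm ℂ (Fin q → ℂ)))
        (LinearMap.proj i) (CliffordAlgebra.involute a)
      = -CliffordAlgebra.involute (CliffordAlgebra.contractLeft
        (Q := (0 : QuadraticForm ℂ (Fin q → ℂ))) (LinearMap.proj i) a) := by
    intro a
    induction a using CliffordAlgebra.left_induction with
    | algebraMap r =>
      rw [AlgHom.commutes, CliffordAlgebra.contractLeft_algebraMap, map_zero, neg_zero]
    | add x y hx hy => simp only [map_add, hx, hy]; abel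
    | ι_mul x v hx =>
      rw [map_mul, CliffordAlgebra.involute_ι, neg_mul, map_neg,
        CliffordAlgebra.contractLeft_ι_mul, CliffordAlgebra.contractLeft_ι_mul, hx, map_sub,
        map_smul, map_mul, CliffordAlgebra.involute_ι, mul_neg, neg_mul]
  have hodd : oddDeriv i (parityInvolution p q f) = -parityInvolution p q (oddDeriv i f) := by
    ext χ : 2
    exact hext (f.coeff χ)
  have heven : ∀ x, evenDeriv x (parityInvolution p q f) = parityInvolution p q (evenDeriv x f) := by
    intro x
    ext χ : 2
    exact (map_smul (CliffordAlgebra.involute (Q := (0 : QuadraticForm ℂ (Fin q → ℂ))))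
      (∑ k, (χ k : ℂ) * x k) (f.coeff χ)).symm
  have hcoord : ∀ j : Fin q,
      parityInvolution p q (oddCoord j : TorusRing p q) = -oddCoord j := by
    intro j
    rw [oddCoord, parityInvolution_single, ← AddMonoidAlgebra.single_neg]
    exact congrArg _ (CliffordAlgebra.involute_ι _)
  simp only [Supertorus.rightOdd, LinearMap.add_apply, LinearMap.smul_apply, LinearMap.sum_apply,
    LinearMap.comp_apply, LinearMap.mulLeft_apply, hodd, heven, map_add, map_smul, map_sum,
    map_mul, hcoord, neg_mul, Finset.sum_neg_distrib, smul_neg, neg_add, neg_neg]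

/-- For an odd vector `v = ∑ i, v_i θ_i ∈ 𝔱₁`, its action on `ℂ[T]` through right translation. -/
def Supertorus.rightOddVec (T : Supertorus p q) (v : Fin q → ℂ) :
    TorusRing p q →ₗ[ℂ] TorusRing p q :=
  ∑ i, v i • T.rightOdd i

theorem rightOddVec_mul (T : Supertorus p q) (v : Fin q → ℂ) (f g : TorusRing p q) :
    T.rightOddVec v (f * g)
      = T.rightOddVec v f * g + parityInvolution p q f * T.rightOddVec v g := by
  simp only [Supertorus.rightOddVec, LinearMap.sum_apply, LinearMap.smul_apply, rightOdd_mul,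
    smul_add, Finset.sum_add_distrib, Finset.sum_mul, Finset.mul_sum, smul_mul_assoc,
    mul_smul_comm]

/-- The superalgebra `ℂ[T/H]` of the homogeneous space `T/H`, where `H` is the closed subgroup
with `H₀ = 1` and `Lie H = 𝔥 ⊆ 𝔱₁`: the functions on `T` that are invariant under right translation
by `H`. -/
def Supertorus.homogeneousRing (T : Supertorus p q) (𝔥 : Submodule ℂ (Fin q → ℂ)) :
    Subalgebra ℂ (TorusRing p q) where
  carrier := {f | ∀ v ∈ 𝔥, T.rightOddVec v f = 0}
  mul_mem' hf hg v hv := by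
    rw [rightOddVec_mul, hf v hv, hg v hv, zero_mul, mul_zero, add_zero]
  add_mem' hf hg v hv := by rw [map_add, hf v hv, hg v hv, add_zero]
  algebraMap_mem' z v _ := by
    have h := rightOddVec_mul T v 1 1
    rw [map_one (parityInvolution p q), mul_one, mul_one, one_mul, left_eq_add] at h
    rw [Algebra.algebraMap_eq_smul_one, map_smul, h, smul_zero]

instance (T : Supertorus p q) (𝔥 : Submodule ℂ (Fin q → ℂ)) :
    SuperRing (restrictGrading (T.homogeneousRing 𝔥)) :=
  superRing_restrictGrading _ fun f hf v hv => by
    have h : T.rightOddVec v (parityInvolution p q f)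
        = -parityInvolution p q (T.rightOddVec v f) := by
      simp only [Supertorus.rightOddVec, LinearMap.sum_apply, LinearMap.smul_apply,
        rightOdd_parityInvolution, map_sum, map_smul, smul_neg, Finset.sum_neg_distrib]
    rw [h, hf v hv, map_zero, neg_zero]

/-- The subspace `𝔥 ⊆ 𝔱₁` is the Lie superalgebra of a closed subgroup `H ⊆ T` with `H₀ = 1`:
`[𝔥, 𝔥] = 0`. -/
def Supertorus.IsOddSubgroup (T : Supertorus p q) (𝔥 : Submodule ℂ (Fin q → ℂ)) : Prop :=
  ∀ v ∈ 𝔥, ∀ w ∈ 𝔥, ∀ k, ∑ i, ∑ j, v i * w j * T.bracket i j k = 0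

variable {A : Type u} [Ring A] [Algebra ℂ A]

/-- A left action of the supertorus `T` on the affine superscheme `Spec A`, in terms of the
Harish-Chandra pair: an algebraic action of the torus `T₀` on `A` by automorphisms and an action
of the Lie superalgebra `𝔱` by superderivations which are compatible with each other. -/
structure SupertorusAction (T : Supertorus p q) (𝒜 : ZMod 2 → AddSubgroup A) where
  /-- the action of `T₀` -/
  grp : (Fin p → ℂˣ) →* (A ≃ₐ[ℂ] A)
  grp_mem : ∀ z i a, a ∈ 𝒜 i → grp z a ∈ 𝒜 i
  /-- the action of `T₀` is algebraic: the orbit maps are Laurent polynomials -/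
  rational : ∀ a, ∃ f : (Fin p → ℤ) →₀ A,
    ∀ z, grp z a = f.sum fun χ b => ((∏ k, z k ^ χ k : ℂˣ) : ℂ) • b
  /-- the action of the basis vector `x_k` of `𝔱₀` -/
  even : Fin p → Module.End ℂ A
  /-- `𝔱₀` acts through the differential of the action of `T₀` -/
  even_apply : ∀ a (f : (Fin p → ℤ) →₀ A),
    (∀ z, grp z a = f.sum fun χ b => ((∏ k, z k ^ χ k : ℂˣ) : ℂ) • b) →
      ∀ k, even k a = f.sum fun χ b => (χ k : ℂ) • b
  /-- the action of the basis vector `θ_i` of `𝔱₁` -/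
  odd : Fin q → Module.End ℂ A
  odd_mem : ∀ i j a, a ∈ 𝒜 j → odd i a ∈ 𝒜 (j + 1)
  /-- `θ_i` acts as an odd superderivation -/
  odd_mul : ∀ i j a b, a ∈ 𝒜 j →
    odd i (a * b) = odd i a * b + (-1 : ℂ) ^ j.val • (a * odd i b)
  /-- the bracket of `𝔱₁` is respected -/
  odd_bracket : ∀ i j a, odd i (odd j a) + odd j (odd i a) = ∑ k, T.bracket i j k • even k a
  /-- equivariance under `T₀`, which acts trivially on `𝔱₁` -/
  grp_odd : ∀ z i a, grp z (odd i a) = odd i (grp z a)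

/-- The action of the supertorus `T` on `X = Spec A` together with the map `T → X` given by
`φ : A → ℂ[T]` makes `X` a toric supervariety: `X` is an irreducible supervariety, and `T → X` is
`T`-equivariant and factors as the quotient map `T → T/H` followed by an open immersion
`T/H → X`, for a closed subgroup `H` with `H₀ = 1`. -/
structure IsToric {T : Supertorus p q} {𝒜 : ZMod 2 → AddSubgroup A} [SuperRing 𝒜]
    (act : SupertorusAction T 𝒜) (φ : A →ₐ[ℂ] TorusRing p q) : Prop where
  irreducible : IrreducibleSpace (SuperSpec 𝒜)
  supervariety : IsAffineSupervariety 𝒜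
  map_grp : ∀ z a, φ (act.grp z a) = leftTranslate z (φ a)
  map_odd : ∀ i a, φ (act.odd i a) = T.leftOdd i (φ a)
  factors : ∃ 𝔥 : Submodule ℂ (Fin q → ℂ), T.IsOddSubgroup 𝔥 ∧
    ∃ ψ : SuperHom 𝒜 (restrictGrading (T.homogeneousRing 𝔥)),
      (∀ a, (ψ.toRingHom a : TorusRing p q) = φ a) ∧ ψ.IsOpenImmersion

/-- `Spec A` is a (not necessarily normal) toric supervariety for some supertorus. -/
def IsToricSupervariety (𝒜 : ZMod 2 → AddSubgroup A) [SuperRing 𝒜] : Prop :=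
  ∃ (p q : ℕ) (T : Supertorus p q) (act : SupertorusAction T 𝒜) (φ : A →ₐ[ℂ] TorusRing p q),
    IsToric act φ

end Supertori

section MonomialSuperalgebras

variable {q n : ℕ}

/-- The character `x^m v` of `(ℂˣ)^(n+1)`, with coordinates `v = t₀` and `x_l = t_l`. -/
def charXV (m : Fin n → ℕ) : Fin (n + 1) → ℤ := Fin.cons 1 fun l => (m l : ℤ)

/-- The monomial `ξ^I x^m v`, where `ξ^I` is the product of the `ξ_i^(I_i)` in increasing order. -/
def superMonomial (k : (Fin q → ℕ) × (Fin n → ℕ)) : TorusRing (n + 1) q :=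
  AddMonoidAlgebra.single (charXV k.2)
    ((List.finRange q).map fun i =>
      (ExteriorAlgebra.ι ℂ (Pi.single i 1 : Fin q → ℂ)) ^ k.1 i).prod

/-- The superalgebra `ℂ[ξ^I x^m v | (I, m) ∈ K]`. -/
def monomialAlgebra (K : Finset ((Fin q → ℕ) × (Fin n → ℕ))) :
    Subalgebra ℂ (TorusRing (n + 1) q) :=
  Algebra.adjoin ℂ (superMonomial '' (K : Set ((Fin q → ℕ) × (Fin n → ℕ))))

theorem parityInvolution_superMonomial (k : (Fin q → ℕ) × (Fin n → ℕ)) :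
    parityInvolution (n + 1) q (superMonomial k) = superMonomial k ∨
      parityInvolution (n + 1) q (superMonomial k) = -superMonomial k := by
  have h : ∀ l : List (Fin q),
      let a := (l.map fun i => (ExteriorAlgebra.ι ℂ (Pi.single i 1 : Fin q → ℂ)) ^ k.1 i).prod
      CliffordAlgebra.involute a = a ∨ CliffordAlgebra.involute a = -a := by
    intro l
    induction l with
    | nil => exact Or.inl (map_one _)
    | cons i l ih =>
      have hi : CliffordAlgebra.involute
          (ExteriorAlgebra.ι ℂ (Pi.single i 1 : Fin q → ℂ)) = -ExteriorAlgebra.ι ℂ _ :=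
        CliffordAlgebra.involute_ι _
      simp only [List.map_cons, List.prod_cons, map_mul, map_pow, hi] at ih ⊢
      rw [neg_pow]
      rcases neg_one_pow_eq_or (ExteriorAlgebra ℂ (Fin q → ℂ)) (k.1 i) with h | h <;>
        rcases ih with ih | ih <;> rw [h, ih] <;> simp
  rw [superMonomial, parityInvolution_single]
  rcases h (List.finRange q) with h | h
  · exact Or.inl (by rw [h])
  · exact Or.inr (by rw [h, AddMonoidAlgebra.single_neg])

instance (K : Finset ((Fin q → ℕ) × (Fin n → ℕ))) :
    SuperRing (restrictGrading (monomialAlgebra K)) :=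
  superRing_restrictGrading _ fun f hf => by
    have h : monomialAlgebra K ≤ (monomialAlgebra K).comap (parityInvolution (n + 1) q) := by
      refine Algebra.adjoin_le ?_
      rintro _ ⟨k, hk, rfl⟩
      have hmem : superMonomial k ∈ monomialAlgebra K := Algebra.subset_adjoin ⟨k, hk, rfl⟩
      rw [SetLike.mem_coe, Subalgebra.mem_comap]
      rcases parityInvolution_superMonomial k with h | h <;> rw [h]
      · exact hmem
      · exact neg_mem hmem
    exact h hf

/-- The set `⟨K⟩` of the sums of finitely many elements of `K` that lie in `{0,1}^q × ℕ^n`. -/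
def boundedSums (K : Finset ((Fin q → ℕ) × (Fin n → ℕ))) : Set ((Fin q → ℕ) × (Fin n → ℕ)) :=
  {k | k ∈ AddSubmonoid.closure (K : Set ((Fin q → ℕ) × (Fin n → ℕ))) ∧ ∀ i, k.1 i ≤ 1}

/-- The supertorus of dimension `n + 1 | q` with even coordinates `v, x₁, …, x_n` and bracket
`[θ_i, θ_j] = (0, c_ij)`. -/
def supertorusOf (c : Fin q → Fin q → Fin n → ℂ) (hc : ∀ i j, c i j = c j i) :
    Supertorus (n + 1) q where
  bracket i j := Fin.cons 0 (c i j)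
  symm i j := by rw [hc]

end MonomialSuperalgebras

end

/-!
Let `A = monomialAlgebra K` and let `s ∈ A` be the product of its generators `x^m v` with
`(0, m) ∈ K`, a unit of `ℂ[T]`. Conditions (2) and (3), together with (1), imply that every element
of `ℂ[T]` becomes an element of `A` after multiplication by a power of `s`. Hence `ℂ[T] = A[1/s]`,
and `T → Spec A` is an open immersion, with trivial `H`. It also follows that the exterior algebra
over the field `ℂ(x, v)` is a ring of fractions of `A`, obtained by inverting even elements. In this
exterior algebra every element is a unit or lies in the nilpotent ideal generated by the `ξ_i`;
transferred to `A`, this makes `Spec A` irreducible, reduced and generically fermionically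
regular.

An action of `T_c` that extends the left translations exists if and only if `A` is stable under the
vector fields `θ_i`. For a generator `f = ξ^I x^m v`,
`θ_i f = ½ ∑_j ⟨m, c_ij⟩ ξ_j f - ∂f/∂ξ_i`, and the last term lies in `A` by (1). The derivation
`ξ_j ∂/∂ξ_j` preserves `A` and, if `I_j = 0`, it extracts the summand `½ ⟨m, c_ij⟩ ξ_j f`. Finally,
all generators have degree one in `v`, so a monomial of degree one in `v` lies in `A` only if it is
a generator.
-/

noncomputable section

open scoped TensorProduct

universe u v w

section SuperRingBasics

namespace SuperRing

variable {A : Type u} [Ring A] {𝒜 : ZMod 2 → AddSubgroup A} [SuperRing 𝒜]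

theorem even_mul_mem {i : ZMod 2} {a b : A} (ha : a ∈ 𝒜 0) (hb : b ∈ 𝒜 i) : a * b ∈ 𝒜 i := by
  simpa using SuperRing.mul_mem ha hb

theorem mul_even_mem {i : ZMod 2} {a b : A} (ha : a ∈ 𝒜 i) (hb : b ∈ 𝒜 0) : a * b ∈ 𝒜 i := by
  simpa using SuperRing.mul_mem ha hb

theorem odd_mul_odd_mem {a b : A} (ha : a ∈ 𝒜 1) (hb : b ∈ 𝒜 1) : a * b ∈ 𝒜 0 :=
  SuperRing.mul_mem ha hb

theorem pow_mem_even {a : A} (ha : a ∈ 𝒜 0) (n : ℕ) : a ^ n ∈ 𝒜 0 :=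
  pow_mem (S := evenPart 𝒜) ha n

theorem isNilpotent_of_odd {a : A} (ha : a ∈ 𝒜 1) : IsNilpotent a :=
  ⟨2, by rw [sq, SuperRing.odd_sq ha]⟩

theorem isNilpotent_odd_mul_odd {a b : A} (ha : a ∈ 𝒜 1) (hb : b ∈ 𝒜 1) :
    IsNilpotent (a * b) := by
  refine ⟨2, ?_⟩
  rw [sq, mul_assoc, ← mul_assoc b, odd_anticomm hb ha, neg_mul, mul_assoc, odd_sq hb, mul_zero,
    neg_zero, mul_zero]

theorem commute_of_even {a : A} (ha : a ∈ 𝒜 0) (b : A) : Commute a b :=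
  even_comm ha b

/-- The elements whose even component is nilpotent form a two-sided ideal. -/
theorem exists_even_isNilpotent_of_mem_span_odd {a : A}
    (h : a ∈ TwoSidedIdeal.span (𝒜 1 : Set A)) :
    ∃ b ∈ 𝒜 0, IsNilpotent b ∧ a - b ∈ 𝒜 1 := by
  induction h using TwoSidedIdeal.span_induction with
  | mem a ha => exact ⟨0, zero_mem _, IsNilpotent.zero, by rwa [sub_zero]⟩
  | zero => exact ⟨0, zero_mem _, IsNilpotent.zero, by simp [zero_mem]⟩
  | add a a' _ _ ha ha' =>
    obtain ⟨b, hb, hbn, hba⟩ := ha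
    obtain ⟨b', hb', hbn', hba'⟩ := ha'
    refine ⟨b + b', add_mem hb hb', (commute_of_even hb b').isNilpotent_add hbn hbn', ?_⟩
    rw [add_sub_add_comm]
    exact add_mem hba hba'
  | neg a _ ha =>
    obtain ⟨b, hb, hbn, hba⟩ := ha
    refine ⟨-b, neg_mem hb, hbn.neg, ?_⟩
    rw [← neg_sub']
    exact neg_mem hba
  | left_absorb c a _ ha =>
    obtain ⟨b, hb, hbn, hba⟩ := ha
    obtain ⟨c₀, hc₀, c₁, hc₁, rfl⟩ := exists_even_add_odd 𝒜 c
    refine ⟨c₀ * b + c₁ * (a - b), add_mem (even_mul_mem hc₀ hb) (odd_mul_odd_mem hc₁ hba),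
      (commute_of_even (even_mul_mem hc₀ hb) _).isNilpotent_add
        ((commute_of_even hc₀ b).isNilpotent_mul_left hbn) (isNilpotent_odd_mul_odd hc₁ hba), ?_⟩
    have e : (c₀ + c₁) * a - (c₀ * b + c₁ * (a - b)) = c₀ * (a - b) + c₁ * b := by noncomm_ring
    rw [e]
    exact add_mem (even_mul_mem hc₀ hba) (mul_even_mem hc₁ hb)
  | right_absorb c a _ ha =>
    obtain ⟨b, hb, hbn, hba⟩ := ha
    obtain ⟨c₀, hc₀, c₁, hc₁, rfl⟩ := exists_even_add_odd 𝒜 c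
    refine ⟨b * c₀ + (a - b) * c₁, add_mem (mul_even_mem hb hc₀) (odd_mul_odd_mem hba hc₁),
      (commute_of_even (mul_even_mem hb hc₀) _).isNilpotent_add
        ((commute_of_even hb c₀).isNilpotent_mul_right hbn) (isNilpotent_odd_mul_odd hba hc₁), ?_⟩
    have e : a * (c₀ + c₁) - (b * c₀ + (a - b) * c₁) = (a - b) * c₀ + b * c₁ := by noncomm_ring
    rw [e]
    exact add_mem (mul_even_mem hba hc₀) (even_mul_mem hb hc₁)

theorem isNilpotent_of_mem_span_odd {a : A} (h : a ∈ TwoSidedIdeal.span (𝒜 1 : Set A)) :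
    IsNilpotent a := by
  obtain ⟨b, hb, hbn, hba⟩ := exists_even_isNilpotent_of_mem_span_odd h
  rw [← add_sub_cancel b a]
  exact (commute_of_even hb _).isNilpotent_add hbn (isNilpotent_of_odd hba)

theorem isNilpotent_coe_evenPart_iff {a : evenPart 𝒜} : IsNilpotent (a : A) ↔ IsNilpotent a :=
  IsNilpotent.map_iff (f := (evenPart 𝒜).subtype) Subtype.coe_injective

theorem isUnit_coe_evenPart_iff {a : evenPart 𝒜} : IsUnit (a : A) ↔ IsUnit a := by
  refine ⟨fun h => ?_, fun h => h.map (evenPart 𝒜).subtype⟩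
  obtain ⟨b, hb⟩ := h.exists_right_inv
  obtain ⟨b₀, hb₀, b₁, hb₁, rfl⟩ := exists_even_add_odd 𝒜 b
  refine IsUnit.of_mul_eq_one ⟨b₀, hb₀⟩ (Subtype.ext ?_)
  have h₁ : (a : A) * b₁ = 0 := by
    refine eq_zero_of_even_of_odd 𝒜 ?_ (even_mul_mem a.2 hb₁)
    rw [mul_add, ← eq_sub_iff_add_eq'] at hb
    exact hb ▸ sub_mem SuperRing.one_mem (even_mul_mem a.2 hb₀)
  rwa [mul_add, h₁, add_zero] at hb

end SuperRing

namespace SuperHom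

variable {A : Type u} [Ring A] {𝒜 : ZMod 2 → AddSubgroup A}
variable {C : Type v} [Ring C] {𝒞 : ZMod 2 → AddSubgroup C}
variable {E : Type w} [Ring E] {ℰ : ZMod 2 → AddSubgroup E}

/-- The composite of two homomorphisms of superrings. -/
def comp (ψ : SuperHom 𝒞 ℰ) (φ : SuperHom 𝒜 𝒞) : SuperHom 𝒜 ℰ where
  toRingHom := ψ.toRingHom.comp φ.toRingHom
  map_mem i a ha := ψ.map_mem i _ (φ.map_mem i a ha)

theorem comp_apply (ψ : SuperHom 𝒞 ℰ) (φ : SuperHom 𝒜 𝒞) (a : A) :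
    (ψ.comp φ).toRingHom a = ψ.toRingHom (φ.toRingHom a) := rfl

theorem map_mem_span_odd (φ : SuperHom 𝒜 𝒞) {a : A}
    (ha : a ∈ TwoSidedIdeal.span (𝒜 1 : Set A)) :
    φ.toRingHom a ∈ TwoSidedIdeal.span (𝒞 1 : Set C) := by
  have hle : TwoSidedIdeal.span (𝒜 1 : Set A) ≤
      TwoSidedIdeal.comap φ.toRingHom (TwoSidedIdeal.span (𝒞 1 : Set C)) :=
    TwoSidedIdeal.span_le.2 fun b hb =>
      (TwoSidedIdeal.mem_comap _).2 (TwoSidedIdeal.subset_span (φ.map_mem 1 b hb))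
  exact (TwoSidedIdeal.mem_comap _).1 (hle ha)

variable [SuperRing 𝒞]

theorem mul_map_mul_left (φ : SuperHom 𝒜 𝒞) {s : A} (hs : s ∈ 𝒜 0) (b c : C) :
    b * (φ.toRingHom s * c) = φ.toRingHom s * (b * c) :=
  (SuperRing.commute_of_even (φ.map_mem 0 s hs) b).symm.left_comm c

variable [SuperRing 𝒜]

theorem map_mem_iff_of_injective (φ : SuperHom 𝒜 𝒞) (hφ : Function.Injective φ.toRingHom)
    {i : ZMod 2} {a : A} : φ.toRingHom a ∈ 𝒞 i ↔ a ∈ 𝒜 i := by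
  refine ⟨fun ha => ?_, φ.map_mem i a⟩
  obtain ⟨a₀, h₀, a₁, h₁, rfl⟩ := exists_even_add_odd 𝒜 a
  have h₀' := φ.map_mem 0 _ h₀
  have h₁' := φ.map_mem 1 _ h₁
  rw [map_add] at ha
  fin_cases i
  · have : φ.toRingHom a₁ = 0 :=
      eq_zero_of_even_of_odd 𝒞 ((AddSubgroup.add_mem_cancel_left _ h₀').1 ha) h₁'
    rw [(map_eq_zero_iff _ hφ).1 this, add_zero]
    exact h₀
  · have : φ.toRingHom a₀ = 0 :=
      eq_zero_of_even_of_odd 𝒞 h₀' ((AddSubgroup.add_mem_cancel_right _ h₁').1 ha)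
    rw [(map_eq_zero_iff _ hφ).1 this, zero_add]
    exact h₁

end SuperHom

theorem IsFermionicallyRegular.of_ringEquiv {A C : Type u} [Ring A] [Ring C]
    {𝒜 : ZMod 2 → AddSubgroup A} {𝒞 : ZMod 2 → AddSubgroup C} (e : A ≃+* C)
    (he : ∀ i a, e a ∈ 𝒞 i ↔ a ∈ 𝒜 i) (h : IsFermionicallyRegular 𝒜) :
    IsFermionicallyRegular 𝒞 := by
  obtain ⟨R, _, M, _, _, f, hf⟩ := h
  exact ⟨R, _, M, _, _, f.trans e, fun i x => (he i _).trans (hf i x)⟩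

theorem SuperHom.isFermionicallyRegular_iff_of_bijective {A C : Type u} [Ring A] [Ring C]
    {𝒜 : ZMod 2 → AddSubgroup A} {𝒞 : ZMod 2 → AddSubgroup C} [SuperRing 𝒜] [SuperRing 𝒞]
    (φ : SuperHom 𝒜 𝒞) (hφ : Function.Bijective φ.toRingHom) :
    IsFermionicallyRegular 𝒜 ↔ IsFermionicallyRegular 𝒞 := by
  let e := RingEquiv.ofBijective φ.toRingHom hφ
  have he (i a) : e a ∈ 𝒞 i ↔ a ∈ 𝒜 i := φ.map_mem_iff_of_injective hφ.1
  refine ⟨.of_ringEquiv e he, .of_ringEquiv e.symm fun i c => ?_⟩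
  rw [← he, e.apply_symm_apply]

end SuperRingBasics

section FractionMaps

namespace SuperHom

variable {A : Type u} [Ring A] {𝒜 : ZMod 2 → AddSubgroup A}
variable {C : Type v} [Ring C] {𝒞 : ZMod 2 → AddSubgroup C}
variable {E : Type w} [Ring E] {ℰ : ZMod 2 → AddSubgroup E}

/-- A fraction map `A → C` exhibits `C` as a superring of fractions of `A`: it is injective, and
every element of `C` is a fraction whose denominator is an even element of `A` that becomes
invertible in `C`. -/
structure IsFractionMap (φ : SuperHom 𝒜 𝒞) : Prop where
  injective : Function.Injective φ.toRingHom
  exists_mul_eq : ∀ c : C, ∃ s ∈ 𝒜 0, IsUnit (φ.toRingHom s) ∧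
    ∃ a : A, φ.toRingHom s * c = φ.toRingHom a

namespace IsFractionMap

variable {φ : SuperHom 𝒜 𝒞}

theorem mem_nonZeroDivisorsLeft_of_map (hφ : φ.IsFractionMap) {a : A}
    (ha : φ.toRingHom a ∈ nonZeroDivisorsLeft C) : a ∈ nonZeroDivisorsLeft A := fun b hb =>
  (map_eq_zero_iff _ hφ.injective).1 (ha _ (by rw [← map_mul, hb, map_zero]))

variable [SuperRing 𝒞]

theorem map_mem_nonZeroDivisorsLeft (hφ : φ.IsFractionMap) {a : A}
    (ha : a ∈ nonZeroDivisorsLeft A) : φ.toRingHom a ∈ nonZeroDivisorsLeft C := by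
  intro c hc
  obtain ⟨s, hs, hsu, b, hb⟩ := hφ.exists_mul_eq c
  have hab : a * b = 0 := hφ.injective <| by
    rw [map_mul, ← hb, φ.mul_map_mul_left hs, hc, mul_zero, map_zero]
  rwa [ha b hab, map_zero, hsu.mul_right_eq_zero] at hb

variable [SuperRing 𝒜]

theorem exists_even_mul_eq (hφ : φ.IsFractionMap) {c : C} (hc : c ∈ 𝒞 0) :
    ∃ s ∈ 𝒜 0, IsUnit (φ.toRingHom s) ∧ ∃ a ∈ 𝒜 0, φ.toRingHom s * c = φ.toRingHom a := by
  obtain ⟨s, hs, hsu, a, ha⟩ := hφ.exists_mul_eq c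
  refine ⟨s, hs, hsu, a, (φ.map_mem_iff_of_injective hφ.injective).1 ?_, ha⟩
  rw [← ha]
  exact SuperRing.even_mul_mem (φ.map_mem 0 s hs) hc

theorem comp {ψ : SuperHom 𝒞 ℰ} (hψ : ψ.IsFractionMap) (hφ : φ.IsFractionMap) :
    (ψ.comp φ).IsFractionMap := by
  refine ⟨hψ.injective.comp hφ.injective, fun x => ?_⟩
  obtain ⟨c, hc, hcu, d, hd⟩ := hψ.exists_mul_eq x
  obtain ⟨s, _, hsu, a, ha, hca⟩ := hφ.exists_even_mul_eq hc
  obtain ⟨t, ht, htu, b, hb⟩ := hφ.exists_mul_eq d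
  refine ⟨t * a, SuperRing.even_mul_mem ht ha, ?_, s * b, ?_⟩
  · rw [comp_apply, map_mul, ← hca, map_mul, map_mul]
    exact (htu.map ψ.toRingHom).mul ((hsu.map ψ.toRingHom).mul hcu)
  · simp only [comp_apply, map_mul, ← hca, ← hb, ← hd, mul_assoc]
    exact (((SuperRing.commute_of_even ht s).map φ.toRingHom).map ψ.toRingHom).left_comm _

theorem exists_mul_eq_of_mem_span_odd (hφ : φ.IsFractionMap) {c : C}
    (hc : c ∈ TwoSidedIdeal.span (𝒞 1 : Set C)) :
    ∃ s ∈ 𝒜 0, IsUnit (φ.toRingHom s) ∧ ∃ a ∈ TwoSidedIdeal.span (𝒜 1 : Set A),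
      φ.toRingHom s * c = φ.toRingHom a := by
  induction hc using TwoSidedIdeal.span_induction with
  | mem c hc =>
    obtain ⟨s, hs, hsu, a, ha⟩ := hφ.exists_mul_eq c
    refine ⟨s, hs, hsu, a, TwoSidedIdeal.subset_span
      ((φ.map_mem_iff_of_injective hφ.injective).1 ?_), ha⟩
    rw [← ha]
    exact SuperRing.even_mul_mem (φ.map_mem 0 s hs) hc
  | zero => exact ⟨1, SuperRing.one_mem, by simp, 0, zero_mem _, by simp⟩
  | add c d _ _ hc hd =>
    obtain ⟨s, hs, hsu, a, ha, hca⟩ := hc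
    obtain ⟨t, ht, htu, b, hb, hdb⟩ := hd
    refine ⟨s * t, SuperRing.even_mul_mem hs ht, map_mul φ.toRingHom s t ▸ hsu.mul htu,
      t * a + s * b, add_mem (TwoSidedIdeal.mul_mem_left _ _ _ ha)
        (TwoSidedIdeal.mul_mem_left _ _ _ hb), ?_⟩
    rw [map_add, map_mul, map_mul, map_mul, ← hca, ← hdb, mul_add, mul_assoc, mul_assoc,
      φ.mul_map_mul_left hs]
  | neg c _ hc =>
    obtain ⟨s, hs, hsu, a, ha, hca⟩ := hc
    exact ⟨s, hs, hsu, -a, neg_mem ha, by rw [mul_neg, hca, map_neg]⟩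
  | left_absorb d c _ hc =>
    obtain ⟨s, hs, hsu, a, ha, hca⟩ := hc
    obtain ⟨t, ht, htu, b, hdb⟩ := hφ.exists_mul_eq d
    refine ⟨t * s, SuperRing.even_mul_mem ht hs, map_mul φ.toRingHom t s ▸ htu.mul hsu, b * a,
      TwoSidedIdeal.mul_mem_left _ _ _ ha, ?_⟩
    rw [map_mul, map_mul, ← hca, ← hdb, mul_assoc, mul_assoc, φ.mul_map_mul_left hs d c]
  | right_absorb d c _ hc =>
    obtain ⟨s, hs, hsu, a, ha, hca⟩ := hc
    obtain ⟨t, ht, htu, b, hdb⟩ := hφ.exists_mul_eq d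
    refine ⟨s * t, SuperRing.even_mul_mem hs ht, map_mul φ.toRingHom s t ▸ hsu.mul htu, a * b,
      TwoSidedIdeal.mul_mem_right _ _ _ ha, ?_⟩
    rw [map_mul, map_mul, ← hca, ← hdb, mul_assoc, mul_assoc, φ.mul_map_mul_left ht c]

end IsFractionMap

end SuperHom

end FractionMaps

section IntegralSuperRings

variable {A : Type u} [Ring A] {𝒜 : ZMod 2 → AddSubgroup A}

/-- Superrings that behave like integral domains: every zero divisor is nilpotent, and every
nilpotent element lies, up to an even non-zero-divisor, in the ideal generated by the odd part. -/
structure IsIntegralSuperRing (𝒜 : ZMod 2 → AddSubgroup A) : Prop where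
  nontrivial : Nontrivial A
  isNilpotent_or_mem_nonZeroDivisorsLeft (a : A) : IsNilpotent a ∨ a ∈ nonZeroDivisorsLeft A
  exists_mul_mem_span_odd {a : A} : IsNilpotent a → ∃ u ∈ 𝒜 0, u ∈ nonZeroDivisorsLeft A ∧
    u * a ∈ TwoSidedIdeal.span (𝒜 1 : Set A)

namespace IsIntegralSuperRing

theorem mem_nonZeroDivisorsLeft_iff (h : IsIntegralSuperRing 𝒜) {a : A} :
    a ∈ nonZeroDivisorsLeft A ↔ ¬IsNilpotent a := by
  refine ⟨fun ha ⟨n, hn⟩ => ?_, (h.isNilpotent_or_mem_nonZeroDivisorsLeft a).resolve_left⟩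
  have := h.nontrivial
  exact zero_notMem_nonZeroDivisorsLeft (hn ▸ pow_mem ha n)

theorem isNilpotent_or_isNilpotent_of_mul (h : IsIntegralSuperRing 𝒜) {a b : A}
    (hab : IsNilpotent (a * b)) : IsNilpotent a ∨ IsNilpotent b := by
  by_contra! hn
  exact h.mem_nonZeroDivisorsLeft_iff.1 (mul_mem (h.mem_nonZeroDivisorsLeft_iff.2 hn.1)
    (h.mem_nonZeroDivisorsLeft_iff.2 hn.2)) hab

theorem zeroDivisorSet_eq (h : IsIntegralSuperRing 𝒜) :
    zeroDivisorSet A = {a | IsNilpotent a} := by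
  ext a
  rw [Set.mem_ofPred_eq, ← not_iff_not, ← h.mem_nonZeroDivisorsLeft_iff,
    _root_.mem_nonZeroDivisorsLeft_iff]
  simp only [zeroDivisorSet, Set.mem_ofPred_eq, not_exists, not_and, ne_eq, not_imp_not]

section FractionMaps

variable {C : Type v} [Ring C] {𝒞 : ZMod 2 → AddSubgroup C} [SuperRing 𝒜] [SuperRing 𝒞]
variable {φ : SuperHom 𝒜 𝒞}

theorem of_isFractionMap (hφ : φ.IsFractionMap) (h : IsIntegralSuperRing 𝒞) :
    IsIntegralSuperRing 𝒜 where
  nontrivial := by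
    have := h.nontrivial
    exact φ.toRingHom.domain_nontrivial
  isNilpotent_or_mem_nonZeroDivisorsLeft a :=
    (h.isNilpotent_or_mem_nonZeroDivisorsLeft (φ.toRingHom a)).imp
      (IsNilpotent.map_iff hφ.injective).1 hφ.mem_nonZeroDivisorsLeft_of_map
  exists_mul_mem_span_odd {a} ha := by
    obtain ⟨c, hc, hreg, hspan⟩ := h.exists_mul_mem_span_odd (ha.map φ.toRingHom)
    obtain ⟨s, hs, hsu, u, hu, hcu⟩ := hφ.exists_even_mul_eq hc
    obtain ⟨t, ht, htu, b, hb, hab⟩ := hφ.exists_mul_eq_of_mem_span_odd hspan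
    refine ⟨t * u, SuperRing.even_mul_mem ht hu, hφ.mem_nonZeroDivisorsLeft_of_map ?_, ?_⟩
    · rw [map_mul, ← hcu]
      exact mul_mem htu.mem_nonZeroDivisors.1 (mul_mem hsu.mem_nonZeroDivisors.1 hreg)
    · have e : t * u * a = s * b := hφ.injective <| by
        rw [map_mul, map_mul, map_mul, ← hcu, ← hab, mul_assoc, mul_assoc,
          φ.mul_map_mul_left hs]
      exact e ▸ TwoSidedIdeal.mul_mem_left _ _ _ hb

theorem map_isFractionMap (hφ : φ.IsFractionMap) (h : IsIntegralSuperRing 𝒜) :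
    IsIntegralSuperRing 𝒞 where
  nontrivial := by
    have := h.nontrivial
    exact hφ.injective.nontrivial
  isNilpotent_or_mem_nonZeroDivisorsLeft c := by
    obtain ⟨s, hs, hsu, a, ha⟩ := hφ.exists_mul_eq c
    have hsc := SuperRing.commute_of_even (φ.map_mem 0 s hs)
    refine (h.isNilpotent_or_mem_nonZeroDivisorsLeft a).imp (fun hn => ?_) fun hreg y hy => ?_
    · exact (hsu.isNilpotent_unit_mul_of_commute_iff (hsc c).symm).1 (ha ▸ hn.map φ.toRingHom)
    · refine hφ.map_mem_nonZeroDivisorsLeft hreg y ?_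
      rw [← ha, mul_assoc, hy, mul_zero]
  exists_mul_mem_span_odd {c} hc := by
    obtain ⟨s, hs, hsu, a, ha⟩ := hφ.exists_mul_eq c
    have hn : IsNilpotent (φ.toRingHom a) := ha ▸
      (SuperRing.commute_of_even (φ.map_mem 0 s hs) c).isNilpotent_mul_left hc
    obtain ⟨u, hu, hreg, hspan⟩ :=
      h.exists_mul_mem_span_odd ((IsNilpotent.map_iff hφ.injective).1 hn)
    refine ⟨φ.toRingHom (u * s), φ.map_mem 0 _ (SuperRing.even_mul_mem hu hs), ?_, ?_⟩
    · rw [map_mul]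
      exact mul_mem (hφ.map_mem_nonZeroDivisorsLeft hreg) hsu.mem_nonZeroDivisors.1
    · rw [map_mul, mul_assoc, ha, ← map_mul]
      exact φ.map_mem_span_odd hspan

end FractionMaps

end IsIntegralSuperRing

end IntegralSuperRings

section Localization

variable {A : Type u} [Ring A] (𝒜 : ZMod 2 → AddSubgroup A) [SuperRing 𝒜]
variable (S : Submonoid (evenPart 𝒜))

/-- The homomorphism of superrings `A → S⁻¹A`. -/
def locHom : SuperHom 𝒜 (locGrading 𝒜 S) where
  toRingHom := locMap 𝒜 S
  map_mem _ a ha := ⟨a, ha, 1, rfl⟩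

theorem locMap_mul_mk (a : A) (s : S) :
    locMap 𝒜 S (s : evenPart 𝒜) * LocalizedModule.mk a s = locMap 𝒜 S a := by
  change LocalizedModule.mk _ 1 * LocalizedModule.mk _ _ = LocalizedModule.mk _ 1
  rw [LocalizedModule.mk_mul_mk, one_mul]
  exact LocalizedModule.mk_cancel s a

theorem isUnit_locMap (s : S) : IsUnit (locMap 𝒜 S (s : evenPart 𝒜)) := by
  have h : locMap 𝒜 S (s : evenPart 𝒜) * LocalizedModule.mk 1 s = 1 := by
    rw [locMap_mul_mk, map_one]
  refine ⟨⟨_, _, h, ?_⟩, rfl⟩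
  rw [← h]
  exact (SuperRing.commute_of_even ((locHom 𝒜 S).map_mem 0 _ s.1.2) _).symm

variable {S}

theorem locHom_isFractionMap (hS : S ≤ evenNonZeroDivisors 𝒜) : (locHom 𝒜 S).IsFractionMap where
  injective := by
    refine (injective_iff_map_eq_zero _).2 fun a ha => ?_
    obtain ⟨s, hs⟩ := LocalizedModule.mk_eq.1 (Eq.trans ha (LocalizedModule.zero_mk 1).symm)
    refine hS s.2 _ ?_
    rwa [one_smul, smul_zero, smul_zero] at hs
  exists_mul_eq x := by
    induction x using LocalizedModule.induction_on with
    | h a s => exact ⟨s.1, s.1.2, isUnit_locMap 𝒜 S s, a, locMap_mul_mk 𝒜 S a s⟩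

theorem locMap_bijective_of_isUnit (hS : ∀ s ∈ S, IsUnit (s : A)) :
    Function.Bijective (locMap 𝒜 S) := by
  refine ⟨(locHom_isFractionMap 𝒜 fun s hs b hb => (hS s hs).mul_right_eq_zero.1 hb).injective,
    fun x => ?_⟩
  induction x using LocalizedModule.induction_on with
  | h a s =>
    obtain ⟨t, ht⟩ := (hS s s.2).exists_left_inv
    refine ⟨t * a, (isUnit_locMap 𝒜 S s).mul_left_cancel ?_⟩
    rw [locMap_mul_mk, ← map_mul, ← mul_assoc, SuperRing.even_comm s.1.2, ht, one_mul]

end Localization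

section ReducedSuperschemes

variable {A : Type u} [Ring A] {𝒜 : ZMod 2 → AddSubgroup A} [SuperRing 𝒜]

theorem closure_singleton_eq_univ {p : SuperSpec 𝒜} (hp : p.asIdeal ≤ nilradical (evenPart 𝒜)) :
    closure ({p} : Set (SuperSpec 𝒜)) = Set.univ := by
  rw [PrimeSpectrum.closure_singleton, Set.eq_univ_iff_forall]
  exact fun p' => hp.trans (nilradical_le_prime p'.asIdeal)

/-- The homomorphism `𝒪_A(U) → A_p` that maps a section to its germ. -/
def germHom (U : Opens (SuperSpec 𝒜)) {p : SuperSpec 𝒜} (hp : p ∈ U) :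
    SuperHom (sectionsGrading 𝒜 U) (stalkGrading 𝒜 p) where
  toRingHom := (Pi.evalRingHom _ (⟨p, hp⟩ : U)).comp (superSections 𝒜 U).subtype
  map_mem _ _ hs := hs ⟨p, hp⟩

/-- The restriction map `A → 𝒪_A(U)`. -/
def toSections (U : Opens (SuperSpec 𝒜)) : SuperHom 𝒜 (sectionsGrading 𝒜 U) where
  toRingHom := (RingHom.pi fun p : U => locMap 𝒜 p.1.asIdeal.primeCompl).codRestrict
    (superSections 𝒜 U) fun a p => ⟨U, le_rfl, p.2, a, 1, fun _ => ⟨Submonoid.one_mem _, rfl⟩⟩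
  map_mem _ a ha _ := ⟨a, ha, 1, rfl⟩

namespace IsIntegralSuperRing

theorem superJ_eq (h : IsIntegralSuperRing 𝒜) : (superJ 𝒜 : Set A) = {a | IsNilpotent a} := by
  let κ := locHom 𝒜 (evenNonZeroDivisors 𝒜)
  ext a
  rw [SetLike.mem_coe, superJ, TwoSidedIdeal.mem_comap]
  constructor <;> intro ha
  · exact (IsNilpotent.map_iff (locHom_isFractionMap 𝒜 le_rfl).injective).1
      (SuperRing.isNilpotent_of_mem_span_odd ha)
  · obtain ⟨u, hu, hreg, hspan⟩ := h.exists_mul_mem_span_odd ha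
    obtain ⟨v, hv⟩ := (isUnit_locMap 𝒜 _ (⟨⟨u, hu⟩, hreg⟩ : evenNonZeroDivisors 𝒜)).exists_left_inv
    have e : locMap 𝒜 (evenNonZeroDivisors 𝒜) a = v * κ.toRingHom (u * a) := by
      rw [map_mul, ← mul_assoc]
      exact (one_mul (locMap 𝒜 _ a)).symm.trans (congrArg (· * _) hv.symm)
    exact e ▸ TwoSidedIdeal.mul_mem_left _ _ _ (κ.map_mem_span_odd hspan)

theorem isReducedSuperRing (h : IsIntegralSuperRing 𝒜) : IsReducedSuperRing 𝒜 := by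
  refine ⟨h.superJ_eq, ?_⟩
  have := h.nontrivial
  have hmk (a : A) : (superJ 𝒜).ringCon.mk' a = 0 ↔ IsNilpotent a := by
    rw [← Set.mem_ofPred (p := IsNilpotent), ← h.superJ_eq, SetLike.mem_coe, TwoSidedIdeal.mem_iff,
      ← map_zero ((superJ 𝒜).ringCon.mk')]
    exact RingCon.eq _
  rw [h.zeroDivisorSet_eq]
  ext x
  obtain ⟨a, rfl⟩ := RingCon.mk'_surjective _ x
  constructor
  · rintro ⟨b, hb, hba⟩
    rw [← hba, (hmk b).2 hb]
    exact ⟨1, fun h1 => not_isNilpotent_one ((hmk 1).1 (by rw [map_one]; exact h1)), zero_mul _⟩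
  · rintro ⟨y, hy, hxy⟩
    obtain ⟨b, rfl⟩ := RingCon.mk'_surjective _ y
    rw [← map_mul, hmk] at hxy
    rw [Ne, hmk] at hy
    exact ⟨a, (h.isNilpotent_or_isNilpotent_of_mul hxy).resolve_right hy, rfl⟩

theorem isPrime_nilradical (h : IsIntegralSuperRing 𝒜) : (nilradical (evenPart 𝒜)).IsPrime := by
  have := h.nontrivial
  refine ⟨fun htop => ?_, fun {x y} hxy => ?_⟩
  · have h1 : (1 : evenPart 𝒜) ∈ nilradical (evenPart 𝒜) := htop ▸ Submodule.mem_top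
    exact not_isNilpotent_one (SuperRing.isNilpotent_coe_evenPart_iff.2 (mem_nilradical.1 h1))
  · simp only [mem_nilradical, ← SuperRing.isNilpotent_coe_evenPart_iff] at hxy ⊢
    exact h.isNilpotent_or_isNilpotent_of_mul hxy

/-- The generic point of the spectrum of an integral superring. -/
def genericPoint (h : IsIntegralSuperRing 𝒜) : SuperSpec 𝒜 :=
  ⟨nilradical (evenPart 𝒜), h.isPrime_nilradical⟩

theorem closure_genericPoint (h : IsIntegralSuperRing 𝒜) :
    closure ({h.genericPoint} : Set (SuperSpec 𝒜)) = Set.univ :=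
  closure_singleton_eq_univ le_rfl

theorem irreducibleSpace (h : IsIntegralSuperRing 𝒜) : IrreducibleSpace (SuperSpec 𝒜) := by
  have huniv : IsIrreducible (Set.univ : Set (SuperSpec 𝒜)) :=
    h.closure_genericPoint ▸ isIrreducible_singleton.closure
  exact (irreducibleSpace_def _).2 huniv

theorem genericPoint_mem (h : IsIntegralSuperRing 𝒜) {U : Opens (SuperSpec 𝒜)} {p : SuperSpec 𝒜}
    (hp : p ∈ U) : h.genericPoint ∈ U := by
  have hp' : p ∈ closure ({h.genericPoint} : Set (SuperSpec 𝒜)) :=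
    h.closure_genericPoint ▸ Set.mem_univ p
  obtain ⟨_, hq, rfl⟩ := mem_closure_iff.1 hp' U U.2 hp
  exact hq

theorem mem_primeCompl_genericPoint_iff (h : IsIntegralSuperRing 𝒜) {s : evenPart 𝒜} :
    s ∈ h.genericPoint.asIdeal.primeCompl ↔ (s : A) ∈ nonZeroDivisorsLeft A := by
  rw [h.mem_nonZeroDivisorsLeft_iff, SuperRing.isNilpotent_coe_evenPart_iff]
  rfl

theorem locHom_genericPoint_isFractionMap (h : IsIntegralSuperRing 𝒜) :
    (locHom 𝒜 h.genericPoint.asIdeal.primeCompl).IsFractionMap :=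
  locHom_isFractionMap 𝒜 fun _ hs => h.mem_primeCompl_genericPoint_iff.1 hs

theorem germHom_isFractionMap (h : IsIntegralSuperRing 𝒜) {U : Opens (SuperSpec 𝒜)}
    (hU : h.genericPoint ∈ U) : (germHom U hU).IsFractionMap where
  injective := by
    refine (injective_iff_map_eq_zero _).2 fun s hs => Subtype.ext (funext fun p => ?_)
    obtain ⟨V, _, hpV, a, f, hV⟩ := s.2 p
    obtain ⟨hf, eη⟩ := hV ⟨h.genericPoint, h.genericPoint_mem hpV⟩
    obtain ⟨hf', ep⟩ := hV ⟨p.1, hpV⟩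
    have ha : a = 0 := by
      refine h.locHom_genericPoint_isFractionMap.injective ?_
      rw [map_zero]
      refine (locMap_mul_mk 𝒜 _ a ⟨f, hf⟩).symm.trans ?_
      rw [← eη]
      exact (congrArg (_ * ·) hs).trans (mul_zero _)
    rw [ha, LocalizedModule.zero_mk] at ep
    exact ep
  exists_mul_eq x := by
    obtain ⟨f, hf, hfu, a, ha⟩ := h.locHom_genericPoint_isFractionMap.exists_mul_eq x
    exact ⟨(toSections U).toRingHom f, (toSections U).map_mem 0 f hf, hfu,
      (toSections U).toRingHom a, ha⟩

theorem sections (h : IsIntegralSuperRing 𝒜) {U : Opens (SuperSpec 𝒜)}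
    (hU : h.genericPoint ∈ U) : IsIntegralSuperRing (sectionsGrading 𝒜 U) :=
  of_isFractionMap (h.germHom_isFractionMap hU)
    (h.map_isFractionMap h.locHom_genericPoint_isFractionMap)

end IsIntegralSuperRing

theorem isReducedSuperRing_of_subsingleton [Subsingleton A] : IsReducedSuperRing 𝒜 := by
  have : Subsingleton (UnderlyingRing 𝒜) :=
    (RingCon.mk'_surjective (superJ 𝒜).ringCon).subsingleton
  refine ⟨Set.ext fun a => ?_, Set.ext fun x => iff_of_false ?_ ?_⟩
  · rw [Subsingleton.elim a 0]
    exact iff_of_true (zero_mem _) IsNilpotent.zero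
  · rintro ⟨_, ⟨b, hb, _⟩, _⟩
    exact hb (Subsingleton.elim _ _)
  · rintro ⟨b, hb, _⟩
    exact hb (Subsingleton.elim _ _)

theorem IsIntegralSuperRing.isReducedSuperSpec (h : IsIntegralSuperRing 𝒜) :
    IsReducedSuperSpec 𝒜 := by
  intro U _
  by_cases hU : h.genericPoint ∈ U
  · exact (h.sections hU).isReducedSuperRing
  · have : IsEmpty U := ⟨fun p => hU (h.genericPoint_mem p.2)⟩
    exact isReducedSuperRing_of_subsingleton

end ReducedSuperschemes

section OpenImmersions

namespace SuperHom

variable {A : Type u} [Ring A] {𝒜 : ZMod 2 → AddSubgroup A} [SuperRing 𝒜]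
variable {C : Type v} [Ring C] {𝒞 : ZMod 2 → AddSubgroup C} [SuperRing 𝒞]
variable {φ : SuperHom 𝒜 𝒞}

theorem stalkMap_mk (φ : SuperHom 𝒜 𝒞) (p : SuperSpec 𝒞) (a : A)
    (s : (φ.specMap p).asIdeal.primeCompl) :
    φ.stalkMap p (LocalizedModule.mk a s) =
      LocalizedModule.mk (φ.toRingHom a) ⟨φ.evenHom s, s.2⟩ := rfl

/-- The map `A_{φ⁻¹(p)} → C_p` of stalks as a homomorphism of superrings. -/
def stalkHom (φ : SuperHom 𝒜 𝒞) (p : SuperSpec 𝒞) :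
    SuperHom (stalkGrading 𝒜 (φ.specMap p)) (stalkGrading 𝒞 p) where
  toRingHom :=
    { toFun := φ.stalkMap p
      map_one' := by
        rw [loc_one_def, loc_one_def, stalkMap_mk, map_one]
        exact congrArg _ (Subtype.ext (map_one φ.evenHom))
      map_zero' := by
        rw [← LocalizedModule.zero_mk 1, stalkMap_mk, map_zero, LocalizedModule.zero_mk]
      map_mul' x y := by
        induction x, y using LocalizedModule.induction_on₂ with
        | h a b s t =>
          rw [LocalizedModule.mk_mul_mk, stalkMap_mk, stalkMap_mk, stalkMap_mk,
            LocalizedModule.mk_mul_mk, map_mul]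
          exact congrArg _ (Subtype.ext (map_mul φ.evenHom s.1 t.1))
      map_add' x y := by
        induction x, y using LocalizedModule.induction_on₂ with
        | h a b s t =>
          rw [LocalizedModule.mk_add_mk, stalkMap_mk, stalkMap_mk, stalkMap_mk,
            LocalizedModule.mk_add_mk, map_add]
          congr 1
          · exact congrArg₂ (· + ·) (map_mul φ.toRingHom _ _) (map_mul φ.toRingHom _ _)
          · exact Subtype.ext (map_mul φ.evenHom s.1 t.1) }
  map_mem := by
    rintro i _ ⟨a, ha, s, rfl⟩
    exact ⟨_, φ.map_mem i a ha, _, rfl⟩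

namespace IsFractionMap

theorem evenHom_injective (hφ : φ.IsFractionMap) : Function.Injective φ.evenHom :=
  fun _ _ h => Subtype.ext (hφ.injective (congrArg Subtype.val h))

theorem exists_evenHom_mul_eq (hφ : φ.IsFractionMap) (c : evenPart 𝒞) :
    ∃ s a : evenPart 𝒜, IsUnit (φ.evenHom s) ∧ φ.evenHom s * c = φ.evenHom a := by
  obtain ⟨s, hs, hsu, a, ha, e⟩ := hφ.exists_even_mul_eq c.2
  exact ⟨⟨s, hs⟩, ⟨a, ha⟩, SuperRing.isUnit_coe_evenPart_iff.1 hsu, Subtype.ext e⟩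

theorem exists_mem_primeCompl_mul_eq (hφ : φ.IsFractionMap) {p : SuperSpec 𝒞}
    (r : p.asIdeal.primeCompl) :
    ∃ s r' : (φ.specMap p).asIdeal.primeCompl, φ.evenHom s * r = φ.evenHom r' := by
  obtain ⟨s, r', hs, h⟩ := hφ.exists_evenHom_mul_eq r
  have hsp : φ.evenHom s ∈ p.asIdeal.primeCompl :=
    fun hmem => p.2.ne_top (Ideal.eq_top_of_isUnit_mem _ hmem hs)
  have hr'p : φ.evenHom r' ∈ p.asIdeal.primeCompl := h ▸ mul_mem hsp r.2
  exact ⟨⟨s, hsp⟩, ⟨r', hr'p⟩, h⟩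

theorem stalkMap_injective (hφ : φ.IsFractionMap) (p : SuperSpec 𝒞) :
    Function.Injective (φ.stalkMap p) := by
  intro x y hxy
  induction x, y using LocalizedModule.induction_on₂ with
  | h a b f g =>
    obtain ⟨r, hr⟩ := LocalizedModule.mk_eq.1 hxy
    obtain ⟨s, r', hr'⟩ := hφ.exists_mem_primeCompl_mul_eq r
    have hr : (r : C) * φ.toRingHom ((g : evenPart 𝒜) * a) =
        (r : C) * φ.toRingHom ((f : evenPart 𝒜) * b) := by
      rw [map_mul, map_mul]
      exact hr
    have hr' : φ.toRingHom (s : evenPart 𝒜) * (r : C) = φ.toRingHom (r' : evenPart 𝒜) :=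
      congrArg Subtype.val hr'
    refine LocalizedModule.mk_eq.2 ⟨r', hφ.injective ?_⟩
    change φ.toRingHom ((r' : evenPart 𝒜) * ((g : evenPart 𝒜) * a)) =
      φ.toRingHom ((r' : evenPart 𝒜) * ((f : evenPart 𝒜) * b))
    rw [map_mul _ (r' : A), map_mul _ (r' : A), ← hr', mul_assoc, mul_assoc, hr]

theorem stalkMap_surjective (hφ : φ.IsFractionMap) (p : SuperSpec 𝒞) :
    Function.Surjective (φ.stalkMap p) := by
  intro y
  induction y using LocalizedModule.induction_on with
  | h c r =>
    obtain ⟨s, r', hr⟩ := hφ.exists_mem_primeCompl_mul_eq r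
    obtain ⟨t, ht, htu, a, ha⟩ := hφ.exists_mul_eq c
    have htp : φ.evenHom ⟨t, ht⟩ ∈ p.asIdeal.primeCompl := fun hmem =>
      p.2.ne_top (Ideal.eq_top_of_isUnit_mem _ hmem (SuperRing.isUnit_coe_evenPart_iff.1 htu))
    have hr : φ.toRingHom (s : evenPart 𝒜) * (r : C) = φ.toRingHom (r' : evenPart 𝒜) :=
      congrArg Subtype.val hr
    refine ⟨LocalizedModule.mk ((s : evenPart 𝒜) * a) (⟨⟨t, ht⟩, htp⟩ * r'), ?_⟩
    refine LocalizedModule.mk_eq.2 ⟨1, ?_⟩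
    rw [one_smul, one_smul]
    change (r : C) * φ.toRingHom ((s : evenPart 𝒜) * a) = φ.toRingHom (t * (r' : evenPart 𝒜)) * c
    rw [map_mul, map_mul, ← ha, ← hr, φ.mul_map_mul_left s.1.2, φ.mul_map_mul_left ht]
    simp only [mul_assoc, φ.mul_map_mul_left ht]

theorem stalkMap_bijective (hφ : φ.IsFractionMap) (p : SuperSpec 𝒞) :
    Function.Bijective (φ.stalkMap p) :=
  ⟨hφ.stalkMap_injective p, hφ.stalkMap_surjective p⟩

end IsFractionMap

theorem isFractionMap_of_away (hφ : Function.Injective φ.toRingHom) {s : evenPart 𝒜}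
    (hs : IsUnit (φ.evenHom s)) (hfrac : ∀ c : C, ∃ (n : ℕ) (a : A),
      φ.toRingHom s ^ n * c = φ.toRingHom a) : φ.IsFractionMap := by
  refine ⟨hφ, fun c => ?_⟩
  obtain ⟨n, a, h⟩ := hfrac c
  refine ⟨(s : A) ^ n, SuperRing.pow_mem_even s.2 n, ?_, a, by rw [map_pow, h]⟩
  rw [map_pow]
  exact (SuperRing.isUnit_coe_evenPart_iff.2 hs).pow n

theorem isOpenEmbedding_specMap_of_away (hφ : Function.Injective φ.toRingHom) {s : evenPart 𝒜}
    (hs : IsUnit (φ.evenHom s)) (hfrac : ∀ c : C, ∃ (n : ℕ) (a : A),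
      φ.toRingHom s ^ n * c = φ.toRingHom a) : Topology.IsOpenEmbedding φ.specMap := by
  let : Algebra (evenPart 𝒜) (evenPart 𝒞) := φ.evenHom.toAlgebra
  have : IsLocalization.Away s (evenPart 𝒞) := by
    refine ⟨⟨?_, fun c => ?_, fun {a b} hab => ⟨1, ?_⟩⟩⟩
    · rintro ⟨_, n, rfl⟩
      exact map_pow φ.evenHom s n ▸ hs.pow n
    · obtain ⟨n, a, h⟩ := hfrac c
      have ha : a ∈ 𝒜 0 := (φ.map_mem_iff_of_injective hφ).1 <| h ▸
        SuperRing.even_mul_mem (SuperRing.pow_mem_even (φ.map_mem 0 s s.2) n) c.2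
      refine ⟨⟨⟨a, ha⟩, ⟨s ^ n, n, rfl⟩⟩, Subtype.ext ?_⟩
      change (c : C) * φ.toRingHom ((s : A) ^ n) = φ.toRingHom a
      rw [map_pow, ← h]
      exact SuperRing.even_comm c.2 _
    · rw [(isFractionMap_of_away hφ hs hfrac).evenHom_injective hab]
  exact PrimeSpectrum.localization_away_isOpenEmbedding (evenPart 𝒞) s

theorem isOpenImmersion_of_away (hφ : Function.Injective φ.toRingHom) {s : evenPart 𝒜}
    (hs : IsUnit (φ.evenHom s)) (hfrac : ∀ c : C, ∃ (n : ℕ) (a : A),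
      φ.toRingHom s ^ n * c = φ.toRingHom a) : φ.IsOpenImmersion :=
  ⟨isOpenEmbedding_specMap_of_away hφ hs hfrac,
    (isFractionMap_of_away hφ hs hfrac).stalkMap_bijective⟩

end SuperHom

end OpenImmersions

section FermionicRegularity

variable {A E : Type u} [Ring A] {𝒜 : ZMod 2 → AddSubgroup A} [SuperRing 𝒜]
variable [Ring E] {ℰ : ZMod 2 → AddSubgroup E} [SuperRing ℰ] {φ : SuperHom 𝒜 ℰ}

theorem IsIntegralSuperRing.isGFRSuperSpec (h : IsIntegralSuperRing ℰ)
    (hunit : nonZeroDivisorsLeft E ≤ IsUnit.submonoid E) (hE : IsFermionicallyRegular ℰ)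
    (hφ : φ.IsFractionMap) : IsGFRSuperSpec 𝒜 := by
  let η := h.genericPoint
  refine ⟨{φ.specMap η}, closure_singleton_eq_univ fun a ha => ?_, ?_⟩
  · exact (IsNilpotent.map_iff hφ.evenHom_injective).1 ha
  · rintro _ rfl
    rw [(φ.stalkHom η).isFermionicallyRegular_iff_of_bijective (hφ.stalkMap_bijective η),
      ← (locHom ℰ η.asIdeal.primeCompl).isFermionicallyRegular_iff_of_bijective]
    · exact hE
    · exact locMap_bijective_of_isUnit ℰ fun s hs => hunit (h.mem_primeCompl_genericPoint_iff.1 hs)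

end FermionicRegularity

section ExteriorAlgebras

theorem isCompl_of_exists_add {G : Type*} [AddCommGroup G] {H K : AddSubgroup G}
    (hinf : ∀ a ∈ H, a ∈ K → a = 0) (hsup : ∀ a, ∃ b ∈ H, ∃ c ∈ K, b + c = a) : IsCompl H K :=
  ⟨AddSubgroup.disjoint_def.2 (hinf _), codisjoint_iff.2 <| eq_top_iff.2 fun a _ => by
    obtain ⟨b, hb, c, hc, rfl⟩ := hsup a
    exact AddSubgroup.add_mem_sup hb hc⟩

theorem SuperRing.of_ringEquiv {A B : Type*} [Ring A] [Ring B] {𝒜 : ZMod 2 → AddSubgroup A}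
    {ℬ : ZMod 2 → AddSubgroup B} [SuperRing ℬ] (e : A ≃+* B) (he : ∀ i a, a ∈ 𝒜 i ↔ e a ∈ ℬ i) :
    SuperRing 𝒜 where
  one_mem := (he 0 1).2 (map_one e ▸ SuperRing.one_mem)
  mul_mem ha hb := (he _ _).2 (map_mul e _ _ ▸ SuperRing.mul_mem ((he _ _).1 ha) ((he _ _).1 hb))
  isCompl := by
    refine isCompl_of_exists_add (fun a h0 h1 => (map_eq_zero_iff e e.injective).1 <|
      eq_zero_of_even_of_odd ℬ ((he 0 a).1 h0) ((he 1 a).1 h1)) fun a => ?_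
    obtain ⟨b, hb, c, hc, h⟩ := exists_even_add_odd ℬ (e a)
    refine ⟨e.symm b, (he 0 _).2 ?_, e.symm c, (he 1 _).2 ?_, ?_⟩
    · rwa [e.apply_symm_apply]
    · rwa [e.apply_symm_apply]
    · rw [← map_add, h, e.symm_apply_apply]
  even_comm ha b := e.injective (by simpa using SuperRing.even_comm ((he 0 _).1 ha) (e b))
  odd_anticomm ha hb := e.injective (by
    simpa using SuperRing.odd_anticomm ((he 1 _).1 ha) ((he 1 _).1 hb))
  odd_sq ha := e.injective (by simpa using SuperRing.odd_sq ((he 1 _).1 ha))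

/-- The grading of the exterior algebra of a module by the parity of the degree. -/
def exteriorGrading (R : Type u) (M : Type v) [CommRing R] [AddCommGroup M] [Module R M]
    (i : ZMod 2) : AddSubgroup (ExteriorAlgebra R M) :=
  (CliffordAlgebra.evenOdd (0 : QuadraticForm R M) i).toAddSubgroup

namespace exteriorGrading

variable {R : Type u} {M : Type v} [CommRing R] [AddCommGroup M] [Module R M]

open ExteriorAlgebra (ι)

theorem ι_mul_ι_comm (v w : M) : ι R v * ι R w = -(ι R w * ι R v) :=
  eq_neg_of_add_eq_zero_left (ExteriorAlgebra.ι_add_mul_swap v w)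

theorem commute_ι_mul_ι (v w : M) (b : ExteriorAlgebra R M) : Commute (ι R v * ι R w) b := by
  induction b using ExteriorAlgebra.induction with
  | algebraMap r => exact Algebra.commute_algebraMap_right r _
  | ι x =>
    change ι R v * ι R w * ι R x = ι R x * (ι R v * ι R w)
    rw [mul_assoc, ι_mul_ι_comm w x, mul_neg, ← mul_assoc, ι_mul_ι_comm v x, neg_mul, neg_neg,
      mul_assoc]
  | mul a b ha hb => exact ha.mul_right hb
  | add a b ha hb => exact ha.add_right hb

theorem commute_of_mem_zero {a : ExteriorAlgebra R M} (ha : a ∈ exteriorGrading R M 0)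
    (b : ExteriorAlgebra R M) : Commute a b := by
  induction a, ha using CliffordAlgebra.even_induction with
  | algebraMap r => exact Algebra.commute_algebraMap_left r b
  | add x y _ _ hx hy => exact hx.add_left hy
  | ι_mul_ι_mul v w x _ hx => exact (commute_ι_mul_ι v w b).mul_left hx

theorem ι_mul_of_mem_one (v : M) {b : ExteriorAlgebra R M} (hb : b ∈ exteriorGrading R M 1) :
    ι R v * b = -(b * ι R v) := by
  induction b, hb using CliffordAlgebra.odd_induction with
  | ι w => exact ι_mul_ι_comm v w
  | add x y _ _ hx hy => rw [mul_add, hx, hy, add_mul, neg_add]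
  | ι_mul_ι_mul w₁ w₂ x _ hx =>
    have hw := (commute_ι_mul_ι w₁ w₂ (ι R v)).eq
    calc ι R v * (ι R w₁ * ι R w₂ * x) = ι R w₁ * ι R w₂ * (ι R v * x) := by
          rw [← mul_assoc, ← hw, mul_assoc]
      _ = -(ι R w₁ * ι R w₂ * x * ι R v) := by rw [hx, mul_neg, mul_assoc _ x]

theorem mul_comm_of_mem_one {a b : ExteriorAlgebra R M} (ha : a ∈ exteriorGrading R M 1)
    (hb : b ∈ exteriorGrading R M 1) : a * b = -(b * a) := by
  induction a, ha using CliffordAlgebra.odd_induction with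
  | ι v => exact ι_mul_of_mem_one v hb
  | add x y _ _ hx hy => rw [mul_add, add_mul, hx, hy, neg_add]
  | ι_mul_ι_mul v w x _ hx =>
    have hvw := (commute_ι_mul_ι v w b).eq
    calc ι R v * ι R w * x * b = -(ι R v * ι R w * b * x) := by
          rw [mul_assoc _ x, hx, mul_neg, mul_assoc _ b]
      _ = -(b * (ι R v * ι R w * x)) := by rw [hvw, mul_assoc b]

theorem mul_self_of_mem_one {a : ExteriorAlgebra R M} (ha : a ∈ exteriorGrading R M 1) :
    a * a = 0 := by
  induction a, ha using CliffordAlgebra.odd_induction with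
  | ι v => exact ExteriorAlgebra.ι_sq_zero v
  | add x y hx' hy' hx hy =>
    rw [add_mul, mul_add, mul_add, hx, hy, mul_comm_of_mem_one hx' hy', zero_add, add_zero,
      neg_add_cancel]
  | ι_mul_ι_mul v w x _ hx =>
    rw [(commute_ι_mul_ι v w x).symm.mul_mul_mul_comm, hx, mul_zero]

instance instSuperRing : SuperRing (exteriorGrading R M) where
  one_mem := SetLike.one_mem_graded (CliffordAlgebra.evenOdd (0 : QuadraticForm R M))
  mul_mem ha hb :=
    SetLike.mul_mem_graded (A := CliffordAlgebra.evenOdd (0 : QuadraticForm R M)) ha hb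
  isCompl := by
    have h := CliffordAlgebra.evenOdd_isCompl (0 : QuadraticForm R M)
    exact isCompl_of_exists_add (fun a h0 h1 => Submodule.disjoint_def.1 h.disjoint a h0 h1)
      fun a => Submodule.mem_sup.1 (h.sup_eq_top ▸ Submodule.mem_top)
  even_comm ha b := commute_of_mem_zero ha b
  odd_anticomm := mul_comm_of_mem_one
  odd_sq := mul_self_of_mem_one

theorem algebraMap_mem (r : R) : algebraMap R (ExteriorAlgebra R M) r ∈ exteriorGrading R M 0 :=
  SetLike.algebraMap_mem_graded (CliffordAlgebra.evenOdd (0 : QuadraticForm R M)) r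

theorem ι_mem (v : M) : ι R v ∈ exteriorGrading R M 1 :=
  CliffordAlgebra.ι_mem_evenOdd_one (0 : QuadraticForm R M) v

theorem sub_algebraMapInv_mem_span_odd (x : ExteriorAlgebra R M) :
    x - algebraMap R _ (ExteriorAlgebra.algebraMapInv x) ∈
      TwoSidedIdeal.span (exteriorGrading R M 1 : Set (ExteriorAlgebra R M)) := by
  induction x using ExteriorAlgebra.induction with
  | algebraMap r =>
    rw [ExteriorAlgebra.algebraMap_leftInverse, sub_self]
    exact zero_mem _
  | ι v =>
    rw [ExteriorAlgebra.algebraMapInv, ExteriorAlgebra.lift_ι_apply, LinearMap.zero_apply, map_zero,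
      sub_zero]
    exact TwoSidedIdeal.subset_span (ι_mem v)
  | mul a b ha hb =>
    rw [map_mul, map_mul, ← sub_add_sub_cancel _ (a * algebraMap R _ _), ← mul_sub, ← sub_mul]
    exact add_mem (TwoSidedIdeal.mul_mem_left _ _ _ hb) (TwoSidedIdeal.mul_mem_right _ _ _ ha)
  | add a b ha hb =>
    rw [map_add, map_add, add_sub_add_comm]
    exact add_mem ha hb

theorem isFermionicallyRegular (R M : Type u) [CommRing R] [AddCommGroup M] [Module R M] :
    IsFermionicallyRegular (exteriorGrading R M) :=
  ⟨R, inferInstance, M, inferInstance, inferInstance, RingEquiv.refl _, fun _ _ => Iff.rfl⟩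

section Field

variable {k : Type u} [Field k] {V : Type v} [AddCommGroup V] [Module k V]

theorem mem_span_odd_or_isUnit (x : ExteriorAlgebra k V) :
    x ∈ TwoSidedIdeal.span (exteriorGrading k V 1 : Set (ExteriorAlgebra k V)) ∨ IsUnit x := by
  have hx := sub_algebraMapInv_mem_span_odd x
  by_cases hc : ExteriorAlgebra.algebraMapInv x = 0
  · left
    rwa [hc, map_zero, sub_zero] at hx
  · right
    rw [← sub_add_cancel x (algebraMap k _ (ExteriorAlgebra.algebraMapInv x))]
    exact (SuperRing.isNilpotent_of_mem_span_odd hx).isUnit_add_right_of_commute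
      ((ExteriorAlgebra.isUnit_algebraMap _ _).2 (IsUnit.mk0 _ hc)) (Algebra.commutes _ _).symm

theorem isUnit_of_not_isNilpotent {x : ExteriorAlgebra k V} (hx : ¬IsNilpotent x) : IsUnit x :=
  (mem_span_odd_or_isUnit x).resolve_left (mt SuperRing.isNilpotent_of_mem_span_odd hx)

theorem isIntegralSuperRing : IsIntegralSuperRing (exteriorGrading k V) where
  nontrivial := inferInstance
  isNilpotent_or_mem_nonZeroDivisorsLeft x := or_iff_not_imp_left.2 fun hx =>
    (isUnit_of_not_isNilpotent hx).mem_nonZeroDivisors.1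
  exists_mul_mem_span_odd {x} hx := ⟨1, SuperRing.one_mem, one_mem _, by
    rw [one_mul]
    exact (mem_span_odd_or_isUnit x).resolve_right fun hu => hu.not_isNilpotent hx⟩

theorem nonZeroDivisorsLeft_le_isUnit :
    nonZeroDivisorsLeft (ExteriorAlgebra k V) ≤ IsUnit.submonoid (ExteriorAlgebra k V) :=
  fun _ hx => isUnit_of_not_isNilpotent (isIntegralSuperRing.mem_nonZeroDivisorsLeft_iff.1 hx)

end Field

end exteriorGrading

end ExteriorAlgebras

section ExteriorMonomials

theorem SuperRing.mul_eq_or_eq_neg_of_odd {A : Type*} [Ring A] {𝒜 : ZMod 2 → AddSubgroup A}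
    [SuperRing 𝒜] {a b : A} {i : ZMod 2} (ha : a ∈ 𝒜 1) (hb : b ∈ 𝒜 i) :
    a * b = b * a ∨ a * b = -(b * a) := by
  fin_cases i
  · exact Or.inl (SuperRing.even_comm hb a).symm
  · exact Or.inr (SuperRing.odd_anticomm ha hb)

theorem prod_map_pow_ite_mem {ι M : Type*} [DecidableEq ι] [Monoid M] (f : ι → M)
    (s : Finset ι) (l : List ι) :
    (l.map fun i => f i ^ (if i ∈ s then 1 else 0)).prod = ((l.filter (· ∈ s)).map f).prod := by
  induction l with
  | nil => rfl
  | cons i l ih =>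
    rw [List.map_cons, List.prod_cons, ih]
    by_cases hi : i ∈ s <;> simp [hi]

variable {q : ℕ}

/-- The monomial `ξ^I`, the product of the `ξ_i^(I_i)` in increasing order. -/
def extMonomial (R : Type u) [CommRing R] (I : Fin q → ℕ) : ExteriorAlgebra R (Fin q → R) :=
  ((List.finRange q).map fun i => ExteriorAlgebra.ι R (Pi.single i 1 : Fin q → R) ^ I i).prod

variable {R : Type u} [CommRing R]

open ExteriorAlgebra (ι)

theorem exteriorBasis_eq_extMonomial (s : Finset (Fin q)) :
    (Pi.basisFun R (Fin q)).ExteriorAlgebra s =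
      extMonomial R (fun i => if i ∈ s then 1 else 0) := by
  rw [ExteriorAlgebra.basis_apply, extMonomial, prod_map_pow_ite_mem]
  refine (ExteriorAlgebra.ιMulti_apply _).trans ?_
  congr 1
  set t := (Set.powersetCard.prodEquiv.symm s).2
  have hl : List.ofFn (Set.powersetCard.ofFinEmbEquiv.symm t) =
      (List.finRange q).filter (· ∈ s) := by
    refine List.SortedLT.eq_of_mem_iff ?_ ?_ fun i => ?_
    · exact List.sortedLT_ofFn_iff.2 (OrderEmbedding.strictMono _)
    · exact ((List.sortedLT_finRange q).pairwise.filter _).sortedLT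
    · rw [List.mem_ofFn, ← Set.mem_range, Set.powersetCard.mem_range_ofFinEmbEquiv_symm_iff_mem]
      simp only [List.mem_filter, List.mem_finRange, true_and, decide_eq_true_eq]
      rfl
  rw [← hl, List.map_ofFn]
  simp only [Function.comp_def, Pi.basisFun_apply]
  rfl

theorem extMonomial_eq_exteriorBasis {I : Fin q → ℕ} (hI : ∀ i, I i ≤ 1) :
    extMonomial R I = (Pi.basisFun R (Fin q)).ExteriorAlgebra
      (Finset.univ.filter fun i => I i = 1) := by
  rw [exteriorBasis_eq_extMonomial]
  congr 1
  ext i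
  have := hI i
  simp only [Finset.mem_filter, Finset.mem_univ, true_and]
  split_ifs <;> omega

theorem extMonomial_zero : extMonomial R (0 : Fin q → ℕ) = 1 := by
  simp [extMonomial]

theorem exists_prod_ι_pow_mem_exteriorGrading (I : Fin q → ℕ) (l : List (Fin q)) : ∃ i,
    (l.map fun i => ι R (Pi.single i 1 : Fin q → R) ^ I i).prod ∈ exteriorGrading R _ i :=
  ⟨_, SetLike.list_prod_map_mem_graded (A := CliffordAlgebra.evenOdd (0 : QuadraticForm R _)) l _ _
    fun i _ => SetLike.pow_mem_graded (I i) (exteriorGrading.ι_mem (Pi.single i 1))⟩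

theorem ι_mul_extMonomial {j : Fin q} {I : Fin q → ℕ} (hj : I j = 0) :
    ι R (Pi.single j 1 : Fin q → R) * extMonomial R I = extMonomial R (I + Pi.single j 1) ∨
    ι R (Pi.single j 1 : Fin q → R) * extMonomial R I = -extMonomial R (I + Pi.single j 1) := by
  obtain ⟨l₁, l₂, hl⟩ := List.append_of_mem (List.mem_finRange j)
  have hnodup : (l₁ ++ j :: l₂).Nodup := hl ▸ List.nodup_finRange q
  obtain ⟨hj₁, hj₂⟩ : j ∉ l₁ ∧ j ∉ l₂ := by
    simpa using (List.nodup_cons.1 (List.nodup_middle.1 hnodup)).1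
  have hcongr {l : List (Fin q)} (h : j ∉ l) :
      (l.map fun i => ι R (Pi.single i 1 : Fin q → R) ^ (I i + (Pi.single j 1 : Fin q → ℕ) i)) =
        l.map fun i => ι R (Pi.single i 1 : Fin q → R) ^ I i := by
    refine List.map_congr_left fun i hi => ?_
    have hij : i ≠ j := fun e => h (e ▸ hi)
    simp [hij]
  obtain ⟨i, hi⟩ := exists_prod_ι_pow_mem_exteriorGrading (R := R) I l₁
  simp only [extMonomial, hl, List.map_append, List.map_cons, List.prod_append, List.prod_cons,
    hcongr hj₁, hcongr hj₂, hj, Pi.add_apply, Pi.single_eq_same, zero_add, pow_zero, pow_one,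
    one_mul]
  refine (SuperRing.mul_eq_or_eq_neg_of_odd
    (exteriorGrading.ι_mem (Pi.single j 1)) hi).imp (fun h => ?_) fun h => ?_
  · rw [← mul_assoc, h, mul_assoc]
  · rw [← mul_assoc, h, neg_mul, mul_assoc]

theorem contractLeft_ι_pow_mul_eq_zero {M : Type v} [AddCommGroup M] [Module R M]
    {d : Module.Dual R M} {v : M} (hv : d v = 0) {x : ExteriorAlgebra R M}
    (hx : CliffordAlgebra.contractLeft (Q := (0 : QuadraticForm R M)) d x = 0) (n : ℕ) :
    CliffordAlgebra.contractLeft (Q := (0 : QuadraticForm R M)) d (ι R v ^ n * x) = 0 := by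
  induction n with
  | zero => rwa [pow_zero, one_mul]
  | succ n ih =>
    rw [pow_succ', mul_assoc]
    refine (CliffordAlgebra.contractLeft_ι_mul _ _ _).trans ?_
    rw [ih, hv, zero_smul, mul_zero, sub_zero]

theorem contractLeft_extMonomial {j : Fin q} {I : Fin q → ℕ} (hj : I j = 0) :
    CliffordAlgebra.contractLeft (Q := (0 : QuadraticForm R (Fin q → R))) (LinearMap.proj j)
      (extMonomial R I) = 0 := by
  unfold extMonomial
  induction List.finRange q with
  | nil => exact CliffordAlgebra.contractLeft_one (Q := (0 : QuadraticForm R (Fin q → R))) _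
  | cons i l ih =>
    rw [List.map_cons, List.prod_cons]
    rcases eq_or_ne i j with rfl | hij
    · rwa [hj, pow_zero, one_mul]
    · exact contractLeft_ι_pow_mul_eq_zero (Pi.single_eq_of_ne hij.symm 1) ih (I i)

end ExteriorMonomials

section BaseChange

variable {q : ℕ} (R : Type u) (S : Type v) [CommRing R] [CommRing S] [Algebra R S]

/-- The homomorphism `Λ_R(R^q) → Λ_S(S^q)` of exterior algebras. -/
def exteriorBaseChange :
    ExteriorAlgebra R (Fin q → R) →ₐ[R] ExteriorAlgebra S (Fin q → S) :=
  ExteriorAlgebra.lift R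
    ⟨(ExteriorAlgebra.ι S (M := Fin q → S)).restrictScalars R ∘ₗ
      (Algebra.linearMap R S).compLeft (Fin q), fun _ => ExteriorAlgebra.ι_sq_zero _⟩

theorem exteriorBaseChange_ι (v : Fin q → R) :
    exteriorBaseChange R S (ExteriorAlgebra.ι R v) =
      ExteriorAlgebra.ι S (fun i => algebraMap R S (v i)) :=
  ExteriorAlgebra.lift_ι_apply _ _ _ _

theorem exteriorBaseChange_extMonomial (I : Fin q → ℕ) :
    exteriorBaseChange R S (extMonomial R I) = extMonomial S I := by
  rw [extMonomial, map_list_prod, List.map_map, extMonomial]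
  congr 2
  ext i
  rw [Function.comp_apply, map_pow, exteriorBaseChange_ι]
  congr 2
  ext j
  rcases eq_or_ne j i with rfl | h
  · simp
  · simp [h]

theorem exteriorBaseChange_exteriorBasis (s : Finset (Fin q)) :
    exteriorBaseChange R S ((Pi.basisFun R (Fin q)).ExteriorAlgebra s) =
      (Pi.basisFun S (Fin q)).ExteriorAlgebra s := by
  rw [exteriorBasis_eq_extMonomial, exteriorBaseChange_extMonomial, exteriorBasis_eq_extMonomial]

theorem exteriorBasis_repr_exteriorBaseChange (a : ExteriorAlgebra R (Fin q → R))
    (s : Finset (Fin q)) :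
    (Pi.basisFun S (Fin q)).ExteriorAlgebra.repr (exteriorBaseChange R S a) s =
      algebraMap R S ((Pi.basisFun R (Fin q)).ExteriorAlgebra.repr a s) := by
  have h : ((Pi.basisFun S (Fin q)).ExteriorAlgebra.coord s).restrictScalars R ∘ₗ
      (exteriorBaseChange R S).toLinearMap =
      Algebra.linearMap R S ∘ₗ (Pi.basisFun R (Fin q)).ExteriorAlgebra.coord s := by
    refine (Pi.basisFun R (Fin q)).ExteriorAlgebra.ext fun t => ?_
    simp only [LinearMap.comp_apply, LinearMap.restrictScalars_apply, AlgHom.toLinearMap_apply,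
      Module.Basis.coord_apply, Module.Basis.repr_self, Algebra.linearMap_apply,
      exteriorBaseChange_exteriorBasis, Finsupp.single_apply]
    split_ifs <;> simp
  exact LinearMap.congr_fun h a

variable {R S}

theorem exteriorBaseChange_mem {i : ZMod 2} {a : ExteriorAlgebra R (Fin q → R)}
    (ha : a ∈ exteriorGrading R (Fin q → R) i) :
    exteriorBaseChange R S a ∈ exteriorGrading S (Fin q → S) i := by
  have hmul (v w : Fin q → R) {j : ZMod 2} {x : ExteriorAlgebra R (Fin q → R)}
      (hx : exteriorBaseChange R S x ∈ exteriorGrading S (Fin q → S) j) :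
      exteriorBaseChange R S (ExteriorAlgebra.ι R v * ExteriorAlgebra.ι R w * x) ∈
        exteriorGrading S (Fin q → S) j := by
    rw [map_mul, map_mul, exteriorBaseChange_ι, exteriorBaseChange_ι]
    exact SuperRing.even_mul_mem
      (SuperRing.odd_mul_odd_mem (exteriorGrading.ι_mem _) (exteriorGrading.ι_mem _)) hx
  fin_cases i
  · induction a, ha using CliffordAlgebra.even_induction with
    | algebraMap r => exact AlgHom.commutes (exteriorBaseChange R S) r ▸
        IsScalarTower.algebraMap_apply R S (ExteriorAlgebra S (Fin q → S)) r ▸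
          exteriorGrading.algebraMap_mem _
    | add x y _ _ hx hy => exact map_add (exteriorBaseChange R S) x y ▸ add_mem hx hy
    | ι_mul_ι_mul v w x _ hx => exact hmul v w hx
  · induction a, ha using CliffordAlgebra.odd_induction with
    | ι v => exact exteriorBaseChange_ι R S v ▸ exteriorGrading.ι_mem _
    | add x y _ _ hx hy => exact map_add (exteriorBaseChange R S) x y ▸ add_mem hx hy
    | ι_mul_ι_mul v w x _ hx => exact hmul v w hx

end BaseChange

section TorusFractions

variable (p q : ℕ)

instance torusGrading.instSuperRing : SuperRing (torusGrading p q) :=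
  have : SuperRing (restrictGrading (⊤ : Subalgebra ℂ (TorusRing p q))) :=
    superRing_restrictGrading _ fun _ _ => trivial
  .of_ringEquiv (ℬ := restrictGrading (⊤ : Subalgebra ℂ (TorusRing p q)))
    (Subalgebra.topEquiv (R := ℂ) (A := TorusRing p q)).symm.toRingEquiv
    fun _ _ => Iff.rfl

/-- The inclusion of the Laurent polynomials into `ℂ[T]`. -/
def laurentHom : AddMonoidAlgebra ℂ (Fin p → ℤ) →ₐ[ℂ] TorusRing p q :=
  AddMonoidAlgebra.mapAlgHom _ (Algebra.ofId ℂ (ExteriorAlgebra ℂ (Fin q → ℂ)))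

variable {p q}

theorem laurentHom_single (χ : Fin p → ℤ) (z : ℂ) :
    laurentHom p q (AddMonoidAlgebra.single χ z) = AddMonoidAlgebra.single χ (algebraMap ℂ _ z) :=
  AddMonoidAlgebra.mapAlgHom_single _ _ _

theorem laurentHom_mem (r : AddMonoidAlgebra ℂ (Fin p → ℤ)) :
    laurentHom p q r ∈ torusGrading p q 0 := by
  intro χ
  rw [laurentHom, AddMonoidAlgebra.coeff_mapAlgHom]
  exact exteriorGrading.algebraMap_mem _

/-- The field of rational functions on the torus. -/
abbrev LaurentFractions (p : ℕ) : Type := FractionRing (AddMonoidAlgebra ℂ (Fin p → ℤ))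

theorem algebraMap_laurentFractions_single (χ : Fin p → ℤ) (z : ℂ) :
    algebraMap (AddMonoidAlgebra ℂ (Fin p → ℤ)) (LaurentFractions p)
      (AddMonoidAlgebra.single χ z) = algebraMap ℂ (LaurentFractions p) z *
        algebraMap (AddMonoidAlgebra ℂ (Fin p → ℤ)) (LaurentFractions p)
          (AddMonoidAlgebra.single χ 1) := by
  rw [IsScalarTower.algebraMap_apply ℂ (AddMonoidAlgebra ℂ (Fin p → ℤ)), ← map_mul,
    ← Algebra.smul_def, AddMonoidAlgebra.smul_single, smul_eq_mul, mul_one]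

/-- The embedding of `ℂ[T]` into an exterior algebra over the field of rational functions, as a
homomorphism of rings. -/
def torusFractionRingHom (p q : ℕ) :
    TorusRing p q →+* ExteriorAlgebra (LaurentFractions p) (Fin q → LaurentFractions p) :=
  AddMonoidAlgebra.liftNCRingHom (exteriorBaseChange ℂ (LaurentFractions p)).toRingHom
    (((algebraMap (LaurentFractions p) _).comp
      (algebraMap (AddMonoidAlgebra ℂ (Fin p → ℤ)) (LaurentFractions p))).toMonoidHom.comp
      (AddMonoidAlgebra.of ℂ (Fin p → ℤ)))
    fun _ _ => (Algebra.commutes _ _).symm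

theorem torusFractionRingHom_single (χ : Fin p → ℤ) (a : ExteriorAlgebra ℂ (Fin q → ℂ)) :
    torusFractionRingHom p q (AddMonoidAlgebra.single χ a) =
      algebraMap (AddMonoidAlgebra ℂ (Fin p → ℤ)) (LaurentFractions p)
        (AddMonoidAlgebra.single χ 1) • exteriorBaseChange ℂ (LaurentFractions p) a :=
  (AddMonoidAlgebra.liftNCRingHom_single _ _ _ _ _).trans <| by
    rw [Algebra.smul_def (R := LaurentFractions p)]
    exact (Algebra.commutes (R := LaurentFractions p) _ _).symm

theorem torusFractionRingHom_laurentHom (r : AddMonoidAlgebra ℂ (Fin p → ℤ)) :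
    torusFractionRingHom p q (laurentHom p q r) =
      algebraMap (LaurentFractions p) _ (algebraMap _ (LaurentFractions p) r) := by
  induction r using AddMonoidAlgebra.induction_linear with
  | zero => simp only [map_zero]
  | add x y hx hy => simp only [map_add, hx, hy]
  | single χ z =>
    rw [laurentHom_single, torusFractionRingHom_single, AlgHom.commutes,
      IsScalarTower.algebraMap_apply ℂ (LaurentFractions p) (ExteriorAlgebra _ _),
      Algebra.smul_def, ← map_mul, mul_comm, ← algebraMap_laurentFractions_single]

theorem exteriorBasis_repr_torusFractionRingHom (f : TorusRing p q) (s : Finset (Fin q)) :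
    (Pi.basisFun (LaurentFractions p) (Fin q)).ExteriorAlgebra.repr
        (torusFractionRingHom p q f) s =
      algebraMap (AddMonoidAlgebra ℂ (Fin p → ℤ)) (LaurentFractions p) (.ofCoeff
        (f.coeff.mapRange ((Pi.basisFun ℂ (Fin q)).ExteriorAlgebra.coord s) (map_zero _))) := by
  induction f using AddMonoidAlgebra.induction_linear with
  | zero => simp
  | add x y hx hy =>
    rw [map_add, map_add, Finsupp.add_apply, hx, hy, ← map_add]
    congr 1
    ext χ
    exact (map_add ((Pi.basisFun ℂ (Fin q)).ExteriorAlgebra.coord s) _ _).symm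
  | single χ a =>
    rw [AddMonoidAlgebra.coeff_single, Finsupp.mapRange_single, torusFractionRingHom_single,
      map_smul, Finsupp.smul_apply, exteriorBasis_repr_exteriorBaseChange, smul_eq_mul, mul_comm,
      ← algebraMap_laurentFractions_single]
    rfl

theorem torusFractionRingHom_injective : Function.Injective (torusFractionRingHom p q) := by
  refine (injective_iff_map_eq_zero _).2 fun f hf => ?_
  ext χ : 2
  refine (Pi.basisFun ℂ (Fin q)).ExteriorAlgebra.ext_elem fun s => ?_
  have h := exteriorBasis_repr_torusFractionRingHom f s
  rw [hf, map_zero, Finsupp.zero_apply, eq_comm, map_eq_zero_iff _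
    (IsFractionRing.injective (AddMonoidAlgebra ℂ (Fin p → ℤ)) (LaurentFractions p))] at h
  rw [AddMonoidAlgebra.coeff_zero, Finsupp.zero_apply, map_zero, Finsupp.zero_apply]
  exact congrArg (fun r : AddMonoidAlgebra ℂ (Fin p → ℤ) => r.coeff χ) h

theorem isUnit_torusFractionRingHom_laurentHom {r : AddMonoidAlgebra ℂ (Fin p → ℤ)} (hr : r ≠ 0) :
    IsUnit (torusFractionRingHom p q (laurentHom p q r)) := by
  rw [torusFractionRingHom_laurentHom, ExteriorAlgebra.isUnit_algebraMap, isUnit_iff_ne_zero]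
  exact (map_ne_zero_iff _ (IsFractionRing.injective _ (LaurentFractions p))).2 hr

theorem exists_laurentHom_mul_eq
    (x : ExteriorAlgebra (LaurentFractions p) (Fin q → LaurentFractions p)) :
    ∃ r : AddMonoidAlgebra ℂ (Fin p → ℤ), r ≠ 0 ∧ ∃ f,
      torusFractionRingHom p q (laurentHom p q r) * x = torusFractionRingHom p q f := by
  let b := (Pi.basisFun (LaurentFractions p) (Fin q)).ExteriorAlgebra
  obtain ⟨r, hr⟩ := IsLocalization.exist_integer_multiples_of_finite
    (nonZeroDivisors (AddMonoidAlgebra ℂ (Fin p → ℤ))) (b.repr x)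
  choose a ha using hr
  refine ⟨r, nonZeroDivisors.ne_zero r.2, ∑ s, laurentHom p q (a s) *
    AddMonoidAlgebra.single 0 ((Pi.basisFun ℂ (Fin q)).ExteriorAlgebra s), ?_⟩
  rw [map_sum, torusFractionRingHom_laurentHom, ← Algebra.smul_def, ← b.sum_repr x,
    Finset.smul_sum]
  refine Finset.sum_congr rfl fun s _ => ?_
  rw [map_mul, torusFractionRingHom_laurentHom, ha, torusFractionRingHom_single,
    ← AddMonoidAlgebra.one_def, map_one, one_smul, exteriorBaseChange_exteriorBasis,
    ← Algebra.smul_def, smul_smul]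
  exact congrArg (· • b s) (Algebra.smul_def (r : AddMonoidAlgebra ℂ (Fin p → ℤ)) _).symm

/-- The embedding of `ℂ[T]` into an exterior algebra over the field of rational functions. -/
def torusFractionHom (p q : ℕ) : SuperHom (torusGrading p q)
    (exteriorGrading (LaurentFractions p) (Fin q → LaurentFractions p)) where
  toRingHom := torusFractionRingHom p q
  map_mem i f hf := by
    rw [torus_sum_single f, map_sum]
    refine sum_mem fun χ _ => ?_
    rw [torusFractionRingHom_single]
    exact Submodule.smul_mem (CliffordAlgebra.evenOdd (0 : QuadraticForm _ _) i) _
      (exteriorBaseChange_mem (hf χ))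

theorem torusFractionHom_isFractionMap : (torusFractionHom p q).IsFractionMap where
  injective := torusFractionRingHom_injective
  exists_mul_eq x := by
    obtain ⟨r, hr, f, hf⟩ := exists_laurentHom_mul_eq x
    exact ⟨laurentHom p q r, laurentHom_mem r, isUnit_torusFractionRingHom_laurentHom hr, f, hf⟩

end TorusFractions

section TorusGenerators

variable {p q : ℕ}

theorem single_one_mem (χ : Fin p → ℤ) :
    (AddMonoidAlgebra.single χ 1 : TorusRing p q) ∈ torusGrading p q 0 := by
  rw [← map_one (algebraMap ℂ _), ← laurentHom_single]
  exact laurentHom_mem _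

theorem algebraMap_mem_torusGrading (z : ℂ) :
    algebraMap ℂ (TorusRing p q) z ∈ torusGrading p q 0 :=
  (laurentHom p q).commutes z ▸ laurentHom_mem _

theorem isUnit_single_one (χ : Fin p → ℤ) :
    IsUnit (AddMonoidAlgebra.single χ 1 : TorusRing p q) :=
  (Group.isUnit (Multiplicative.ofAdd χ)).map (AddMonoidAlgebra.of _ _)

theorem oddCoord_mem (i : Fin q) : (oddCoord i : TorusRing p q) ∈ torusGrading p q 1 := by
  rw [mem_torusGrading_one, oddCoord, parityInvolution_single, ← AddMonoidAlgebra.single_neg]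
  exact congrArg _ (CliffordAlgebra.involute_ι _)

theorem single_zero_mem_of_oddCoord_mem {S : Subalgebra ℂ (TorusRing p q)}
    (hodd : ∀ i, oddCoord i ∈ S) (a : ExteriorAlgebra ℂ (Fin q → ℂ)) :
    AddMonoidAlgebra.single 0 a ∈ S := by
  let φ : ExteriorAlgebra ℂ (Fin q → ℂ) →ₐ[ℂ] TorusRing p q := AddMonoidAlgebra.singleZeroAlgHom
  suffices h : a ∈ S.comap φ from h
  induction a using ExteriorAlgebra.induction with
  | algebraMap z => exact algebraMap_mem _ z
  | ι v =>
    rw [← (Pi.basisFun ℂ (Fin q)).sum_repr v, map_sum]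
    refine sum_mem fun i _ => ?_
    rw [map_smul, Pi.basisFun_apply]
    exact (S.comap φ).smul_mem (hodd i) _
  | mul a b ha hb => exact mul_mem ha hb
  | add a b ha hb => exact add_mem ha hb

theorem torusRing_subalgebra_eq_top {S : Subalgebra ℂ (TorusRing p q)}
    (heven : (laurentHom p q).range ≤ S) (hodd : ∀ i, oddCoord i ∈ S) : S = ⊤ := by
  refine eq_top_iff.2 fun f _ => ?_
  rw [torus_sum_single f]
  refine sum_mem fun χ _ => ?_
  have hχ : AddMonoidAlgebra.single χ 1 ∈ S := heven ⟨AddMonoidAlgebra.single χ 1, by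
    exact (laurentHom_single χ 1).trans (by rw [map_one])⟩
  have := mul_mem hχ (single_zero_mem_of_oddCoord_mem hodd (f.coeff χ))
  rwa [AddMonoidAlgebra.single_mul_single, add_zero, one_mul] at this

end TorusGenerators

section SuperMonomials

variable {q n : ℕ}

theorem superMonomial_eq_single (k : (Fin q → ℕ) × (Fin n → ℕ)) :
    superMonomial k = AddMonoidAlgebra.single (charXV k.2) (extMonomial ℂ k.1) := rfl

theorem superMonomial_zero_fst (m : Fin n → ℕ) :
    superMonomial ((0, m) : (Fin q → ℕ) × (Fin n → ℕ)) =
      AddMonoidAlgebra.single (charXV m) 1 := by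
  rw [superMonomial_eq_single, extMonomial_zero]

theorem oddCoord_mul_superMonomial {k : (Fin q → ℕ) × (Fin n → ℕ)} {j : Fin q} (hj : k.1 j = 0) :
    oddCoord j * superMonomial k = superMonomial (k.1 + Pi.single j 1, k.2) ∨
      oddCoord j * superMonomial k = -superMonomial (k.1 + Pi.single j 1, k.2) := by
  simp only [superMonomial_eq_single, oddCoord, AddMonoidAlgebra.single_mul_single, zero_add,
    ← AddMonoidAlgebra.single_neg]
  exact (ι_mul_extMonomial hj).imp (congrArg _) (congrArg _)

end SuperMonomials

section Inverting

variable {R A : Type*} [CommRing R] [Ring A] [Algebra R A]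

/-- The elements of `A` that a power of the central element `s` of `B` multiplies into `B`, that
is, the part of `A` that lies in `B[s⁻¹]` when `s` is a unit of `A`. -/
def awaySubalgebra (B : Subalgebra R A) {s : A} (hs : s ∈ B) (hcomm : ∀ a, Commute s a) :
    Subalgebra R A where
  carrier := {a | ∃ N : ℕ, s ^ N * a ∈ B}
  mul_mem' := by
    rintro a b ⟨N, hN⟩ ⟨M, hM⟩
    refine ⟨N + M, ?_⟩
    rw [pow_add, ((hcomm a).pow_left M).mul_mul_mul_comm]
    exact mul_mem hN hM
  add_mem' := by
    rintro a b ⟨N, hN⟩ ⟨M, hM⟩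
    refine ⟨N + M, ?_⟩
    rw [mul_add]
    nth_rw 1 [add_comm N M]
    rw [pow_add, pow_add, mul_assoc, mul_assoc]
    exact add_mem (mul_mem (pow_mem hs M) hN) (mul_mem (pow_mem hs N) hM)
  algebraMap_mem' r := ⟨0, by
    rw [pow_zero, one_mul]
    exact B.algebraMap_mem r⟩

variable {B : Subalgebra R A} {s : A} (hs : s ∈ B) (hcomm : ∀ a, Commute s a)

theorem mem_awaySubalgebra_of_mul_mem {a : A} (ha : s * a ∈ B) : a ∈ awaySubalgebra B hs hcomm :=
  ⟨1, by rwa [pow_one]⟩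

theorem le_awaySubalgebra : B ≤ awaySubalgebra B hs hcomm := fun _ ha =>
  mem_awaySubalgebra_of_mul_mem hs hcomm (mul_mem hs ha)

end Inverting

section EvenProduct

variable {q n : ℕ} (K : Finset ((Fin q → ℕ) × (Fin n → ℕ)))

/-- The sum of the characters of the even generators of a monomial superalgebra. -/
def evenCharSum : Fin (n + 1) → ℤ := ∑ k ∈ K with k.1 = 0, charXV k.2

/-- The product of the even generators of a monomial superalgebra, by inverting which one passes
to `ℂ[T]`. -/
def evenProduct : TorusRing (n + 1) q := AddMonoidAlgebra.single (evenCharSum K) 1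

theorem evenProduct_even : evenProduct K ∈ torusGrading (n + 1) q 0 := single_one_mem _

theorem isUnit_evenProduct : IsUnit (evenProduct K) := isUnit_single_one _

variable {K}

theorem superMonomial_mem {k : (Fin q → ℕ) × (Fin n → ℕ)} (hk : k ∈ K) :
    superMonomial k ∈ monomialAlgebra K :=
  Algebra.subset_adjoin ⟨k, hk, rfl⟩

theorem single_sum_mem {F : Finset ((Fin q → ℕ) × (Fin n → ℕ))} (hF : ∀ k ∈ F, k ∈ K ∧ k.1 = 0) :
    (AddMonoidAlgebra.single (∑ k ∈ F, charXV k.2) 1 : TorusRing (n + 1) q) ∈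
      monomialAlgebra K := by
  induction F using Finset.induction_on with
  | empty => exact one_mem _
  | insert k F hk ih =>
    obtain ⟨hkK, hk0⟩ := hF k (Finset.mem_insert_self _ _)
    have h := mul_mem (superMonomial_mem hkK) (ih fun k hk => hF k (Finset.mem_insert_of_mem hk))
    rw [superMonomial_eq_single, hk0, extMonomial_zero, AddMonoidAlgebra.single_mul_single,
      one_mul] at h
    rwa [Finset.sum_insert hk]

variable (K) in
theorem evenProduct_mem : evenProduct K ∈ monomialAlgebra K :=
  single_sum_mem fun _ hk => Finset.mem_filter.1 hk

theorem evenProduct_mul_single_neg_mem {m : Fin n → ℕ} (hm : ((0, m) : _ × _) ∈ K) :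
    evenProduct K * AddMonoidAlgebra.single (-charXV m) 1 ∈ monomialAlgebra K := by
  have hm' : ((0, m) : (Fin q → ℕ) × (Fin n → ℕ)) ∈ K.filter fun k => k.1 = 0 :=
    Finset.mem_filter.2 ⟨hm, rfl⟩
  have h := single_sum_mem (K := K) (F := (K.filter fun k => k.1 = 0).erase (0, m)) fun k hk =>
    Finset.mem_filter.1 (Finset.mem_of_mem_erase hk)
  rw [Finset.sum_erase_eq_sub hm'] at h
  rwa [evenProduct, AddMonoidAlgebra.single_mul_single, ← sub_eq_add_neg, one_mul]

variable (K) in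
/-- The superalgebra obtained by inverting the product of the even generators. -/
abbrev monomialLocalization : Subalgebra ℂ (TorusRing (n + 1) q) :=
  awaySubalgebra (monomialAlgebra K) (evenProduct_mem K)
    (SuperRing.commute_of_even (evenProduct_even K))

theorem single_neg_mem_monomialLocalization {m : Fin n → ℕ} (hm : ((0, m) : _ × _) ∈ K) :
    AddMonoidAlgebra.single (-charXV m) 1 ∈ monomialLocalization K :=
  mem_awaySubalgebra_of_mul_mem _ _ (evenProduct_mul_single_neg_mem hm)

theorem laurentHom_range_le_monomialLocalization (hK_even : Algebra.adjoin ℂ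
      {f : AddMonoidAlgebra ℂ (Fin (n + 1) → ℤ) | ∃ m : Fin n → ℕ, ((0, m) : _ × _) ∈ K ∧
        (f = AddMonoidAlgebra.single (charXV m) 1 ∨ f = AddMonoidAlgebra.single (-charXV m) 1)} =
      ⊤) :
    (laurentHom (n + 1) q).range ≤ monomialLocalization K := by
  rw [← Algebra.map_top, ← hK_even, AlgHom.map_adjoin, Algebra.adjoin_le_iff]
  rintro _ ⟨_, ⟨m, hm, rfl | rfl⟩, rfl⟩ <;> rw [laurentHom_single, map_one]
  · rw [← superMonomial_zero_fst]
    exact le_awaySubalgebra _ _ (superMonomial_mem hm)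
  · exact single_neg_mem_monomialLocalization hm

variable (hK_closed : ∀ k ∈ K, ∀ i, k.1 i = 1 → (k.1 - Pi.single i 1, k.2) ∈ K)

include hK_closed in
theorem oddCoord_mem_monomialLocalization {i : Fin q} {m : Fin n → ℕ}
    (hm : (Pi.single i 1, m) ∈ K) : oddCoord i ∈ monomialLocalization K := by
  have hm₀ : ((0, m) : _ × _) ∈ K := by
    simpa using hK_closed _ hm i (Pi.single_eq_same i 1)
  have h := oddCoord_mul_superMonomial (k := ((0, m) : (Fin q → ℕ) × (Fin n → ℕ))) (j := i) rfl
  rw [superMonomial_zero_fst, zero_add] at h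
  have hmem : oddCoord i * AddMonoidAlgebra.single (charXV m) 1 ∈ monomialLocalization K := by
    refine le_awaySubalgebra _ _ ?_
    rcases h with h | h <;> rw [h]
    · exact superMonomial_mem hm
    · exact neg_mem (superMonomial_mem hm)
  have := mul_mem hmem (single_neg_mem_monomialLocalization hm₀)
  rwa [mul_assoc, AddMonoidAlgebra.single_mul_single, add_neg_cancel, mul_one,
    ← AddMonoidAlgebra.one_def, mul_one] at this

theorem eq_single_one_or_eq_single_one_of_add {ι : Type*} [DecidableEq ι] {x y : ι → ℕ} {i : ι}
    (h : x + y = Pi.single i 1) : x = Pi.single i 1 ∨ y = Pi.single i 1 := by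
  have hi : x i + y i = 1 := by rw [← Pi.add_apply, h, Pi.single_eq_same]
  have hne {j : ι} (hj : j ≠ i) : x j = 0 ∧ y j = 0 := by
    rw [← Nat.add_eq_zero_iff, ← Pi.add_apply, h, Pi.single_eq_of_ne hj]
  refine (Nat.add_eq_one_iff.1 hi).symm.imp (fun hi => ?_) fun hi => ?_ <;> ext j <;>
    rcases eq_or_ne j i with rfl | hj
  · rw [hi.1, Pi.single_eq_same]
  · rw [(hne hj).1, Pi.single_eq_of_ne hj]
  · rw [hi.2, Pi.single_eq_same]
  · rw [(hne hj).2, Pi.single_eq_of_ne hj]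

theorem exists_single_mem_of_mem_boundedSums {i : Fin q} {m : Fin n → ℕ}
    (h : (Pi.single i 1, m) ∈ boundedSums K) : ∃ m' : Fin n → ℕ, (Pi.single i 1, m') ∈ K := by
  suffices key : ∀ k ∈ AddSubmonoid.closure (K : Set ((Fin q → ℕ) × (Fin n → ℕ))),
      k.1 = Pi.single i 1 → ∃ m' : Fin n → ℕ, ((Pi.single i 1, m') : _ × _) ∈ K from
    key _ h.1 rfl
  intro k hk
  induction hk using AddSubmonoid.closure_induction with
  | mem k hk => exact fun h => ⟨k.2, h ▸ hk⟩
  | zero => exact fun h => (Pi.single_ne_zero_iff.2 one_ne_zero h.symm).elim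
  | add x y _ _ hx hy => exact fun h => (eq_single_one_or_eq_single_one_of_add h).elim hx hy

end EvenProduct

section MonomialSupervarieties

variable {q n : ℕ} {K : Finset ((Fin q → ℕ) × (Fin n → ℕ))}

/-- The homomorphism of superrings given by the inclusion of a subalgebra of `ℂ[T]`, that is, the
map from the supertorus `T` to the spectrum of the subalgebra. -/
def subalgebraHom {p : ℕ} (B : Subalgebra ℂ (TorusRing p q)) :
    SuperHom (restrictGrading B) (torusGrading p q) where
  toRingHom := B.val.toRingHom
  map_mem _ _ ha := ha

section

variable (hK_even : Algebra.adjoin ℂ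
    {f : AddMonoidAlgebra ℂ (Fin (n + 1) → ℤ) | ∃ m : Fin n → ℕ, ((0, m) : _ × _) ∈ K ∧
      (f = AddMonoidAlgebra.single (charXV m) 1 ∨ f = AddMonoidAlgebra.single (-charXV m) 1)} = ⊤)
  (hK_closed : ∀ k ∈ K, ∀ i, k.1 i = 1 → (k.1 - Pi.single i 1, k.2) ∈ K)
  (hK_odd : ∀ i : Fin q, ∃ m : Fin n → ℕ, (Pi.single i 1, m) ∈ boundedSums K)

include hK_even hK_closed hK_odd

theorem monomialLocalization_eq_top : monomialLocalization K = ⊤ := by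
  refine torusRing_subalgebra_eq_top (laurentHom_range_le_monomialLocalization hK_even) fun i => ?_
  obtain ⟨_, hm⟩ := hK_odd i
  obtain ⟨_, hm'⟩ := exists_single_mem_of_mem_boundedSums hm
  exact oddCoord_mem_monomialLocalization hK_closed hm'

theorem exists_evenProduct_pow_mul_mem (f : TorusRing (n + 1) q) :
    ∃ N : ℕ, evenProduct K ^ N * f ∈ monomialAlgebra K :=
  (monomialLocalization_eq_top hK_even hK_closed hK_odd ▸ Algebra.mem_top :
    f ∈ monomialLocalization K)

theorem subalgebraHom_monomialAlgebra_isFractionMap :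
    (subalgebraHom (monomialAlgebra K)).IsFractionMap where
  injective := Subtype.val_injective
  exists_mul_eq f := by
    obtain ⟨N, hN⟩ := exists_evenProduct_pow_mul_mem hK_even hK_closed hK_odd f
    exact ⟨⟨_, pow_mem (evenProduct_mem K) N⟩, SuperRing.pow_mem_even (evenProduct_even K) N,
      (isUnit_evenProduct K).pow N, ⟨_, hN⟩, rfl⟩

theorem monomialAlgebra_isFractionMap :
    ((torusFractionHom (n + 1) q).comp (subalgebraHom (monomialAlgebra K))).IsFractionMap :=
  torusFractionHom_isFractionMap.comp
    (subalgebraHom_monomialAlgebra_isFractionMap hK_even hK_closed hK_odd)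

theorem monomialAlgebra_isIntegralSuperRing :
    IsIntegralSuperRing (restrictGrading (monomialAlgebra K)) :=
  .of_isFractionMap (monomialAlgebra_isFractionMap hK_even hK_closed hK_odd)
    exteriorGrading.isIntegralSuperRing

theorem monomialAlgebra_isAffineSupervariety :
    IsAffineSupervariety (restrictGrading (monomialAlgebra K)) where
  algebraMap_mem z := algebraMap_mem_torusGrading z
  finiteType := (Subalgebra.fg_iff_finiteType _).1 <|
    Subalgebra.fg_def.2 ⟨_, K.finite_toSet.image superMonomial, rfl⟩
  separated a := ⟨a ⊗ₜ 1, by rw [LinearMap.mul'_apply, mul_one]⟩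
  gfr := exteriorGrading.isIntegralSuperRing.isGFRSuperSpec
    exteriorGrading.nonZeroDivisorsLeft_le_isUnit (exteriorGrading.isFermionicallyRegular _ _)
    (monomialAlgebra_isFractionMap hK_even hK_closed hK_odd)
  reduced := (monomialAlgebra_isIntegralSuperRing hK_even hK_closed hK_odd).isReducedSuperSpec

end

theorem Supertorus.homogeneousRing_bot {p : ℕ} (T : Supertorus p q) :
    T.homogeneousRing ⊥ = ⊤ := by
  refine eq_top_iff.2 fun f _ v hv => ?_
  simp [(Submodule.mem_bot ℂ).1 hv, Supertorus.rightOddVec]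

theorem Supertorus.isOddSubgroup_bot {p : ℕ} (T : Supertorus p q) : T.IsOddSubgroup ⊥ := by
  intro v hv w _ k
  simp [(Submodule.mem_bot ℂ).1 hv]

/-- The map from the quotient of `T` by the trivial subgroup to the spectrum of a subalgebra
of `ℂ[T]`. -/
def homogeneousRingBotHom {p : ℕ} (T : Supertorus p q) (B : Subalgebra ℂ (TorusRing p q)) :
    SuperHom (restrictGrading B) (restrictGrading (T.homogeneousRing ⊥)) where
  toRingHom := (Subalgebra.inclusion (T.homogeneousRing_bot ▸ le_top)).toRingHom
  map_mem _ _ ha := ha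

theorem homogeneousRingBotHom_isOpenImmersion {p : ℕ} (T : Supertorus p q)
    {B : Subalgebra ℂ (TorusRing p q)} [SuperRing (restrictGrading B)] {s : TorusRing p q}
    (hs : s ∈ B) (hs_even : s ∈ torusGrading p q 0) (hs_unit : IsUnit s)
    (h : ∀ f, ∃ N : ℕ, s ^ N * f ∈ B) :
    (homogeneousRingBotHom T B).IsOpenImmersion := by
  refine SuperHom.isOpenImmersion_of_away (Subalgebra.inclusion_injective _)
    (s := ⟨⟨s, hs⟩, hs_even⟩) ?_ fun c => ?_
  · obtain ⟨t, hst, hts⟩ := isUnit_iff_exists.1 hs_unit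
    rw [← SuperRing.isUnit_coe_evenPart_iff]
    exact isUnit_iff_exists.2 ⟨⟨t, T.homogeneousRing_bot ▸ Algebra.mem_top⟩, Subtype.ext hst,
      Subtype.ext hts⟩
  · obtain ⟨N, hN⟩ := h c
    exact ⟨N, ⟨_, hN⟩, Subtype.ext rfl⟩

end MonomialSupervarieties

section LaurentCharacters

variable {p : ℕ}

/-- The character `z ↦ z^χ` of the torus `(ℂˣ)^p`, with values in `ℂ` rather than `ℂˣ` so that
linear independence of characters applies to it. -/
def laurentCharacter (χ : Fin p → ℤ) : (Fin p → ℂˣ) →* ℂ :=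
  (Units.coeHom ℂ).comp
    { toFun := fun z => ∏ k, z k ^ χ k
      map_one' := by simp
      map_mul' := fun z z' => by simp only [Pi.mul_apply, mul_zpow, Finset.prod_mul_distrib] }

theorem laurentCharacter_apply (χ : Fin p → ℤ) (z : Fin p → ℂˣ) :
    laurentCharacter χ z = ((∏ k, z k ^ χ k : ℂˣ) : ℂ) := rfl

theorem laurentCharacter_zero (z : Fin p → ℂˣ) : laurentCharacter 0 z = 1 := by
  simp [laurentCharacter_apply]

theorem laurentCharacter_add (χ ψ : Fin p → ℤ) (z : Fin p → ℂˣ) :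
    laurentCharacter (χ + ψ) z = laurentCharacter χ z * laurentCharacter ψ z := by
  simp only [laurentCharacter_apply, Pi.add_apply, zpow_add, Finset.prod_mul_distrib,
    Units.val_mul]

theorem laurentCharacter_mulSingle (χ : Fin p → ℤ) (k : Fin p) (u : ℂˣ) :
    laurentCharacter χ (Pi.mulSingle k u) = (u : ℂ) ^ χ k := by
  rw [laurentCharacter_apply, Finset.prod_eq_single k (fun l _ hl => by
    rw [Pi.mulSingle_eq_of_ne hl, one_zpow]) (by simp), Pi.mulSingle_eq_same,
    Units.val_zpow_eq_zpow_val]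

theorem laurentCharacter_injective : Function.Injective (laurentCharacter (p := p)) := by
  intro χ ψ h
  ext k
  have hk := congrArg norm (DFunLike.congr_fun h (Pi.mulSingle k (Units.mk0 2 two_ne_zero)))
  rw [laurentCharacter_mulSingle, laurentCharacter_mulSingle, Units.val_mk0, norm_zpow, norm_zpow,
    Complex.norm_ofNat] at hk
  exact zpow_right_injective₀ (by norm_num) (by norm_num) hk

theorem laurentPolynomial_eq_zero {V : Type*} [AddCommGroup V] [Module ℂ V]
    {g : (Fin p → ℤ) →₀ V} (h : ∀ z, (g.sum fun χ b => laurentCharacter χ z • b) = 0) :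
    g = 0 := by
  have hli := (linearIndependent_monoidHom (Fin p → ℂˣ) ℂ).comp _ laurentCharacter_injective
  ext χ
  rw [Finsupp.zero_apply, ← Module.forall_dual_apply_eq_zero_iff ℂ]
  intro l
  suffices hl : g.mapRange l (map_zero l) = 0 from DFunLike.congr_fun hl χ
  refine linearIndependent_iff.1 hli _ (funext fun z => ?_)
  rw [Finsupp.linearCombination_apply, Finsupp.sum_mapRange_index (by simp), Finsupp.sum,
    Finset.sum_apply, Pi.zero_apply, ← map_zero l, ← h z, Finsupp.sum, map_sum]
  refine Finset.sum_congr rfl fun χ _ => ?_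
  rw [map_smul, Pi.smul_apply, smul_eq_mul, smul_eq_mul, mul_comm]
  rfl

theorem laurentPolynomial_ext {V : Type*} [AddCommGroup V] [Module ℂ V]
    {f g : (Fin p → ℤ) →₀ V} (h : ∀ z, (f.sum fun χ b => laurentCharacter χ z • b) =
      g.sum fun χ b => laurentCharacter χ z • b) : f = g := by
  refine sub_eq_zero.1 (laurentPolynomial_eq_zero fun z => ?_)
  rw [Finsupp.sum_sub_index fun _ _ _ => smul_sub _ _ _, h, sub_self]

end LaurentCharacters

section TorusOperators

variable {p q : ℕ}

theorem weightScale_mul {w : (Fin p → ℤ) → ℂ} (hw : ∀ χ ψ, w (χ + ψ) = w χ * w ψ)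
    (f g : TorusRing p q) : weightScale w (f * g) = weightScale w f * weightScale w g := by
  induction f using AddMonoidAlgebra.induction_linear with
  | zero => simp
  | add x y hx hy => simp only [add_mul, map_add, hx, hy]
  | single χ a =>
    induction g using AddMonoidAlgebra.induction_linear with
    | zero => simp
    | add x y hx hy => simp only [mul_add, map_add, hx, hy]
    | single ψ b =>
      simp only [AddMonoidAlgebra.single_mul_single, weightScale_single, hw, smul_mul_smul_comm]

theorem weightScale_oddCoord_mul (w : (Fin p → ℤ) → ℂ) (j : Fin q) (f : TorusRing p q) :
    weightScale w (oddCoord j * f) = oddCoord j * weightScale w f := by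
  induction f using AddMonoidAlgebra.induction_linear with
  | zero => simp
  | add x y hx hy => simp only [mul_add, map_add, hx, hy]
  | single χ a =>
    simp only [oddCoord, AddMonoidAlgebra.single_mul_single, weightScale_single, zero_add,
      mul_smul_comm]

theorem weightScale_comm (w w' : (Fin p → ℤ) → ℂ) (f : TorusRing p q) :
    weightScale w (weightScale w' f) = weightScale w' (weightScale w f) := by
  ext χ : 2
  exact smul_comm (w χ) (w' χ) (f.coeff χ)

theorem weightScale_mem (w : (Fin p → ℤ) → ℂ) {i : ZMod 2} {f : TorusRing p q}
    (hf : f ∈ torusGrading p q i) : weightScale w f ∈ torusGrading p q i :=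
  fun χ => Submodule.smul_mem _ _ (hf χ)

theorem evenDeriv_eq_sum (x : Fin p → ℂ) (f : TorusRing p q) :
    evenDeriv x f = ∑ k, x k • evenDeriv (Pi.single k 1) f := by
  induction f using AddMonoidAlgebra.induction_linear with
  | zero => simp
  | add f g hf hg => simp only [map_add, smul_add, Finset.sum_add_distrib, hf, hg]
  | single χ a =>
    have hk (k) : ∑ l, (χ l : ℂ) * (Pi.single k 1 : Fin p → ℂ) l = χ k := by
      simp [Pi.single_apply]
    simp only [evenDeriv, weightScale_single, hk, AddMonoidAlgebra.smul_single, smul_smul]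
    simp only [Finset.sum_smul, mul_comm (x _)]
    exact map_sum (AddMonoidAlgebra.singleAddHom χ) _ _

theorem leftTranslate_eq_weightScale (z : Fin p → ℂˣ) (f : TorusRing p q) :
    leftTranslate z f = weightScale (fun χ => laurentCharacter (-χ) z) f := by
  simp only [leftTranslate, laurentCharacter_apply, Units.coe_prod, Pi.neg_apply]

theorem leftTranslate_mul (z : Fin p → ℂˣ) (f g : TorusRing p q) :
    leftTranslate z (f * g) = leftTranslate z f * leftTranslate z g := by
  simp only [leftTranslate_eq_weightScale]
  exact weightScale_mul (fun χ ψ => by rw [neg_add, laurentCharacter_add]) f g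

theorem leftTranslate_apply_one (z : Fin p → ℂˣ) :
    leftTranslate z (1 : TorusRing p q) = 1 := by
  rw [leftTranslate_eq_weightScale, AddMonoidAlgebra.one_def, weightScale_single, neg_zero,
    laurentCharacter_zero, one_smul]

theorem leftTranslate_one (f : TorusRing p q) : leftTranslate 1 f = f := by
  rw [leftTranslate_eq_weightScale]
  ext χ : 2
  change laurentCharacter (-χ) 1 • f.coeff χ = f.coeff χ
  rw [map_one, one_smul]

theorem leftTranslate_leftTranslate (z z' : Fin p → ℂˣ) (f : TorusRing p q) :
    leftTranslate z (leftTranslate z' f) = leftTranslate (z * z') f := by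
  simp only [leftTranslate_eq_weightScale]
  ext χ : 2
  change laurentCharacter (-χ) z • laurentCharacter (-χ) z' • f.coeff χ =
    laurentCharacter (-χ) (z * z') • f.coeff χ
  rw [smul_smul, map_mul]

theorem oddDeriv_single (i : Fin q) (χ : Fin p → ℤ) (a : ExteriorAlgebra ℂ (Fin q → ℂ)) :
    oddDeriv i (AddMonoidAlgebra.single χ a) = AddMonoidAlgebra.single χ
      (CliffordAlgebra.contractLeft (Q := (0 : QuadraticForm ℂ (Fin q → ℂ)))
        (LinearMap.proj i) a) :=
  AddMonoidAlgebra.coeff_injective (Finsupp.mapRange_single (hf := map_zero _))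

theorem oddDeriv_oddCoord (i j : Fin q) :
    oddDeriv i (oddCoord j : TorusRing p q) = if i = j then 1 else 0 := by
  have h : CliffordAlgebra.contractLeft (Q := (0 : QuadraticForm ℂ (Fin q → ℂ)))
      (LinearMap.proj i) (ExteriorAlgebra.ι ℂ (Pi.single j 1)) = if i = j then 1 else 0 := by
    refine (CliffordAlgebra.contractLeft_ι _ _ _).trans ?_
    rw [LinearMap.proj_apply, Pi.single_apply]
    split_ifs <;> simp
  rw [oddCoord, oddDeriv_single, h]
  split_ifs
  · rfl
  · exact AddMonoidAlgebra.single_zero _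

theorem oddDeriv_oddCoord_mul (i j : Fin q) (f : TorusRing p q) :
    oddDeriv i (oddCoord j * f) = (if i = j then f else 0) - oddCoord j * oddDeriv i f := by
  rw [oddDeriv_mul, oddDeriv_oddCoord, (mem_torusGrading_one _).1 (oddCoord_mem j), neg_mul,
    ← sub_eq_add_neg, ite_mul, one_mul, zero_mul]

theorem oddDeriv_comm (i j : Fin q) (f : TorusRing p q) :
    oddDeriv i (oddDeriv j f) = -oddDeriv j (oddDeriv i f) := by
  ext χ : 2
  exact CliffordAlgebra.contractLeft_comm (Q := (0 : QuadraticForm ℂ (Fin q → ℂ)))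
    (d := LinearMap.proj i) (d' := LinearMap.proj j) (f.coeff χ)

theorem oddDeriv_weightScale (i : Fin q) (w : (Fin p → ℤ) → ℂ) (f : TorusRing p q) :
    oddDeriv i (weightScale w f) = weightScale w (oddDeriv i f) := by
  ext χ : 2
  exact map_smul (CliffordAlgebra.contractLeft (Q := (0 : QuadraticForm ℂ (Fin q → ℂ)))
      (LinearMap.proj i)) (w χ) (f.coeff χ)

end TorusOperators

section LeftVectorFields

variable {p q : ℕ} (T : Supertorus p q)

theorem Supertorus.leftOdd_apply (i : Fin q) (f : TorusRing p q) :
    T.leftOdd i f = (1 / 2 : ℂ) • ∑ j, oddCoord j * evenDeriv (T.bracket i j) f -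
      oddDeriv i f := by
  simp only [leftOdd, LinearMap.sub_apply, LinearMap.smul_apply, LinearMap.sum_apply,
    LinearMap.comp_apply, LinearMap.mulLeft_apply]

/-- The supertorus with the opposite bracket, whose right translations are the left translations
of the given supertorus up to sign. -/
def Supertorus.opposite : Supertorus p q where
  bracket i j k := -T.bracket i j k
  symm i j := by rw [T.symm]

theorem Supertorus.leftOdd_eq_neg_rightOdd (i : Fin q) (f : TorusRing p q) :
    T.leftOdd i f = -T.opposite.rightOdd i f := by
  have h (j) : evenDeriv (T.opposite.bracket i j) f = -evenDeriv (T.bracket i j) f := by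
    rw [evenDeriv_eq_sum, evenDeriv_eq_sum (T.bracket i j), ← Finset.sum_neg_distrib]
    exact Finset.sum_congr rfl fun k _ => neg_smul _ _
  simp only [leftOdd_apply, rightOdd, LinearMap.add_apply, LinearMap.smul_apply,
    LinearMap.sum_apply, LinearMap.comp_apply, LinearMap.mulLeft_apply, h, mul_neg,
    Finset.sum_neg_distrib, smul_neg]
  abel

theorem Supertorus.leftOdd_mul (i : Fin q) (f g : TorusRing p q) :
    T.leftOdd i (f * g) = T.leftOdd i f * g + parityInvolution p q f * T.leftOdd i g := by
  simp only [leftOdd_eq_neg_rightOdd, rightOdd_mul, neg_mul, mul_neg, neg_add]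

theorem Supertorus.leftOdd_parityInvolution (i : Fin q) (f : TorusRing p q) :
    T.leftOdd i (parityInvolution p q f) = -parityInvolution p q (T.leftOdd i f) := by
  simp only [leftOdd_eq_neg_rightOdd, rightOdd_parityInvolution, map_neg]

theorem Supertorus.leftOdd_mem (i : Fin q) {j : ZMod 2} {f : TorusRing p q}
    (hf : f ∈ torusGrading p q j) : T.leftOdd i f ∈ torusGrading p q (j + 1) := by
  have h := T.leftOdd_parityInvolution i f
  fin_cases j
  · rw [(mem_torusGrading_zero _).1 hf] at h
    exact (mem_torusGrading_one _).2 (neg_eq_iff_eq_neg.2 h).symm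
  · rw [(mem_torusGrading_one _).1 hf, map_neg, neg_inj] at h
    exact (mem_torusGrading_zero _).2 h.symm

theorem Supertorus.leftOdd_weightScale (i : Fin q) (w : (Fin p → ℤ) → ℂ) (f : TorusRing p q) :
    T.leftOdd i (weightScale w f) = weightScale w (T.leftOdd i f) := by
  simp only [T.leftOdd_apply, map_sub, map_smul, map_sum, weightScale_oddCoord_mul,
    oddDeriv_weightScale, evenDeriv, weightScale_comm w]

theorem Supertorus.leftOdd_leftOdd (i j : Fin q) (f : TorusRing p q) :
    T.leftOdd i (T.leftOdd j f) =
      (1 / 4 : ℂ) • ∑ a, ∑ b, oddCoord a * (oddCoord b *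
        evenDeriv (T.bracket i a) (evenDeriv (T.bracket j b) f)) -
      (1 / 2 : ℂ) • ∑ a, oddCoord a * evenDeriv (T.bracket i a) (oddDeriv j f) -
      (1 / 2 : ℂ) • evenDeriv (T.bracket i j) f +
      (1 / 2 : ℂ) • ∑ b, oddCoord b * evenDeriv (T.bracket j b) (oddDeriv i f) +
      oddDeriv i (oddDeriv j f) := by
  have hcoord (x b) (g : TorusRing p q) :
      evenDeriv x (oddCoord b * g) = oddCoord b * evenDeriv x g :=
    weightScale_oddCoord_mul _ _ _
  have hderiv (x) (g : TorusRing p q) : oddDeriv i (evenDeriv x g) = evenDeriv x (oddDeriv i g) :=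
    oddDeriv_weightScale _ _ _
  rw [T.leftOdd_apply i, T.leftOdd_apply j]
  simp only [map_sub, map_smul, map_sum, hcoord, oddDeriv_oddCoord_mul, hderiv, mul_sub,
    mul_smul_comm, Finset.mul_sum, Finset.sum_sub_distrib, ← Finset.smul_sum, smul_sub, smul_smul,
    Finset.sum_ite_eq, Finset.mem_univ, if_true, T.symm j i]
  norm_num
  abel

theorem Supertorus.leftOdd_bracket (i j : Fin q) (f : TorusRing p q) :
    T.leftOdd i (T.leftOdd j f) + T.leftOdd j (T.leftOdd i f) =
      -evenDeriv (T.bracket i j) f := by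
  have hquad : ∑ a, ∑ b, oddCoord a * (oddCoord b *
        evenDeriv (T.bracket i a) (evenDeriv (T.bracket j b) f)) =
      -∑ a, ∑ b, oddCoord a * (oddCoord b *
        evenDeriv (T.bracket j a) (evenDeriv (T.bracket i b) f)) := by
    rw [Finset.sum_comm, ← Finset.sum_neg_distrib]
    refine Finset.sum_congr rfl fun b _ => ?_
    rw [← Finset.sum_neg_distrib]
    refine Finset.sum_congr rfl fun a _ => ?_
    rw [← mul_assoc, ← mul_assoc,
      SuperRing.odd_anticomm (𝒜 := torusGrading p q) (oddCoord_mem a) (oddCoord_mem b), neg_mul,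
      evenDeriv, evenDeriv, weightScale_comm]
  rw [T.leftOdd_leftOdd, T.leftOdd_leftOdd j i, hquad, oddDeriv_comm i j, T.symm j i]
  module

end LeftVectorFields

section SkewDerivations

theorem skewDerivation_mem_adjoin {R A : Type*} [CommRing R] [Ring A] [Algebra R A] {X : Set A}
    {D : A →ₗ[R] A} {σ : A →ₐ[R] A} (hD : ∀ f g, D (f * g) = D f * g + σ f * D g)
    (hσ : ∀ f ∈ Algebra.adjoin R X, σ f ∈ Algebra.adjoin R X)
    (hX : ∀ x ∈ X, D x ∈ Algebra.adjoin R X) {f : A} (hf : f ∈ Algebra.adjoin R X) :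
    D f ∈ Algebra.adjoin R X := by
  induction hf using Algebra.adjoin_induction with
  | mem x hx => exact hX x hx
  | algebraMap z =>
    have h := hD 1 1
    rw [map_one σ, one_mul, mul_one, one_mul, left_eq_add] at h
    rw [Algebra.algebraMap_eq_smul_one, map_smul, h, smul_zero]
    exact zero_mem _
  | add f g _ _ hf hg =>
    rw [map_add]
    exact add_mem hf hg
  | mul f g hf hg ihf ihg =>
    rw [hD]
    exact add_mem (mul_mem ihf hg) (mul_mem (hσ f hf) ihg)

end SkewDerivations

section WeightGradedSubalgebras

variable {p q : ℕ}

/-- The subalgebra `B` of `ℂ[T]` is spanned by its vectors of weight `χ` for the torus `T₀`, for all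
characters `χ`, expressed by its stability under all operators that are scalar on the weight
spaces. -/
def IsWeightGraded (B : Subalgebra ℂ (TorusRing p q)) : Prop :=
  ∀ w, ∀ f ∈ B, weightScale w f ∈ B

theorem isWeightGraded_adjoin {X : Set (TorusRing p q)}
    (hX : ∀ x ∈ X, ∃ χ a, x = AddMonoidAlgebra.single χ a) :
    IsWeightGraded (Algebra.adjoin ℂ X) := by
  intro w f hf
  suffices h : (Algebra.adjoin ℂ X).toSubmodule ≤ (Algebra.adjoin ℂ X).toSubmodule.comap
    (weightScale w) from h hf
  nth_rw 1 [Algebra.adjoin_eq_span]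
  refine Submodule.span_le.2 fun x hx => ?_
  obtain ⟨χ, a, rfl⟩ : ∃ χ a, x = AddMonoidAlgebra.single χ a := by
    induction hx using Submonoid.closure_induction with
    | mem x hx => exact hX x hx
    | one => exact ⟨0, 1, rfl⟩
    | mul x y _ _ hx hy =>
      obtain ⟨χ, a, rfl⟩ := hx
      obtain ⟨ψ, b, rfl⟩ := hy
      exact ⟨_, _, AddMonoidAlgebra.single_mul_single _ _ _ _⟩
  change weightScale w (AddMonoidAlgebra.single χ a) ∈ Algebra.adjoin ℂ X
  rw [weightScale_single, ← AddMonoidAlgebra.smul_single]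
  exact Subalgebra.smul_mem _
    ((Submonoid.closure_le (S := (Algebra.adjoin ℂ X).toSubmonoid)).2 Algebra.subset_adjoin hx) _

variable {B : Subalgebra ℂ (TorusRing p q)}

theorem IsWeightGraded.leftTranslate_mem (hB : IsWeightGraded B) (z : Fin p → ℂˣ)
    {f : TorusRing p q} (hf : f ∈ B) : leftTranslate z f ∈ B := by
  rw [leftTranslate_eq_weightScale]
  exact hB _ f hf

theorem weightScale_piSingle (χ : Fin p → ℤ) (f : TorusRing p q) :
    weightScale (Pi.single χ 1) f = AddMonoidAlgebra.single χ (f.coeff χ) := by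
  ext ψ : 2
  change (Pi.single χ 1 : (Fin p → ℤ) → ℂ) ψ • f.coeff ψ = _
  rw [AddMonoidAlgebra.coeff_single]
  rcases eq_or_ne ψ χ with rfl | h
  · rw [Finsupp.single_eq_same, Pi.single_eq_same, one_smul]
  · rw [Finsupp.single_eq_of_ne h, Pi.single_eq_of_ne h, zero_smul]

theorem IsWeightGraded.single_coeff_mem (hB : IsWeightGraded B) {f : TorusRing p q} (hf : f ∈ B)
    (χ : Fin p → ℤ) : AddMonoidAlgebra.single χ (f.coeff χ) ∈ B :=
  weightScale_piSingle χ f ▸ hB _ f hf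

/-- The restriction to `B` of an endomorphism of `ℂ[T]` that preserves `B`. -/
def restrictEnd (D : TorusRing p q →ₗ[ℂ] TorusRing p q) (hD : ∀ f ∈ B, D f ∈ B) :
    Module.End ℂ B where
  toFun f := ⟨D f, hD f f.2⟩
  map_add' _ _ := Subtype.ext (map_add D _ _)
  map_smul' _ _ := Subtype.ext (map_smul D _ _)

/-- The action of `z ∈ T₀` on `B` through left translation, as an endomorphism. -/
def torusAlgHom (hB : IsWeightGraded B) (z : Fin p → ℂˣ) : B →ₐ[ℂ] B :=
  AlgHom.ofLinearMap (restrictEnd (leftTranslate z) fun _ => hB.leftTranslate_mem z)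
    (Subtype.ext (leftTranslate_apply_one z))
    fun f g => Subtype.ext (leftTranslate_mul z (f : TorusRing p q) g)

theorem torusAlgHom_comp (hB : IsWeightGraded B) (z z' : Fin p → ℂˣ) :
    (torusAlgHom hB z).comp (torusAlgHom hB z') = torusAlgHom hB (z * z') :=
  AlgHom.ext fun a => Subtype.ext (leftTranslate_leftTranslate z z' (a : TorusRing p q))

theorem torusAlgHom_one (hB : IsWeightGraded B) : torusAlgHom hB 1 = AlgHom.id ℂ B :=
  AlgHom.ext fun a => Subtype.ext (leftTranslate_one (a : TorusRing p q))

/-- The action of `T₀` on `B` through left translation. -/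
def torusAction (hB : IsWeightGraded B) : (Fin p → ℂˣ) →* (B ≃ₐ[ℂ] B) where
  toFun z := AlgEquiv.ofAlgHom (torusAlgHom hB z) (torusAlgHom hB z⁻¹)
    (by rw [torusAlgHom_comp, mul_inv_cancel, torusAlgHom_one])
    (by rw [torusAlgHom_comp, inv_mul_cancel, torusAlgHom_one])
  map_one' := AlgEquiv.ext fun a => DFunLike.congr_fun (torusAlgHom_one hB) a
  map_mul' z z' := AlgEquiv.ext fun a => (DFunLike.congr_fun (torusAlgHom_comp hB z z') a).symm

/-- The orbit map `z ↦ z · a` of `a ∈ B` under the left translations, as a Laurent polynomial with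
coefficients in `B`. Since `z · t^χ = z^(-χ) t^χ`, its `z^(-χ)`-coefficient is the component of `a`
of weight `χ`. -/
def orbitPolynomial (hB : IsWeightGraded B) (a : B) : (Fin p → ℤ) →₀ B :=
  ∑ χ ∈ (a : TorusRing p q).coeff.support,
    Finsupp.single (-χ) ⟨AddMonoidAlgebra.single χ _, hB.single_coeff_mem a.2 χ⟩

theorem coe_orbitPolynomial_sum (hB : IsWeightGraded B) (a : B) (w : (Fin p → ℤ) → ℂ) :
    (((orbitPolynomial hB a).sum fun χ b => w χ • b : B) : TorusRing p q) =
      weightScale (fun χ => w (-χ)) a := by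
  rw [orbitPolynomial,
    ← Finsupp.sum_finsetSum_index (fun _ => smul_zero _) fun _ _ _ => smul_add _ _ _,
    AddSubmonoidClass.coe_finsetSum]
  conv_rhs => rw [torus_sum_single (a : TorusRing p q), map_sum]
  refine Finset.sum_congr rfl fun χ _ => ?_
  rw [weightScale_single, ← AddMonoidAlgebra.smul_single]
  exact congrArg Subtype.val (Finsupp.sum_single_index (h := fun ψ b => w ψ • b) (smul_zero _))

theorem torusAction_eq_orbitPolynomial_sum (hB : IsWeightGraded B) (a : B) (z : Fin p → ℂˣ) :
    torusAction hB z a = (orbitPolynomial hB a).sum fun χ b => laurentCharacter χ z • b :=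
  Subtype.ext <| (leftTranslate_eq_weightScale z (a : TorusRing p q)).trans
    (coe_orbitPolynomial_sum hB a fun χ => laurentCharacter χ z).symm

theorem coe_orbitPolynomial_sum_smul (hB : IsWeightGraded B) (a : B) (k : Fin p) :
    (((orbitPolynomial hB a).sum fun χ b => (χ k : ℂ) • b : B) : TorusRing p q) =
      -evenDeriv (Pi.single k 1) (a : TorusRing p q) := by
  rw [coe_orbitPolynomial_sum hB a fun χ => (χ k : ℂ)]
  ext χ : 2
  change ((-χ) k : ℂ) • (a : TorusRing p q).coeff χ =
    -((∑ l, (χ l : ℂ) * (Pi.single k 1 : Fin p → ℂ) l) • (a : TorusRing p q).coeff χ)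
  simp [Pi.single_apply]

theorem parityInvolution_eq_smul {j : ZMod 2} {f : TorusRing p q} (hf : f ∈ torusGrading p q j) :
    parityInvolution p q f = (-1 : ℂ) ^ j.val • f := by
  fin_cases j
  · exact ((mem_torusGrading_zero f).1 hf).trans (by simp [ZMod.val])
  · exact ((mem_torusGrading_one f).1 hf).trans (by simp [ZMod.val])

/-- The action of the supertorus `T` through left translation on the spectrum of a weight graded
subalgebra `B` of `ℂ[T]` that the odd vector fields preserve. -/
def supertorusAction (T : Supertorus p q) (hB : IsWeightGraded B)
    (hT : ∀ i, ∀ f ∈ B, T.leftOdd i f ∈ B) : SupertorusAction T (restrictGrading B) where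
  grp := torusAction hB
  grp_mem z i a ha := by
    change leftTranslate z (a : TorusRing p q) ∈ torusGrading p q i
    rw [leftTranslate_eq_weightScale]
    exact weightScale_mem _ ha
  rational a := ⟨orbitPolynomial hB a, torusAction_eq_orbitPolynomial_sum hB a⟩
  even k := restrictEnd (-evenDeriv (Pi.single k 1)) fun f hf => neg_mem (hB _ f hf)
  even_apply a f hf k := by
    obtain rfl : orbitPolynomial hB a = f := laurentPolynomial_ext fun z =>
      (torusAction_eq_orbitPolynomial_sum hB a z).symm.trans (hf z)
    exact Subtype.ext (coe_orbitPolynomial_sum_smul hB a k).symm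
  odd i := restrictEnd (T.leftOdd i) (hT i)
  odd_mem i j a ha := T.leftOdd_mem i ha
  odd_mul i j a b ha := by
    refine Subtype.ext ((T.leftOdd_mul i a b).trans ?_)
    rw [parityInvolution_eq_smul ha, smul_mul_assoc]
    rfl
  odd_bracket i j a := by
    refine Subtype.ext ((T.leftOdd_bracket i j a).trans ?_)
    rw [evenDeriv_eq_sum, ← Finset.sum_neg_distrib, AddSubmonoidClass.coe_finsetSum]
    exact Finset.sum_congr rfl fun k _ => (smul_neg _ _).symm
  grp_odd z i a := by
    refine Subtype.ext ?_
    change leftTranslate z (T.leftOdd i (a : TorusRing p q)) = T.leftOdd i (leftTranslate z _)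
    rw [leftTranslate_eq_weightScale, leftTranslate_eq_weightScale, T.leftOdd_weightScale]

end WeightGradedSubalgebras

section MonomialOperators

variable {q n : ℕ}

theorem charXV_injective : Function.Injective (charXV (n := n)) := fun m m' h =>
  funext fun l => by simpa [charXV] using congrFun h l.succ

theorem superMonomial_eq_oddCoord_mul {k : (Fin q → ℕ) × (Fin n → ℕ)} {j : Fin q}
    (hj : k.1 j = 1) :
    superMonomial k = oddCoord j * superMonomial (k.1 - Pi.single j 1, k.2) ∨
      superMonomial k = -(oddCoord j * superMonomial (k.1 - Pi.single j 1, k.2)) := by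
  have hk : k.1 - Pi.single j 1 + Pi.single j 1 = k.1 :=
    tsub_add_cancel_of_le (update_le_iff.2 ⟨hj.ge, fun _ _ => Nat.zero_le _⟩)
  have h := oddCoord_mul_superMonomial (k := (k.1 - Pi.single j 1, k.2)) (j := j) (by simp [hj])
  rw [hk] at h
  exact h.imp Eq.symm fun h => neg_eq_iff_eq_neg.1 h.symm

theorem oddCoord_mul_superMonomial_eq_zero {k : (Fin q → ℕ) × (Fin n → ℕ)} {j : Fin q}
    (hj : k.1 j = 1) : oddCoord j * superMonomial k = 0 := by
  have h : (oddCoord j * oddCoord j : TorusRing (n + 1) q) = 0 :=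
    SuperRing.odd_sq (oddCoord_mem j)
  rcases superMonomial_eq_oddCoord_mul hj with hk | hk <;> simp [hk, ← mul_assoc, h]

theorem oddDeriv_superMonomial_eq_zero {k : (Fin q → ℕ) × (Fin n → ℕ)} {j : Fin q}
    (hj : k.1 j = 0) : oddDeriv j (superMonomial k) = 0 := by
  rw [superMonomial_eq_single, oddDeriv_single, contractLeft_extMonomial hj,
    AddMonoidAlgebra.single_zero]

theorem oddDeriv_superMonomial {k : (Fin q → ℕ) × (Fin n → ℕ)} {j : Fin q} (hj : k.1 j = 1) :
    oddDeriv j (superMonomial k) = superMonomial (k.1 - Pi.single j 1, k.2) ∨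
      oddDeriv j (superMonomial k) = -superMonomial (k.1 - Pi.single j 1, k.2) := by
  have h : oddDeriv j (oddCoord j * superMonomial (k.1 - Pi.single j 1, k.2)) =
      superMonomial (k.1 - Pi.single j 1, k.2) := by
    rw [oddDeriv_oddCoord_mul, if_pos rfl, oddDeriv_superMonomial_eq_zero (by simp [hj]), mul_zero,
      sub_zero]
  rcases superMonomial_eq_oddCoord_mul hj with hk | hk
  · exact Or.inl (hk ▸ h)
  · exact Or.inr (by rw [hk, map_neg, h])

theorem oddCoord_mul_oddDeriv_superMonomial {k : (Fin q → ℕ) × (Fin n → ℕ)} {j : Fin q}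
    (hj : k.1 j = 1) : oddCoord j * oddDeriv j (superMonomial k) = superMonomial k := by
  have h := oddDeriv_oddCoord_mul j j (superMonomial k)
  rw [oddCoord_mul_superMonomial_eq_zero hj, map_zero, if_pos rfl] at h
  exact (sub_eq_zero.1 h.symm).symm

theorem leftOdd_superMonomial (c : Fin q → Fin q → Fin n → ℂ) (hc : ∀ i j, c i j = c j i)
    (i : Fin q) (k : (Fin q → ℕ) × (Fin n → ℕ)) :
    (supertorusOf c hc).leftOdd i (superMonomial k) =
      (1 / 2 : ℂ) • ∑ j, (∑ l, (k.2 l : ℂ) * c i j l) • (oddCoord j * superMonomial k) -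
        oddDeriv i (superMonomial k) := by
  rw [Supertorus.leftOdd_apply]
  congr 2
  refine Finset.sum_congr rfl fun j _ => ?_
  have h : evenDeriv ((supertorusOf c hc).bracket i j) (superMonomial k) =
      (∑ l, (k.2 l : ℂ) * c i j l) • superMonomial k := by
    rw [superMonomial_eq_single, evenDeriv, weightScale_single, ← AddMonoidAlgebra.smul_single,
      Fin.sum_univ_succ]
    simp [supertorusOf, charXV]
  rw [h, mul_smul_comm]

end MonomialOperators

section MonomialMembership

variable {q n : ℕ}

theorem linearIndepOn_superMonomial :
    LinearIndepOn ℂ superMonomial {k : (Fin q → ℕ) × (Fin n → ℕ) | ∀ i, k.1 i ≤ 1} := by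
  let b : Module.Basis _ ℂ ((Fin (n + 1) → ℤ) →₀ ExteriorAlgebra ℂ (Fin q → ℂ)) :=
    Finsupp.basis fun _ => (Pi.basisFun ℂ (Fin q)).ExteriorAlgebra
  let coeffMap : TorusRing (n + 1) q →ₗ[ℂ] (Fin (n + 1) → ℤ) →₀ ExteriorAlgebra ℂ (Fin q → ℂ) :=
    (AddMonoidAlgebra.coeffLinearEquiv ℂ).toLinearMap
  let index (k : {k : (Fin q → ℕ) × (Fin n → ℕ) | ∀ i, k.1 i ≤ 1}) :
      Σ _ : Fin (n + 1) → ℤ, Finset (Fin q) :=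
    ⟨charXV k.1.2, Finset.univ.filter fun i => k.1.1 i = 1⟩
  have hindex : Function.Injective index := by
    rintro ⟨⟨I, m⟩, hI⟩ ⟨⟨I', m'⟩, hI'⟩ h
    obtain ⟨hm, hII'⟩ := Sigma.mk.inj_iff.1 h
    have hI_eq : I = I' := funext fun i => by
      have hi : I i ≤ 1 := hI i
      have hi' : I' i ≤ 1 := hI' i
      have hiff : I i = 1 ↔ I' i = 1 := by simpa using Finset.ext_iff.1 (eq_of_heq hII') i
      omega
    exact Subtype.ext (Prod.ext hI_eq (charXV_injective hm))
  have hb : coeffMap ∘ (fun k => superMonomial k.1) = b ∘ index := funext fun k => by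
    rw [Function.comp_apply, Function.comp_apply, Finsupp.coe_basis]
    exact congrArg (Finsupp.single _) (extMonomial_eq_exteriorBasis k.2)
  exact LinearIndependent.of_comp coeffMap (hb ▸ b.linearIndependent.comp index hindex)

variable {K : Finset ((Fin q → ℕ) × (Fin n → ℕ))}

theorem eq_one_or_mem_or_two_le_of_mem_closure {f : TorusRing (n + 1) q}
    (hf : f ∈ Submonoid.closure (superMonomial '' (K : Set ((Fin q → ℕ) × (Fin n → ℕ))))) :
    f = 1 ∨ f ∈ superMonomial '' (K : Set ((Fin q → ℕ) × (Fin n → ℕ))) ∨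
      ∃ (χ : Fin (n + 1) → ℤ) (a : _), 2 ≤ χ 0 ∧ f = AddMonoidAlgebra.single χ a := by
  induction hf using Submonoid.closure_induction_left with
  | one => exact Or.inl rfl
  | mul_left x hx y _ hy =>
    obtain ⟨k, hk, rfl⟩ := hx
    right
    rcases hy with rfl | ⟨l, _, rfl⟩ | ⟨χ, a, hχ, rfl⟩
    · exact Or.inl ⟨k, hk, (mul_one _).symm⟩
    · refine Or.inr ⟨_, _, ?_, AddMonoidAlgebra.single_mul_single _ _ _ _⟩
      simp [charXV]
    · refine Or.inr ⟨_, _, ?_, AddMonoidAlgebra.single_mul_single _ _ _ _⟩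
      simp only [charXV, Pi.add_apply, Fin.cons_zero]
      omega

theorem weightScale_mem_span_superMonomial {f : TorusRing (n + 1) q}
    (hf : f ∈ monomialAlgebra K) :
    weightScale (fun χ => if χ 0 = 1 then 1 else 0) f ∈
      Submodule.span ℂ (superMonomial '' (K : Set ((Fin q → ℕ) × (Fin n → ℕ)))) := by
  suffices h : (monomialAlgebra K).toSubmodule ≤ (Submodule.span ℂ (superMonomial '' K)).comap
    (weightScale fun χ => if χ 0 = 1 then 1 else 0) from h hf
  rw [monomialAlgebra, Algebra.adjoin_eq_span]
  refine Submodule.span_le.2 fun x hx => ?_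
  rw [SetLike.mem_coe, Submodule.mem_comap]
  rcases eq_one_or_mem_or_two_le_of_mem_closure hx with rfl | ⟨k, hk, rfl⟩ | ⟨χ, a, hχ, rfl⟩
  · rw [AddMonoidAlgebra.one_def, weightScale_single]
    simp
  · rw [superMonomial_eq_single, weightScale_single,
      if_pos (show charXV k.2 0 = 1 from rfl), one_smul]
    exact Submodule.subset_span ⟨k, hk, rfl⟩
  · rw [weightScale_single, if_neg (by omega), zero_smul, AddMonoidAlgebra.single_zero]
    exact zero_mem _

theorem mem_of_superMonomial_mem (hK : ∀ k ∈ K, ∀ i, k.1 i ≤ 1)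
    {k : (Fin q → ℕ) × (Fin n → ℕ)} (hk : ∀ i, k.1 i ≤ 1)
    (hmem : superMonomial k ∈ monomialAlgebra K) : k ∈ K := by
  have hspan := weightScale_mem_span_superMonomial hmem
  rw [superMonomial_eq_single, weightScale_single,
    if_pos (show charXV k.2 0 = 1 from rfl), one_smul,
    ← superMonomial_eq_single] at hspan
  exact (linearIndepOn_superMonomial.mono hK).mem_span_iff.1 hspan <|
    linearIndepOn_superMonomial.mono (Set.insert_subset hk hK)

end MonomialMembership

section MonomialActions

variable {q n : ℕ} {K : Finset ((Fin q → ℕ) × (Fin n → ℕ))}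

theorem isWeightGraded_monomialAlgebra : IsWeightGraded (monomialAlgebra K) :=
  isWeightGraded_adjoin <| by
    rintro _ ⟨k, _, rfl⟩
    exact ⟨_, _, superMonomial_eq_single k⟩

theorem parityInvolution_mem_monomialAlgebra {f : TorusRing (n + 1) q}
    (hf : f ∈ monomialAlgebra K) : parityInvolution (n + 1) q f ∈ monomialAlgebra K := by
  suffices h : monomialAlgebra K ≤ (monomialAlgebra K).comap (parityInvolution (n + 1) q) from h hf
  refine Algebra.adjoin_le ?_
  rintro _ ⟨k, hk, rfl⟩
  rw [SetLike.mem_coe, Subalgebra.mem_comap]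
  rcases parityInvolution_superMonomial k with h | h <;> rw [h]
  · exact superMonomial_mem hk
  · exact neg_mem (superMonomial_mem hk)

variable (hK : ∀ k ∈ K, ∀ i, k.1 i ≤ 1)

include hK

/-- `ξ_j ∂/∂ξ_j` is a derivation that fixes the monomials divisible by `ξ_j` and kills the
others. -/
theorem oddCoord_mul_oddDeriv_mem (j : Fin q) {f : TorusRing (n + 1) q}
    (hf : f ∈ monomialAlgebra K) : oddCoord j * oddDeriv j f ∈ monomialAlgebra K := by
  refine skewDerivation_mem_adjoin (D := LinearMap.mulLeft ℂ (oddCoord j) ∘ₗ oddDeriv j)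
    (σ := AlgHom.id ℂ _) (fun f g => ?_) (fun f hf => hf) ?_ hf
  · simp only [LinearMap.comp_apply, LinearMap.mulLeft_apply, oddDeriv_mul, AlgHom.id_apply,
      mul_add, ← mul_assoc]
    rw [oddCoord_mul j (parityInvolution (n + 1) q f), parityInvolution_parityInvolution]
  · rintro _ ⟨k, hk, rfl⟩
    change oddCoord j * oddDeriv j (superMonomial k) ∈ monomialAlgebra K
    rcases Nat.le_one_iff_eq_zero_or_eq_one.1 (hK k hk j) with hj | hj
    · rw [oddDeriv_superMonomial_eq_zero hj, mul_zero]
      exact zero_mem _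
    · rw [oddCoord_mul_oddDeriv_superMonomial hj]
      exact superMonomial_mem hk

variable {c : Fin q → Fin q → Fin n → ℂ} (hc : ∀ i j, c i j = c j i)

theorem sum_eq_zero_of_leftOdd_mem {i j : Fin q} {k : (Fin q → ℕ) × (Fin n → ℕ)} (hk : k ∈ K)
    (hj : k.1 j = 0) (hkj : (k.1 + Pi.single j 1, k.2) ∉ K)
    (hmem : (supertorusOf c hc).leftOdd i (superMonomial k) ∈ monomialAlgebra K) :
    ∑ l, (k.2 l : ℂ) * c i j l = 0 := by
  by_contra hne
  have hderiv := oddDeriv_superMonomial_eq_zero hj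
  have hproj := oddCoord_mul_oddDeriv_mem hK j hmem
  rw [leftOdd_superMonomial] at hproj
  simp only [map_sub, map_smul, map_sum, oddDeriv_oddCoord_mul, hderiv, mul_zero, sub_zero,
    oddDeriv_comm j i, map_zero, neg_zero, smul_ite, smul_zero, Finset.sum_ite_eq,
    Finset.mem_univ, if_true, mul_smul_comm, smul_smul] at hproj
  have hprod : oddCoord j * superMonomial k ∈ monomialAlgebra K :=
    ((monomialAlgebra K).toSubmodule.smul_mem_iff (mul_ne_zero (by norm_num) hne)).1 hproj
  refine hkj (mem_of_superMonomial_mem hK (fun a => ?_) ?_)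
  · rcases eq_or_ne a j with rfl | ha
    · simp [hj]
    · simpa [ha] using hK k hk a
  · rcases oddCoord_mul_superMonomial hj with h | h <;> rw [h] at hprod
    · exact hprod
    · exact neg_mem_iff.1 hprod

variable (hK_closed : ∀ k ∈ K, ∀ i, k.1 i = 1 → (k.1 - Pi.single i 1, k.2) ∈ K)

include hK_closed

theorem oddDeriv_superMonomial_mem (i : Fin q) {k : (Fin q → ℕ) × (Fin n → ℕ)} (hk : k ∈ K) :
    oddDeriv i (superMonomial k) ∈ monomialAlgebra K := by
  rcases Nat.le_one_iff_eq_zero_or_eq_one.1 (hK k hk i) with hi | hi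
  · rw [oddDeriv_superMonomial_eq_zero hi]
    exact zero_mem _
  · rcases oddDeriv_superMonomial hi with h | h <;> rw [h]
    · exact superMonomial_mem (hK_closed k hk i hi)
    · exact neg_mem (superMonomial_mem (hK_closed k hk i hi))

theorem leftOdd_mem_monomialAlgebra
    (h : ∀ i j, ∀ k ∈ K, k.1 j = 0 → (k.1 + Pi.single j 1, k.2) ∉ K →
      ∑ l, (k.2 l : ℂ) * c i j l = 0) (i : Fin q) (f : TorusRing (n + 1) q)
    (hf : f ∈ monomialAlgebra K) : (supertorusOf c hc).leftOdd i f ∈ monomialAlgebra K := by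
  refine skewDerivation_mem_adjoin ((supertorusOf c hc).leftOdd_mul i)
    (fun f hf => parityInvolution_mem_monomialAlgebra hf) ?_ hf
  rintro _ ⟨k, hk, rfl⟩
  change _ ∈ monomialAlgebra K
  rw [leftOdd_superMonomial]
  refine sub_mem (Subalgebra.smul_mem _ (sum_mem fun j _ => ?_) _)
    (oddDeriv_superMonomial_mem hK hK_closed i hk)
  rcases Nat.le_one_iff_eq_zero_or_eq_one.1 (hK k hk j) with hj | hj
  · by_cases hmem : (k.1 + Pi.single j 1, k.2) ∈ K
    · refine Subalgebra.smul_mem _ ?_ _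
      rcases oddCoord_mul_superMonomial hj with hkj | hkj <;> rw [hkj]
      · exact superMonomial_mem hmem
      · exact neg_mem (superMonomial_mem hmem)
    · rw [h i j k hk hj hmem, zero_smul]
      exact zero_mem _
  · rw [oddCoord_mul_superMonomial_eq_zero hj, smul_zero]
    exact zero_mem _

theorem exists_isToric_iff
    (hK_even : Algebra.adjoin ℂ
      {f : AddMonoidAlgebra ℂ (Fin (n + 1) → ℤ) | ∃ m : Fin n → ℕ, ((0, m) : _ × _) ∈ K ∧
        (f = AddMonoidAlgebra.single (charXV m) 1 ∨ f = AddMonoidAlgebra.single (-charXV m) 1)} = ⊤)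
    (hK_odd : ∀ i : Fin q, ∃ m : Fin n → ℕ, (Pi.single i 1, m) ∈ boundedSums K) :
    (∃ act : SupertorusAction (supertorusOf c hc) (restrictGrading (monomialAlgebra K)),
        IsToric act (monomialAlgebra K).val) ↔
      ∀ i j, ∀ k ∈ K, k.1 j = 0 → (k.1 + Pi.single j 1, k.2) ∉ K →
        ∑ l, (k.2 l : ℂ) * c i j l = 0 where
  mp := by
    rintro ⟨act, hact⟩ i j k hk hj hkj
    refine sum_eq_zero_of_leftOdd_mem hK hc hk hj hkj ?_
    exact hact.map_odd i ⟨_, superMonomial_mem hk⟩ ▸ Subtype.property _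
  mpr h := ⟨supertorusAction _ isWeightGraded_monomialAlgebra
      (leftOdd_mem_monomialAlgebra hK hc hK_closed h),
    { irreducible :=
        (monomialAlgebra_isIntegralSuperRing hK_even hK_closed hK_odd).irreducibleSpace
      supervariety := monomialAlgebra_isAffineSupervariety hK_even hK_closed hK_odd
      map_grp := fun _ _ => rfl
      map_odd := fun _ _ => rfl
      factors := ⟨⊥, Supertorus.isOddSubgroup_bot _, homogeneousRingBotHom _ _,
        fun _ => rfl, homogeneousRingBotHom_isOpenImmersion _ (evenProduct_mem K)
          (evenProduct_even K) (isUnit_evenProduct K)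
          (exists_evenProduct_pow_mul_mem hK_even hK_closed hK_odd)⟩ }⟩

end MonomialActions

end

theorem mainTheorem3 (q n : ℕ) (K : Finset ((Fin q → ℕ) × (Fin n → ℕ)))
    (hK : ∀ k ∈ K, ∀ i, k.1 i ≤ 1)
    (hK_closed : ∀ k ∈ K, ∀ i, k.1 i = 1 → (k.1 - Pi.single i 1, k.2) ∈ K)
    (hK_even : Algebra.adjoin ℂ
      {f : AddMonoidAlgebra ℂ (Fin (n + 1) → ℤ) | ∃ m : Fin n → ℕ, ((0, m) : _ × _) ∈ K ∧
        (f = AddMonoidAlgebra.single (charXV m) 1 ∨ f = AddMonoidAlgebra.single (-charXV m) 1)} = ⊤)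
    (hK_odd : ∀ i : Fin q, ∃ m : Fin n → ℕ, (Pi.single i 1, m) ∈ boundedSums K) :
    IsToricSupervariety (restrictGrading (monomialAlgebra K)) ∧
    ∀ (c : Fin q → Fin q → Fin n → ℂ) (hc : ∀ i j, c i j = c j i),
      ((∃ act : SupertorusAction (supertorusOf c hc) (restrictGrading (monomialAlgebra K)),
          IsToric act (monomialAlgebra K).val) ↔
        ∀ i j, ∀ k ∈ K, k.1 j = 0 → (k.1 + Pi.single j 1, k.2) ∉ K →
          ∑ l, (k.2 l : ℂ) * c i j l = 0) ∧
      ((∃ act : SupertorusAction (supertorusOf c hc) (restrictGrading (monomialAlgebra K)),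
          IsToric act (monomialAlgebra K).val) →
        ∀ i j, ∀ k ∈ K, k.1 j = 0 → (k.1 + Pi.single j 1, k.2) ∉ boundedSums K →
          ∑ l, (k.2 l : ℂ) * c i j l = 0) := by
  have key c hc := exists_isToric_iff (c := c) hK hc hK_closed hK_even hK_odd
  refine ⟨?_, fun c hc => ⟨key c hc, fun hact i j k hk hj hkj =>
    (key c hc).1 hact i j k hk hj fun hmem =>
      hkj ⟨AddSubmonoid.subset_closure hmem, hK _ hmem⟩⟩⟩
  obtain ⟨act, hact⟩ := (key 0 fun _ _ => rfl).2 (by simp)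
  exact ⟨n + 1, q, _, act, _, hact⟩
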